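/- Let $a\ge 2$ and $d\ge 1$. For $i=1,\dots,a$ and $k=1,2,\dots$ let $X_{ik}=\mu_i+\epsilon_{ik}$ with $\mu_i\in\mathbb R^d$, where the random vectors $\epsilon_{ik}=(\epsilon_{ikj})_{j=1}^d$ are independent, have mean zero and finite second moments, for fixed $i$ and $j$ the variables $\epsilon_{ikj}$ ($k\ge1$) are identically distributed, and $\Sigma_i=\operatorname{Var}(\epsilon_{ik})$ does not depend on $k$. At total sample size $N=\sum_{i=1}^a n_i$ one observes $X_{ik}$, $k\le n_i$, where $n_i=n_i(N)$ and $n_i/N\to\kappa_i\in(0,1]$ for each $i$ as $N\to\infty$. Let $P_a=I_a-\mathbf 1_a\mathbf 1_a^\top/a$, let $\overline X^{(j)}\in\mathbb R^a$ be the vector of the $a$ group means of the $j$-th component, let $\Sigma^{(j)}=\operatorname{diag}(\kappa_1^{-1}(\Sigma_1)_{jj},\dots,\kappa_a^{-1}(\Sigma_a)_{jj})$, let $\widehat\Sigma_i=\frac1{n_i-1}\sum_{k=1}^{n_i}(X_{ik}-\overline X_{i\cdot})(X_{ik}-\overline X_{i\cdot})^\top$, where $\overline X_{i\cdot}=\frac1{n_i}\sum_{k=1}^{n_i}X_{ik}$,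 and let $\widehat\Sigma=N\bigoplus_{i=1}^a n_i^{-1}\widehat\Sigma_i$ and $\widehat\Sigma^{(j)}=N\operatorname{diag}(n_1^{-1}(\widehat\Sigma_1)_{jj},\dots,n_a^{-1}(\widehat\Sigma_a)_{jj})$. Let $\widetilde M$ be a matrix-valued function such that $S\mapsto\widetilde M(P_a,S)\in\mathbb R^{a\times a}$ is measurable and is symmetric positive semidefinite for positive semidefinite $S$. Let $\widetilde\Sigma^{(j)}$ be estimators with $\widetilde\Sigma^{(j)}\to\Sigma^{(j)}$ in probability, and assume that $\widetilde M(P_a,\widetilde\Sigma^{(j)})$ and $\widetilde M(P_a,\widehat\Sigma^{(j)})$ converge to $\widetilde M(P_a,\Sigma^{(j)})$ in probability as $N\to\infty$. For $S,M\in\mathbb R^{a\times a}$ put $v(M,S)=2\operatorname{tr}([P_a^\top MP_aS]^2)$, and assume $v(\widetilde M(P_a,\Sigma^{(j)}),\Sigma^{(j)})>0$ for all $j=1,\dots,d$. For $u\in\mathbb R^a$ and $S\in\mathbb R^{a\times a}$ put $$q(u,S)=\frac{(P_au)^\top\widetilde M(P_a,S)(P_au)}{\sqrt{v(\widetilde M(P_a,S),S)}}\quad\text{if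 } v(\widetilde M(P_a,S),S)>0,\qquad q(u,S)=0\quad\text{otherwise.}$$ The test statistics are $\widetilde Q_{Nj}=N\,q(\overline X^{(j)},\widetilde\Sigma^{(j)})$, $j=1,\dots,d$. Monte-Carlo replicates: given the data of total sample size $N$, let $Z_1,\dots,Z_B$ be independent with distribution $\mathcal N_{ad}(0,\widehat\Sigma)$, let $Z_b^{(j)}\in\mathbb R^a$ be the vector of the entries of $Z_b$ that belong to component $j$ in the $a$ groups, and let $\widetilde Q^{MC,b}_j=q(Z_b^{(j)},\widehat\Sigma^{(j)})$. Critical values: for $\alpha\in(0,1)$ and $p\in(0,1]$ let $\widehat q_j(p)=\inf\{t:\#\{b:\widetilde Q^{MC,b}_j\le t\}\ge pB\}$ be the empirical $p$-quantile of the $j$-th component of the replicates, let $$\widehat\beta=\max\Big\{\beta\in\{0,\tfrac1B,\dots,\tfrac{B-1}B\}:\ \tfrac1B\,\#\{b:\exists j,\ \widetilde Q^{MC,b}_j>\widehat q_j(1-\beta)\}\le\alpha\Big\},$$ and put $\widetilde q^{MC}_{j,B}=\widehat q_j(1-\widehat\beta)$. In quotients $\widetilde Q_{Nj}/\widetilde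 q^{MC}_{j,B}$ let $0/0:=1$ and $x/0:=\infty$ for $x>0$. Then, for every sequence $B_N\to\infty$, the test $$\varphi^{MC}_{\widetilde Q}(N,B)=\max_{j=1,\dots,d}\mathbf 1\{\widetilde Q_{Nj}/\widetilde q^{MC}_{j,B}>1\}$$ is an asymptotically correct level-$\alpha$ test of the global hypothesis $\mu_1=\dots=\mu_a$: under this hypothesis $$\lim_{N\to\infty}\mathbb E\big[\varphi^{MC}_{\widetilde Q}(N,B_N)\big]=\alpha .$$ Moreover, it controls the family-wise error rate asymptotically in the strong sense: for every (not necessarily globally null) $\mu_1,\dots,\mu_a$ and every set $\mathcal T\subset\{1,\dots,d\}$ of indices $j$ of true local hypotheses $\mu_{1j}=\dots=\mu_{aj}$, the following limit exists and $$\lim_{N\to\infty}\mathbb E\Big[\max_{j\in\mathcal T}\mathbf 1\{\widetilde Q_{Nj}/\widetilde q^{MC}_{j,B_N}>1\}\Big]\le\alpha$$ (the maximum over the empty set being $0$). -/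

import Mathlib

open MeasureTheory ProbabilityTheory Filter Topology
open scoped Matrix NNReal ENNReal

noncomputable section

namespace QFMCT

/-! ### Data, means and empirical covariance matrices -/

/-- A data set: in group `i` there are `n i` subjects, each with a `d`-variate observation. -/
abbrev Sample {a : ℕ} (d : ℕ) (n : Fin a → ℕ) : Type :=
  (i : Fin a) → Fin (n i) → Fin d → ℝ

/-- The centering matrix `P_a = I_a - 1_a 1_aᵀ / a`. -/
def centering (a : ℕ) : Matrix (Fin a) (Fin a) ℝ :=
  1 - (a : ℝ)⁻¹ • Matrix.of (fun _ _ => (1 : ℝ))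

/-- The total sample size. -/
def totalSize {a : ℕ} (n : Fin a → ℕ) : ℕ := ∑ i, n i

/-- The mean vector of group `i`. -/
def groupMean {a d : ℕ} {n : Fin a → ℕ} (x : Sample d n) (i : Fin a) : Fin d → ℝ :=
  fun j => (n i : ℝ)⁻¹ * ∑ k, x i k j

/-- The component-wise mean vector: the means of the `j`-th component in the `a` groups. -/
def compMean {a d : ℕ} {n : Fin a → ℕ} (x : Sample d n) (j : Fin d) : Fin a → ℝ :=
  fun i => groupMean x i j

/-- The empirical covariance matrix of group `i`. -/
def empCov {a d : ℕ} {n : Fin a → ℕ} (x : Sample d n) (i : Fin a) : Matrix (Fin d) (Fin d) ℝ :=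
  ((n i : ℝ) - 1)⁻¹ •
    ∑ k, Matrix.vecMulVec (x i k - groupMean x i) (x i k - groupMean x i)

/-- The block diagonal matrix `N ⊕ᵢ nᵢ⁻¹ Σ̂ᵢ`. The pair `(j, i)` stands for component `j` in
group `i`. -/
def empCovFull {a d : ℕ} {n : Fin a → ℕ} (x : Sample d n) :
    Matrix (Fin d × Fin a) (Fin d × Fin a) ℝ :=
  (totalSize n : ℝ) • Matrix.blockDiagonal (fun i => (n i : ℝ)⁻¹ • empCov x i)

/-- The diagonal matrix `N diag(n₁⁻¹ (Σ̂₁)ⱼⱼ, …, n_a⁻¹ (Σ̂_a)ⱼⱼ)`. -/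
def empCovComp {a d : ℕ} {n : Fin a → ℕ} (x : Sample d n) (j : Fin d) :
    Matrix (Fin a) (Fin a) ℝ :=
  (totalSize n : ℝ) • Matrix.diagonal (fun i => (n i : ℝ)⁻¹ * empCov x i j j)

/-- The diagonal matrix `diag(κ₁⁻¹ (Σ₁)ⱼⱼ, …, κ_a⁻¹ (Σ_a)ⱼⱼ)`, the limit covariance matrix of
the `j`-th component-wise mean vector. -/
def limCovComp {a d : ℕ} (κ : Fin a → ℝ) (Sig : Fin a → Matrix (Fin d) (Fin d) ℝ) (j : Fin d) :
    Matrix (Fin a) (Fin a) ℝ :=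
  Matrix.diagonal (fun i => (κ i)⁻¹ * Sig i j j)

/-! ### Standardized quadratic forms -/

/-- `2 tr([P_aᵀ M P_a S]²)` -/
def variance {a : ℕ} (M S : Matrix (Fin a) (Fin a) ℝ) : ℝ :=
  2 * (((centering a)ᵀ * M * centering a * S) ^ 2).trace

/-- The standardized quadratic form `[P_a u]ᵀ M [P_a u] / √(2 tr([P_aᵀ M P_a S]²))`, set to `0`
unless the trace is positive. -/
def quadForm {a : ℕ} (M S : Matrix (Fin a) (Fin a) ℝ) (u : Fin a → ℝ) : ℝ :=
  if 0 < variance M S then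
    ((centering a *ᵥ u) ⬝ᵥ (M *ᵥ (centering a *ᵥ u))) / √(variance M S)
  else 0

/-- The test statistic of the `j`-th local hypothesis, for the data `x`, the matrix function `M`
(of the hypothesis matrix and a covariance matrix) and the value `S` of the estimator of the
covariance matrix. -/
def testStat {a d : ℕ} {n : Fin a → ℕ}
    (M : Matrix (Fin a) (Fin a) ℝ → Matrix (Fin a) (Fin a) ℝ → Matrix (Fin a) (Fin a) ℝ)
    (S : Matrix (Fin a) (Fin a) ℝ) (x : Sample d n) (j : Fin d) : ℝ :=
  (totalSize n : ℝ) * quadForm (M (centering a) S) S (compMean x j)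

/-- One Monte-Carlo replicate, computed from the data `x` and a draw `z` of the
`N(0, Σ̂)`-distribution (`z (j, i)` is component `j` in group `i`). It is the test statistic with
the empirical covariance matrix as estimator and with `z / √N` in place of the mean vector. -/
def mcStat {a d : ℕ} {n : Fin a → ℕ}
    (M : Matrix (Fin a) (Fin a) ℝ → Matrix (Fin a) (Fin a) ℝ → Matrix (Fin a) (Fin a) ℝ)
    (x : Sample d n) (z : EuclideanSpace ℝ (Fin d × Fin a)) (j : Fin d) : ℝ :=
  quadForm (M (centering a) (empCovComp x j)) (empCovComp x j) (fun i => z (j, i))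

/-! ### Critical values from replicates -/

/-- The empirical `p`-quantile `inf {t : F_B(t) ≥ p}` of `B` real numbers with empirical
distribution function `F_B`. -/
def empQuantile {B : ℕ} (y : Fin B → ℝ) (p : ℝ) : ℝ :=
  sInf {t : ℝ | p ≤ ((Finset.univ.filter (fun b => y b ≤ t)).card : ℝ) / B}

open scoped Classical in
/-- The proportion of the replicates for which some component exceeds its own empirical
`(1 - β)`-quantile: the estimated family-wise error rate at local level `β`. -/
def estFWER {B d : ℕ} (y : Fin B → Fin d → ℝ) (β : ℝ) : ℝ :=
  ((Finset.univ.filter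
    (fun b => ∃ j, empQuantile (fun b' => y b' j) (1 - β) < y b j)).card : ℝ) / B

/-- The largest local level `β ∈ {0, 1/B, …, (B-1)/B}` with estimated family-wise error rate at
most `α` (for `B ≥ 1` the supremum is over a finite nonempty set). -/
def localLevel {B d : ℕ} (y : Fin B → Fin d → ℝ) (α : ℝ) : ℝ :=
  sSup {β : ℝ | (∃ k : ℕ, k < B ∧ β = (k : ℝ) / B) ∧ estFWER y β ≤ α}

/-- The critical value of component `j`: its empirical quantile at the common local level. -/
def critValue {B d : ℕ} (y : Fin B → Fin d → ℝ) (α : ℝ) (j : Fin d) : ℝ :=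
  empQuantile (fun b => y b j) (1 - localLevel y α)

/-! ### The test -/

/-- The quotient of two nonnegative reals, with `0 / 0 = 1` and `x / 0 = ∞` for `x > 0`. -/
def ratio (x y : ℝ) : ℝ≥0∞ :=
  if x = 0 ∧ y = 0 then 1 else ENNReal.ofReal x / ENNReal.ofReal y

open scoped Classical in
/-- The maximum over `j ∈ T` of the indicators of `Q j / q j > 1` (`0` for empty `T`). -/
def maxReject {d : ℕ} (T : Finset (Fin d)) (Q q : Fin d → ℝ) : ℝ≥0 :=
  T.sup (fun j => if 1 < ratio (Q j) (q j) then 1 else 0)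

/-- The rejection indicator for the local hypotheses in `T`, of the test with Monte-Carlo critical
values, as a function of the data `x`, the estimates `S j` of the covariance matrices and the
Monte-Carlo draws `z`. For `T = Finset.univ` it is the test of the global hypothesis. -/
def mcTest {a d B : ℕ} {n : Fin a → ℕ} (T : Finset (Fin d)) (α : ℝ)
    (M : Matrix (Fin a) (Fin a) ℝ → Matrix (Fin a) (Fin a) ℝ → Matrix (Fin a) (Fin a) ℝ)
    (S : Fin d → Matrix (Fin a) (Fin a) ℝ) (x : Sample d n)
    (z : Fin B → EuclideanSpace ℝ (Fin d × Fin a)) : ℝ≥0 :=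
  maxReject T (fun j => testStat M (S j) x j) (critValue (fun b => mcStat M x (z b)) α)

/-! ### The model -/

/-- The data set of the observations `X_{ik} = μ_i + ε_{ik}`, `k < n i`. -/
def observed {Ω : Type*} {a d : ℕ} (mean : Fin a → Fin d → ℝ)
    (ε : Fin a → ℕ → Ω → Fin d → ℝ) (n : Fin a → ℕ) (ω : Ω) : Sample d n :=
  fun i k => mean i + ε i k ω

/-- Entry-wise convergence in probability of random matrices to a fixed matrix. -/
def TendstoInProb {Ω : Type*} [MeasurableSpace Ω] {a : ℕ} (P : Measure Ω)
    (A : ℕ → Ω → Matrix (Fin a) (Fin a) ℝ) (A₀ : Matrix (Fin a) (Fin a) ℝ) : Prop :=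
  ∀ r s, TendstoInMeasure P (fun N ω => A N ω r s) atTop (fun _ => A₀ r s)

end QFMCT

end

noncomputable section

namespace QFMCT

/-! ### Empirical distribution functions and quantiles -/

/-! Let `ν` be the law of the vector of standardized quadratic forms in the Gaussian limit of the
scaled group means. The statistics of true local hypotheses converge jointly to the corresponding
components of `ν`, and given the data the replicates are i.i.d. from a law that approaches `ν`. The
theorem follows by a squeeze in the local level.

Statistics: the centering matrix annihilates a mean that is common to all groups, so a statistic of
a true hypothesis is a quadratic form in the scaled error means. Their central limit theorem,
`tendstoInDistribution_scaledErrorMean`, is proved with characteristic functions. Within a group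
only the marginal laws and the covariance matrix are constant; the joint law of an error vector may
change with the subject. Taylor remainders are therefore dominated by remainders of single
components. Slutsky and the portmanteau theorem then give `tendsto_measure_testStat_mem_exceed`.

Replicates: the empirical covariance matrices are consistent by a weak law, Gaussian exceedance
probabilities depend continuously on the covariance and the matrices of the forms, and Chebyshev's
inequality given the data compares proportions with probabilities. This is `empConsistent_mcStat`.

Squeeze: the limit family-wise error rate of all components at local level `β` is continuous and
strictly increasing on `(0, 1)`, and it equals `α` at some `β`. Strict monotonicity pins
`localLevel` near this `β`, hence the critical values lie between marginal quantiles of `ν` at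
neighbouring levels, and the rejection probability for `T` tends to `fwer T β ≤ fwer univ β = α`
(`EmpConsistent.tendsto_measure_reject`). The replicates are centred whatever the true means are,
which is why the control is strong.

Regularity of `ν` needs care because the limit covariance may be singular, so that no density is at
hand. The Gaussian vector is written as a linear image of a standard one. Level sets are null
because a nonconstant quadratic polynomial in one coordinate has finitely many roots; mass between
nested orthants comes from scaling a point (`regularLimit_map_quadForms_stdGaussian`). -/

/-- The empirical distribution function of `B` real numbers. -/
def empCdf {B : ℕ} (y : Fin B → ℝ) (t : ℝ) : ℝ :=
  ((Finset.univ.filter (fun b => y b ≤ t)).card : ℝ) / B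

open scoped Classical in
/-- The proportion of the vectors `y b` which exceed the threshold `t` in a component in `T`. -/
def empExceed {B d : ℕ} (T : Finset (Fin d)) (t : Fin d → ℝ) (y : Fin B → Fin d → ℝ) : ℝ :=
  ((Finset.univ.filter (fun b => ∃ j ∈ T, t j < y b j)).card : ℝ) / B

lemma empCdf_mono {B : ℕ} (y : Fin B → ℝ) : Monotone (empCdf y) := by
  intro s t hst
  unfold empCdf
  gcongr

/-- Marginal distribution functions are exceedance proportions for a singleton, so consistency of
`empExceed` for all `T` covers the quantiles as well. -/
lemma empCdf_eq_one_sub_empExceed {B d : ℕ} (hB : 0 < B) (y : Fin B → Fin d → ℝ) (j : Fin d)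
    (t : Fin d → ℝ) : empCdf (fun b => y b j) (t j) = 1 - empExceed {j} t y := by
  have hB' : (B : ℝ) ≠ 0 := by positivity
  unfold empCdf empExceed
  have h := Finset.card_filter_add_card_filter_not (s := (Finset.univ : Finset (Fin B)))
    (fun b => y b j ≤ t j)
  rw [eq_sub_iff_add_eq, ← add_div, div_eq_one_iff_eq hB']
  have : (Finset.univ.filter (fun b => ∃ j' ∈ ({j} : Finset (Fin d)), t j' < y b j'))
      = Finset.univ.filter (fun b => ¬ y b j ≤ t j) := by
    ext b; simp
  rw [this]
  rw [Finset.card_univ, Fintype.card_fin] at h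
  exact_mod_cast h

/-- The infimum is attained: the distribution function jumps only at sample points, so every
admissible threshold dominates an admissible sample point, and there are finitely many of these.
Positivity of `p` bounds the set below and `p ≤ 1` makes it nonempty. All later facts on quantiles,
measurability included, go through this equivalence. -/
lemma empQuantile_le_iff {B : ℕ} (hB : 0 < B) (y : Fin B → ℝ) {p : ℝ} (hp : p ∈ Set.Ioc (0 : ℝ) 1)
    (t : ℝ) : empQuantile y p ≤ t ↔ p ≤ empCdf y t := by
  have hB' : (0 : ℝ) < B := by positivity
  have : Nonempty (Fin B) := ⟨⟨0, hB⟩⟩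
  set A : Set ℝ := {t : ℝ | p ≤ empCdf y t} with hA
  have hQ : empQuantile y p = sInf A := rfl
  have hup : ∀ s ∈ A, ∀ s', s ≤ s' → s' ∈ A := fun s hs s' h => le_trans hs (empCdf_mono y h)
  have hne : A.Nonempty := by
    refine ⟨Finset.univ.sup' Finset.univ_nonempty y, ?_⟩
    have : Finset.univ.filter (fun b => y b ≤ Finset.univ.sup' Finset.univ_nonempty y)
        = Finset.univ :=
      Finset.filter_true_of_mem fun b hb => Finset.le_sup' y hb
    simp only [hA, Set.mem_ofPred_eq, empCdf, this, Finset.card_univ, Fintype.card_fin]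
    rw [div_self hB'.ne']
    exact hp.2
  have hval : ∀ s ∈ A, ∃ b, y b ≤ s ∧ y b ∈ A := by
    intro s hs
    have hne' : (Finset.univ.filter (fun b => y b ≤ s)).Nonempty := by
      rw [← Finset.card_pos]
      by_contra h0
      have : empCdf y s = 0 := by simp [empCdf, Nat.eq_zero_of_not_pos h0]
      have : p ≤ 0 := this ▸ hs
      linarith [hp.1]
    obtain ⟨b, hb, hmax⟩ := Finset.exists_max_image _ y hne'
    refine ⟨b, (Finset.mem_filter.1 hb).2, ?_⟩
    have : Finset.univ.filter (fun b' => y b' ≤ s) = Finset.univ.filter (fun b' => y b' ≤ y b) := by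
      ext b'
      simp only [Finset.mem_filter, Finset.mem_univ, true_and]
      exact ⟨fun h => hmax b' (by simpa using h), fun h => h.trans (Finset.mem_filter.1 hb).2⟩
    have hs' : p ≤ empCdf y s := hs
    simp only [hA, Set.mem_ofPred_eq, empCdf] at hs' ⊢
    rwa [← this]
  have hbdd : BddBelow A := by
    refine ⟨Finset.univ.inf' Finset.univ_nonempty y, fun s hs => ?_⟩
    obtain ⟨b, hb, -⟩ := hval s hs
    exact (Finset.inf'_le y (Finset.mem_univ b)).trans hb
  have hmem : sInf A ∈ A := by
    have hfin : (A ∩ Set.range y).Finite := (Set.finite_range y).subset Set.inter_subset_right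
    have hne2 : (A ∩ Set.range y).Nonempty := by
      obtain ⟨s, hs⟩ := hne
      obtain ⟨b, -, hb⟩ := hval s hs
      exact ⟨y b, hb, b, rfl⟩
    have hle : sInf (A ∩ Set.range y) ≤ sInf A := by
      refine le_csInf hne fun s hs => ?_
      obtain ⟨b, hb, hb'⟩ := hval s hs
      exact (csInf_le (hbdd.mono Set.inter_subset_left)
        (⟨hb', ⟨b, rfl⟩⟩ : y b ∈ A ∩ Set.range y)).trans hb
    exact hup _ (hne2.csInf_mem hfin).1 _ hle
  rw [hQ]
  exact ⟨fun h => hup _ hmem _ h, fun h => csInf_le hbdd h⟩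

lemma lt_empQuantile_iff {B : ℕ} (hB : 0 < B) (y : Fin B → ℝ) {p : ℝ} (hp : p ∈ Set.Ioc (0 : ℝ) 1)
    (t : ℝ) : t < empQuantile y p ↔ empCdf y t < p := by
  rw [← not_le, empQuantile_le_iff hB y hp, not_le]

lemma empQuantile_mono {B : ℕ} (hB : 0 < B) (y : Fin B → ℝ) {p q : ℝ}
    (hp : p ∈ Set.Ioc (0 : ℝ) 1) (hq : q ∈ Set.Ioc (0 : ℝ) 1) (h : p ≤ q) :
    empQuantile y p ≤ empQuantile y q := by
  rw [empQuantile_le_iff hB y hp]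
  exact h.trans ((empQuantile_le_iff hB y hq _).1 le_rfl)

lemma empExceed_anti {B d : ℕ} (T : Finset (Fin d)) (y : Fin B → Fin d → ℝ) {s t : Fin d → ℝ}
    (h : ∀ j ∈ T, s j ≤ t j) : empExceed T t y ≤ empExceed T s y := by
  unfold empExceed
  gcongr with b _ j hj
  exact h j hj

lemma estFWER_eq {B d : ℕ} (y : Fin B → Fin d → ℝ) (β : ℝ) :
    estFWER y β
      = empExceed Finset.univ (fun j => empQuantile (fun b => y b j) (1 - β)) y := by
  simp [estFWER, empExceed]

lemma estFWER_mono {B d : ℕ} (hB : 0 < B) (y : Fin B → Fin d → ℝ) {β γ : ℝ} (hβ : 0 ≤ β)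
    (hγ : γ < 1) (h : β ≤ γ) : estFWER y β ≤ estFWER y γ := by
  rw [estFWER_eq, estFWER_eq]
  refine empExceed_anti _ _ fun j _ => empQuantile_mono hB _ ?_ ?_ ?_
  · constructor <;> linarith
  · constructor <;> linarith
  · linarith

/-- The empirical `1`-quantile is at least the sample maximum, so nothing exceeds it. Hence level
`0` is always admissible in `localLevel`. -/
lemma estFWER_zero {B d : ℕ} (hB : 0 < B) (y : Fin B → Fin d → ℝ) : estFWER y 0 = 0 := by
  have : Nonempty (Fin B) := ⟨⟨0, hB⟩⟩
  have hB' : (B : ℝ) ≠ 0 := by positivity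
  rw [estFWER_eq, sub_zero]
  unfold empExceed
  rw [div_eq_zero_iff]
  left
  rw [Nat.cast_eq_zero, Finset.card_eq_zero, Finset.filter_eq_empty_iff]
  rintro b - ⟨j, -, hlt⟩
  rw [← not_le] at hlt
  apply hlt
  have h1 := (empQuantile_le_iff hB (fun b => y b j) (p := 1) (by simp) _).1 le_rfl
  have h2 : (Finset.univ.filter (fun b' => y b' j ≤ empQuantile (fun b => y b j) 1)) =
      Finset.univ := by
    rw [← Finset.card_eq_iff_eq_univ]
    refine le_antisymm (Finset.card_le_univ _) ?_
    rw [empCdf, le_div_iff₀ (by positivity), one_mul] at h1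
    rw [Fintype.card_fin]
    exact_mod_cast h1
  have h3 : b ∈ Finset.univ.filter (fun b' => y b' j ≤ empQuantile (fun b => y b j) 1) := by
    rw [h2]; exact Finset.mem_univ b
  exact (Finset.mem_filter.1 h3).2

/-! ### The local level and the critical values -/

lemma localLevel_aux {B d : ℕ} (hB : 0 < B) (y : Fin B → Fin d → ℝ) {α : ℝ} (hα : 0 ≤ α) :
    BddAbove {β : ℝ | (∃ k : ℕ, k < B ∧ β = (k : ℝ) / B) ∧ estFWER y β ≤ α} ∧
    (0 : ℝ) ∈ {β : ℝ | (∃ k : ℕ, k < B ∧ β = (k : ℝ) / B) ∧ estFWER y β ≤ α} := by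
  refine ⟨⟨1, ?_⟩, ⟨0, hB, by simp⟩, by rw [estFWER_zero hB]; exact hα⟩
  rintro β ⟨⟨k, hk, rfl⟩, -⟩
  rw [div_le_one (by positivity)]
  exact_mod_cast hk.le

lemma localLevel_nonneg {B d : ℕ} (hB : 0 < B) (y : Fin B → Fin d → ℝ) {α : ℝ} (hα : 0 ≤ α) :
    0 ≤ localLevel y α :=
  le_csSup (localLevel_aux hB y hα).1 (localLevel_aux hB y hα).2

lemma localLevel_le_iff {B d : ℕ} (hB : 0 < B) (y : Fin B → Fin d → ℝ) {α : ℝ} (hα : 0 ≤ α)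
    (c : ℝ) : localLevel y α ≤ c ↔
      ∀ k : ℕ, k < B → estFWER y ((k : ℝ) / B) ≤ α → (k : ℝ) / B ≤ c := by
  unfold localLevel
  rw [csSup_le_iff (localLevel_aux hB y hα).1 ⟨0, (localLevel_aux hB y hα).2⟩]
  constructor
  · exact fun h k hk hk' => h _ ⟨⟨k, hk, rfl⟩, hk'⟩
  · rintro h _ ⟨⟨k, hk, rfl⟩, hk'⟩
    exact h k hk hk'

/-- The grid stops at `(B - 1) / B`. This keeps `1 - localLevel` positive, as the characterisation
of the quantile requires. -/
lemma localLevel_lt_one {B d : ℕ} (hB : 0 < B) (y : Fin B → Fin d → ℝ) {α : ℝ} (hα : 0 ≤ α) :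
    localLevel y α < 1 := by
  have hB' : (0 : ℝ) < B := by positivity
  have : localLevel y α ≤ 1 - 1 / B := by
    rw [localLevel_le_iff hB y hα]
    intro k hk _
    rw [div_le_iff₀ hB', sub_mul, div_mul_cancel₀ _ hB'.ne', one_mul]
    have : ((k + 1 : ℕ) : ℝ) ≤ B := by exact_mod_cast hk
    push_cast at this
    linarith
  have : 0 < 1 / (B : ℝ) := by positivity
  linarith

lemma one_sub_localLevel_mem {B d : ℕ} (hB : 0 < B) (y : Fin B → Fin d → ℝ) {α : ℝ}
    (hα : 0 ≤ α) : 1 - localLevel y α ∈ Set.Ioc (0 : ℝ) 1 := by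
  have h1 := localLevel_nonneg hB y hα
  have h2 := localLevel_lt_one hB y hα
  constructor <;> linarith

lemma localLevel_le_of_lt_estFWER {B d : ℕ} (hB : 0 < B) (y : Fin B → Fin d → ℝ) {α β : ℝ}
    (hα : 0 ≤ α) (hβ : 0 ≤ β) (h : α < estFWER y β) : localLevel y α ≤ β := by
  rw [localLevel_le_iff hB y hα]
  intro k hk hk'
  by_contra hlt
  rw [not_le] at hlt
  have hk1 : (k : ℝ) / B < 1 := by
    rw [div_lt_one (by positivity)]; exact_mod_cast hk
  exact absurd (h.trans_le (estFWER_mono hB y hβ hk1 hlt.le)) (not_lt.2 hk')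

/-- The loss `1 / B` is the price of rounding `β` down to the grid point `⌊β * B⌋₊ / B`, which stays
admissible by monotonicity. -/
lemma le_localLevel_of_estFWER_le {B d : ℕ} (hB : 0 < B) (y : Fin B → Fin d → ℝ) {α β : ℝ}
    (hα : 0 ≤ α) (hβ : 0 ≤ β) (hβ1 : β < 1) (h : estFWER y β ≤ α) :
    β - 1 / B ≤ localLevel y α := by
  have hB' : (0 : ℝ) < B := by positivity
  have h0 : 0 ≤ β * B := by positivity
  have hle : (⌊β * B⌋₊ : ℝ) / B ≤ β := by
    rw [div_le_iff₀ hB']; exact Nat.floor_le h0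
  have hlt : ⌊β * B⌋₊ < B := by
    rw [Nat.floor_lt h0]; nlinarith
  have h1 : (⌊β * B⌋₊ : ℝ) / B ≤ localLevel y α :=
    le_csSup (localLevel_aux hB y hα).1
      ⟨⟨_, hlt, rfl⟩, (estFWER_mono hB y (by positivity) hβ1 hle).trans h⟩
  refine le_trans ?_ h1
  rw [le_div_iff₀ hB', sub_mul, div_mul_cancel₀ _ hB'.ne']
  linarith [Nat.lt_floor_add_one (β * B)]

lemma critValue_le_iff {B d : ℕ} (hB : 0 < B) (y : Fin B → Fin d → ℝ) {α : ℝ} (hα : 0 ≤ α)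
    (j : Fin d) (t : ℝ) :
    critValue y α j ≤ t ↔ 1 - localLevel y α ≤ empCdf (fun b => y b j) t :=
  empQuantile_le_iff hB _ (one_sub_localLevel_mem hB y hα) t

/-- For a positive critical value the conventions for division by zero play no role. Critical values
are positive with probability tending to one. -/
lemma one_lt_ratio_iff {x q : ℝ} (hq : 0 < q) : 1 < ratio x q ↔ q < x := by
  unfold ratio
  rw [if_neg (by rintro ⟨-, h⟩; exact hq.ne' h)]
  rw [ENNReal.lt_div_iff_mul_lt (Or.inl (by simpa using hq)) (Or.inl ENNReal.ofReal_ne_top),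
    one_mul, ENNReal.ofReal_lt_ofReal_iff_of_nonneg hq.le]

/-! ### Measurability -/

@[fun_prop]
lemma measurable_empCdf {X : Type*} [MeasurableSpace X] {B : ℕ} {f : X → Fin B → ℝ}
    {g : X → ℝ} (hf : Measurable f) (hg : Measurable g) :
    Measurable (fun x => empCdf (f x) (g x)) := by
  unfold empCdf
  simp_rw [Finset.card_filter, Nat.cast_sum, Nat.cast_ite]
  refine Measurable.div_const (Finset.measurable_sum _ fun b _ => ?_) _
  exact Measurable.ite (measurableSet_le (by fun_prop) hg) measurable_const measurable_const

lemma measurable_empExceed {X : Type*} [MeasurableSpace X] {B d : ℕ} (T : Finset (Fin d))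
    {f : X → Fin B → Fin d → ℝ} {g : X → Fin d → ℝ} (hf : Measurable f) (hg : Measurable g) :
    Measurable (fun x => empExceed T (g x) (f x)) := by
  classical
  unfold empExceed
  simp_rw [Finset.card_filter, Nat.cast_sum, Nat.cast_ite]
  refine Measurable.div_const (Finset.measurable_sum _ fun b _ => ?_) _
  refine Measurable.ite ?_ measurable_const measurable_const
  have : {x | ∃ j ∈ T, g x j < f x b j} = ⋃ j ∈ T, {x | g x j < f x b j} := by ext; simp
  rw [this]
  exact Finset.measurableSet_biUnion _ fun j _ => measurableSet_lt (by fun_prop) (by fun_prop)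

lemma measurable_empQuantile {B : ℕ} (hB : 0 < B) {p : ℝ} (hp : p ∈ Set.Ioc (0 : ℝ) 1) :
    Measurable (fun y : Fin B → ℝ => empQuantile y p) := by
  refine measurable_of_Iic fun t => ?_
  have : (fun y : Fin B → ℝ => empQuantile y p) ⁻¹' Set.Iic t = {y | p ≤ empCdf y t} := by
    ext y; exact empQuantile_le_iff hB y hp t
  rw [this]
  exact measurableSet_le measurable_const (by fun_prop)

lemma measurable_estFWER {B d : ℕ} (hB : 0 < B) {β : ℝ} (hβ : β ∈ Set.Ico (0 : ℝ) 1) :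
    Measurable (fun y : Fin B → Fin d → ℝ => estFWER y β) := by
  simp_rw [estFWER_eq]
  refine measurable_empExceed _ measurable_id (measurable_pi_lambda _ fun j => ?_)
  have hp : 1 - β ∈ Set.Ioc (0 : ℝ) 1 := ⟨by linarith [hβ.2], by linarith [hβ.1]⟩
  exact (measurable_empQuantile hB hp).comp (by fun_prop)

lemma measurable_localLevel {B d : ℕ} (hB : 0 < B) {α : ℝ} (hα : 0 ≤ α) :
    Measurable (fun y : Fin B → Fin d → ℝ => localLevel y α) := by
  refine measurable_of_Iic fun c => ?_
  have : (fun y : Fin B → Fin d → ℝ => localLevel y α) ⁻¹' Set.Iic c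
      = ⋂ k ∈ Finset.range B, {y | estFWER y ((k : ℝ) / B) ≤ α → (k : ℝ) / B ≤ c} := by
    ext y
    simp only [Set.mem_preimage, Set.mem_Iic, localLevel_le_iff hB y hα, Set.mem_iInter,
      Finset.mem_range, Set.mem_ofPred_eq]
  rw [this]
  refine Finset.measurableSet_biInter _ fun k hk => ?_
  have hk : (k : ℝ) < B := by exact_mod_cast Finset.mem_range.1 hk
  have hm : MeasurableSet {y : Fin B → Fin d → ℝ | estFWER y ((k : ℝ) / B) ≤ α} := by
    refine measurableSet_le (measurable_estFWER hB ⟨by positivity, ?_⟩) measurable_const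
    rwa [div_lt_one (by positivity)]
  exact hm.imp (MeasurableSet.const _)

lemma measurable_critValue {B d : ℕ} (hB : 0 < B) {α : ℝ} (hα : 0 ≤ α) (j : Fin d) :
    Measurable (fun y : Fin B → Fin d → ℝ => critValue y α j) := by
  refine measurable_of_Iic fun t => ?_
  have : (fun y : Fin B → Fin d → ℝ => critValue y α j) ⁻¹' Set.Iic t
      = {y | 1 - localLevel y α ≤ empCdf (fun b => y b j) t} := by
    ext y; exact critValue_le_iff hB y hα j t
  rw [this]
  exact measurableSet_le (by have := measurable_localLevel (d := d) hB hα; fun_prop) (by fun_prop)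

lemma maxReject_eq_indicator {d : ℕ} (T : Finset (Fin d)) (Q q : Fin d → ℝ) :
    ((maxReject T Q q : ℝ≥0) : ℝ)
      = Set.indicator {p : (Fin d → ℝ) × (Fin d → ℝ) | ∃ j ∈ T, 1 < ratio (p.1 j) (p.2 j)} 1
        (Q, q) := by
  classical
  unfold maxReject
  by_cases h : ∃ j ∈ T, 1 < ratio (Q j) (q j)
  · rw [Set.indicator_of_mem (by exact h)]
    obtain ⟨j, hj, hlt⟩ := h
    have : T.sup (fun j => if 1 < ratio (Q j) (q j) then (1 : ℝ≥0) else 0) = 1 := by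
      refine le_antisymm (Finset.sup_le fun j _ => by split_ifs <;> simp) ?_
      refine le_trans ?_ (Finset.le_sup hj)
      simp [hlt]
    simp [this]
  · rw [Set.indicator_of_notMem (by exact h)]
    have : T.sup (fun j => if 1 < ratio (Q j) (q j) then (1 : ℝ≥0) else 0) = 0 := by
      rw [← bot_eq_zero, Finset.sup_eq_bot_iff]
      intro j hj
      rw [if_neg fun hlt => h ⟨j, hj, hlt⟩, bot_eq_zero]
    simp [this]

lemma measurableSet_one_lt_ratio :
    MeasurableSet {p : ℝ × ℝ | 1 < ratio p.1 p.2} := by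
  refine measurableSet_lt measurable_const ?_
  unfold ratio
  refine Measurable.ite ?_ measurable_const (by fun_prop)
  exact (measurableSet_eq_fun measurable_fst measurable_const).inter
    (measurableSet_eq_fun measurable_snd measurable_const)

lemma measurableSet_exists_one_lt_ratio {d : ℕ} (T : Finset (Fin d)) :
    MeasurableSet {p : (Fin d → ℝ) × (Fin d → ℝ) | ∃ j ∈ T, 1 < ratio (p.1 j) (p.2 j)} := by
  have : {p : (Fin d → ℝ) × (Fin d → ℝ) | ∃ j ∈ T, 1 < ratio (p.1 j) (p.2 j)}
      = ⋃ j ∈ T, (fun p : (Fin d → ℝ) × (Fin d → ℝ) => (p.1 j, p.2 j)) ⁻¹'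
        {p : ℝ × ℝ | 1 < ratio p.1 p.2} := by ext; simp
  rw [this]
  exact Finset.measurableSet_biUnion _ fun j _ => measurableSet_one_lt_ratio.preimage (by fun_prop)

/-! ### Events with probability tending to one -/

/-- The events `p N` have (inner) probability tending to one. -/
def WHP {Ω : Type*} [MeasurableSpace Ω] (P : Measure Ω) (p : ℕ → Ω → Prop) : Prop :=
  Tendsto (fun N => P {ω | ¬ p N ω}) atTop (𝓝 0)

section WHP

variable {Ω : Type*} [MeasurableSpace Ω] {P : Measure Ω} {p q : ℕ → Ω → Prop}

lemma WHP.mono (hp : WHP P p) (h : ∀ᶠ N in atTop, ∀ ω, p N ω → q N ω) : WHP P q := by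
  refine tendsto_of_tendsto_of_tendsto_of_le_of_le' tendsto_const_nhds hp
    (Eventually.of_forall fun _ => zero_le) ?_
  filter_upwards [h] with N hN
  exact measure_mono fun ω hω hpω => hω (hN ω hpω)

lemma WHP.and (hp : WHP P p) (hq : WHP P q) : WHP P (fun N ω => p N ω ∧ q N ω) := by
  refine tendsto_of_tendsto_of_tendsto_of_le_of_le tendsto_const_nhds
    (by simpa using Tendsto.add hp hq) (fun _ => zero_le) fun N => ?_
  refine le_trans (measure_mono ?_) (measure_union_le _ _)
  intro ω hω
  by_contra h
  simp only [Set.mem_union, Set.mem_ofPred_eq, not_or, not_not] at h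
  exact hω h

lemma WHP.of_forall (h : ∀ᶠ N in atTop, ∀ ω, p N ω) : WHP P p := by
  refine tendsto_const_nhds.congr' ?_
  filter_upwards [h] with N hN
  simp [hN]

lemma WHP.finset_forall {ι : Type*} (s : Finset ι) {p : ι → ℕ → Ω → Prop}
    (h : ∀ i ∈ s, WHP P (p i)) : WHP P (fun N ω => ∀ i ∈ s, p i N ω) := by
  classical
  induction s using Finset.induction_on with
  | empty => exact WHP.of_forall (Eventually.of_forall fun N ω => by simp)
  | insert i s hi ih =>
    refine ((h i (Finset.mem_insert_self _ _)).and
      (ih fun k hk => h k (Finset.mem_insert_of_mem hk))).mono (Eventually.of_forall ?_)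
    intro N ω h k hk
    rcases Finset.mem_insert.1 hk with rfl | hk
    exacts [h.1, h.2 k hk]

lemma WHP.forall {ι : Type*} [Fintype ι] {p : ι → ℕ → Ω → Prop}
    (h : ∀ i, WHP P (p i)) : WHP P (fun N ω => ∀ i, p i N ω) := by
  simpa using WHP.finset_forall Finset.univ fun i _ => h i

end WHP

/-! ### The limit distribution -/

/-- The vectors which exceed the threshold `t` in a component in `T`. -/
def exceed {d : ℕ} (T : Finset (Fin d)) (t : Fin d → ℝ) : Set (Fin d → ℝ) :=
  {y | ∃ j ∈ T, t j < y j}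

lemma measurableSet_exceed {d : ℕ} (T : Finset (Fin d)) (t : Fin d → ℝ) :
    MeasurableSet (exceed T t) := by
  have : exceed T t = ⋃ j ∈ T, {y | t j < y j} := by ext; simp [exceed]
  rw [this]
  exact Finset.measurableSet_biUnion _ fun j _ => measurableSet_lt (by fun_prop) (by fun_prop)

lemma exceed_anti {d : ℕ} (T : Finset (Fin d)) {s t : Fin d → ℝ} (h : ∀ j, s j ≤ t j) :
    exceed T t ⊆ exceed T s := fun _ ⟨j, hj, hlt⟩ => ⟨j, hj, (h j).trans_lt hlt⟩

/-- The properties of a limit distribution of a vector of statistics which make simultaneous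
critical values at a common local level work: atomless marginals on the positive half-line, and
positive mass between any two nested orthants. -/
structure RegularLimit {d : ℕ} (ν : Measure (Fin d → ℝ)) : Prop where
  atomless : ∀ j t, ν {y | y j = t} = 0
  pos : ∀ j, ν {y | y j ≤ 0} = 0
  between : ∀ s t : Fin d → ℝ, (∀ j, 0 < s j ∧ s j < t j) →
    0 < ν {y | (∃ j, s j < y j) ∧ ∀ j, y j < t j}

section limit

variable {d : ℕ} {ν : Measure (Fin d → ℝ)} [IsProbabilityMeasure ν]

lemma RegularLimit.exists_quantile (hν : RegularLimit ν) (j : Fin d) {p : ℝ}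
    (hp : p ∈ Set.Ioo (0 : ℝ) 1) : ∃ t, ν.real {y | y j ≤ t} = p := by
  set μ := ν.map (fun y => y j) with hμ
  have hm : Measurable (fun y : Fin d → ℝ => y j) := by fun_prop
  have : IsProbabilityMeasure μ := Measure.isProbabilityMeasure_map hm.aemeasurable
  have hna : ∀ t, μ {t} = 0 := fun t => by
    rw [hμ, Measure.map_apply hm (measurableSet_singleton t)]
    exact hν.atomless j t
  have hF : ∀ t, cdf μ t = ν.real {y | y j ≤ t} := fun t => by
    rw [cdf_eq_real, hμ, map_measureReal_apply hm measurableSet_Iic]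
    rfl
  have hcont : Continuous (cdf μ) := by
    rw [continuous_iff_continuousAt]
    intro t
    -- The distribution function is right continuous, so only its left jump can spoil continuity,
    -- and that jump is the mass of the point.
    rw [(monotone_cdf μ).continuousAt_iff_leftLim_eq_rightLim, (cdf μ).rightLim_eq]
    have h := (cdf μ).measure_singleton t
    rw [measure_cdf, hna] at h
    have h1 := ENNReal.ofReal_eq_zero.1 h.symm
    have h2 := (monotone_cdf μ).leftLim_le (le_refl t)
    linarith
  obtain ⟨t, ht⟩ := mem_range_of_exists_le_of_exists_ge hcont
    (((tendsto_cdf_atBot μ).eventually_le_const hp.1).exists)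
    (((tendsto_cdf_atTop μ).eventually_const_le hp.2).exists)
  exact ⟨t, (hF t).symm.trans ht⟩

/-- The quantiles of the marginals of a measure with atomless marginals. -/
def RegularLimit.quantile (hν : RegularLimit ν) (p : ℝ) (j : Fin d) : ℝ :=
  if hp : p ∈ Set.Ioo (0 : ℝ) 1 then (hν.exists_quantile j hp).choose else 0

lemma RegularLimit.quantile_spec (hν : RegularLimit ν) {p : ℝ} (hp : p ∈ Set.Ioo (0 : ℝ) 1)
    (j : Fin d) : ν.real {y | y j ≤ hν.quantile p j} = p := by
  rw [RegularLimit.quantile, dif_pos hp]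
  exact (hν.exists_quantile j hp).choose_spec

/-- The quantiles are arbitrary choices, but each carries exactly its level as mass below it, which
forces strict monotonicity. -/
lemma RegularLimit.quantile_lt (hν : RegularLimit ν) {p q : ℝ} (hp : p ∈ Set.Ioo (0 : ℝ) 1)
    (hq : q ∈ Set.Ioo (0 : ℝ) 1) (h : p < q) (j : Fin d) :
    hν.quantile p j < hν.quantile q j := by
  by_contra hlt
  rw [not_lt] at hlt
  have : ν.real {y | y j ≤ hν.quantile q j} ≤ ν.real {y | y j ≤ hν.quantile p j} :=
    measureReal_mono fun y hy => le_trans hy hlt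
  rw [hν.quantile_spec hp, hν.quantile_spec hq] at this
  linarith

lemma RegularLimit.quantile_pos (hν : RegularLimit ν) {p : ℝ} (hp : p ∈ Set.Ioo (0 : ℝ) 1)
    (j : Fin d) : 0 < hν.quantile p j := by
  by_contra hlt
  rw [not_lt] at hlt
  have : ν.real {y | y j ≤ hν.quantile p j} ≤ ν.real {y | y j ≤ 0} :=
    measureReal_mono fun y hy => le_trans hy hlt
  rw [hν.quantile_spec hp, measureReal_def, hν.pos] at this
  simp at this
  linarith [hp.1]

/-- The limit of the family-wise error rate of the hypotheses in `T` at local level `β`. -/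
def RegularLimit.fwer (hν : RegularLimit ν) (T : Finset (Fin d)) (β : ℝ) : ℝ :=
  ν.real (exceed T (hν.quantile (1 - β)))

lemma one_sub_mem_Ioo {β : ℝ} (h : β ∈ Set.Ioo (0 : ℝ) 1) : 1 - β ∈ Set.Ioo (0 : ℝ) 1 := by
  constructor <;> linarith [h.1, h.2]

lemma RegularLimit.fwer_singleton (hν : RegularLimit ν) (j : Fin d) {β : ℝ}
    (hβ : β ∈ Set.Ioo (0 : ℝ) 1) : hν.fwer {j} β = β := by
  have h := hν.quantile_spec (one_sub_mem_Ioo hβ) j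
  have h2 : exceed {j} (hν.quantile (1 - β)) = {y | y j ≤ hν.quantile (1 - β) j}ᶜ := by
    ext; simp [exceed]
  rw [RegularLimit.fwer, h2, measureReal_compl (measurableSet_le (by fun_prop) (by fun_prop)), h]
  simp

lemma RegularLimit.fwer_mono (hν : RegularLimit ν) {T T' : Finset (Fin d)} (h : T ⊆ T') (β : ℝ) :
    hν.fwer T β ≤ hν.fwer T' β :=
  measureReal_mono fun _ ⟨j, hj, hlt⟩ => ⟨j, h hj, hlt⟩

/-- The open region of `between` lies in the difference of the two exceedance sets. Strictness is
what identifies the limit of the local level. -/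
lemma RegularLimit.fwer_lt (hν : RegularLimit ν) {β γ : ℝ} (hβ : β ∈ Set.Ioo (0 : ℝ) 1)
    (hγ : γ ∈ Set.Ioo (0 : ℝ) 1) (h : β < γ) :
    hν.fwer Finset.univ β < hν.fwer Finset.univ γ := by
  set s := hν.quantile (1 - γ)
  set t := hν.quantile (1 - β)
  have hst : ∀ j, s j < t j :=
    hν.quantile_lt (one_sub_mem_Ioo hγ) (one_sub_mem_Ioo hβ) (by linarith)
  have hs : ∀ j, 0 < s j := hν.quantile_pos (one_sub_mem_Ioo hγ)
  have hpos := hν.between s t fun j => ⟨hs j, hst j⟩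
  have hsub := exceed_anti (Finset.univ : Finset (Fin d)) fun j => (hst j).le
  have hdiff : ν.real (exceed Finset.univ s \ exceed Finset.univ t)
      = ν.real (exceed Finset.univ s) - ν.real (exceed Finset.univ t) :=
    measureReal_sdiff hsub (measurableSet_exceed _ _)
  have hle : ν.real {y | (∃ j, s j < y j) ∧ ∀ j, y j < t j}
      ≤ ν.real (exceed Finset.univ s \ exceed Finset.univ t) := by
    refine measureReal_mono fun y hy => ⟨?_, ?_⟩
    · obtain ⟨j, hj⟩ := hy.1
      exact ⟨j, Finset.mem_univ _, hj⟩
    · rintro ⟨j, -, hj⟩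
      exact lt_asymm hj (hy.2 j)
  have hpos' : 0 < ν.real {y | (∃ j, s j < y j) ∧ ∀ j, y j < t j} :=
    ENNReal.toReal_pos hpos.ne' (measure_ne_top _ _)
  change ν.real (exceed Finset.univ t) < ν.real (exceed Finset.univ s)
  linarith

/-- The two exceedance sets differ by at most `d` strips, one per component, each of mass `γ - β`.
The resulting Lipschitz constant `d` serves both the intermediate value argument and the final
squeeze. -/
lemma RegularLimit.fwer_le_add (hν : RegularLimit ν) (T : Finset (Fin d)) {β γ : ℝ}
    (hβ : β ∈ Set.Ioo (0 : ℝ) 1) (hγ : γ ∈ Set.Ioo (0 : ℝ) 1) (h : β ≤ γ) :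
    hν.fwer T β ≤ hν.fwer T γ ∧ hν.fwer T γ ≤ hν.fwer T β + d * (γ - β) := by
  rcases h.eq_or_lt with rfl | h
  · simp
  set s := hν.quantile (1 - γ)
  set t := hν.quantile (1 - β)
  have hst : ∀ j, s j < t j :=
    hν.quantile_lt (one_sub_mem_Ioo hγ) (one_sub_mem_Ioo hβ) (by linarith)
  have hsub := exceed_anti T fun j => (hst j).le
  refine ⟨measureReal_mono hsub, ?_⟩
  have hcov : exceed T s ⊆ exceed T t ∪ ⋃ j : Fin d, ({y | y j ≤ t j} \ {y | y j ≤ s j}) := by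
    rintro y ⟨j, hj, hlt⟩
    by_cases hyt : y j ≤ t j
    · exact Or.inr (Set.mem_iUnion.2 ⟨j, hyt, by simpa using hlt⟩)
    · exact Or.inl ⟨j, hj, not_le.1 hyt⟩
  have hj : ∀ j : Fin d, ν.real ({y | y j ≤ t j} \ {y | y j ≤ s j}) = γ - β := fun j => by
    have hsub' : {y : Fin d → ℝ | y j ≤ s j} ⊆ {y | y j ≤ t j} :=
      fun y hy => le_trans hy (hst j).le
    rw [measureReal_sdiff hsub'
      (measurableSet_le (by fun_prop) (by fun_prop)), hν.quantile_spec (one_sub_mem_Ioo hβ),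
      hν.quantile_spec (one_sub_mem_Ioo hγ)]
    ring
  calc ν.real (exceed T s)
      ≤ ν.real (exceed T t ∪ ⋃ j : Fin d, ({y | y j ≤ t j} \ {y | y j ≤ s j})) :=
        measureReal_mono hcov
    _ ≤ ν.real (exceed T t) + ν.real (⋃ j : Fin d, ({y | y j ≤ t j} \ {y | y j ≤ s j})) :=
        measureReal_union_le _ _
    _ ≤ ν.real (exceed T t) + ∑ j : Fin d, ν.real ({y | y j ≤ t j} \ {y | y j ≤ s j}) := by
        gcongr
        exact measureReal_iUnion_fintype_le _
    _ = ν.real (exceed T t) + d * (γ - β) := by simp [hj, mul_sub]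

/-- Intermediate value theorem: at level `α / (2 * d)` Bonferroni's bound gives at most `α / 2`, and
at level `α` a single component already contributes `α`. -/
lemma RegularLimit.exists_fwer_eq (hν : RegularLimit ν) (hd : 1 ≤ d) {α : ℝ}
    (hα : α ∈ Set.Ioo (0 : ℝ) 1) :
    ∃ β ∈ Set.Ioo (0 : ℝ) 1, hν.fwer Finset.univ β = α := by
  have hd' : (1 : ℝ) ≤ d := by exact_mod_cast hd
  have hsub : Set.Icc (α / (2 * d)) α ⊆ Set.Ioo (0 : ℝ) 1 := fun x hx =>
    ⟨lt_of_lt_of_le (by have := hα.1; positivity) hx.1, hx.2.trans_lt hα.2⟩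
  have hle : α / (2 * d) ≤ α := div_le_self hα.1.le (by linarith)
  have hcont : ContinuousOn (hν.fwer Finset.univ) (Set.Icc (α / (2 * d)) α) := by
    refine (LipschitzOnWith.of_dist_le_mul (K := (d : ℝ≥0)) ?_).continuousOn
    intro x hx y hy
    rw [Real.dist_eq, Real.dist_eq, NNReal.coe_natCast]
    rcases le_total x y with h | h
    · have := hν.fwer_le_add Finset.univ (hsub hx) (hsub hy) h
      rw [abs_sub_comm, abs_sub_comm x, abs_of_nonneg (by linarith), abs_of_nonneg (by linarith)]
      linarith
    · have := hν.fwer_le_add Finset.univ (hsub hy) (hsub hx) h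
      rw [abs_of_nonneg (by linarith), abs_of_nonneg (by linarith)]
      linarith
  have h1 : hν.fwer Finset.univ (α / (2 * d)) ≤ α := by
    have hcov : exceed Finset.univ (hν.quantile (1 - α / (2 * d)))
        ⊆ ⋃ j : Fin d, exceed {j} (hν.quantile (1 - α / (2 * d))) := by
      rintro y ⟨j, -, hj⟩
      exact Set.mem_iUnion.2 ⟨j, j, by simp, hj⟩
    have h2 : hν.fwer Finset.univ (α / (2 * d)) ≤ ∑ j : Fin d, hν.fwer {j} (α / (2 * d)) :=
      (measureReal_mono hcov).trans (measureReal_iUnion_fintype_le _)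
    simp_rw [hν.fwer_singleton _ (hsub (Set.left_mem_Icc.2 hle))] at h2
    refine h2.trans ?_
    simp only [Finset.sum_const, Finset.card_univ, Fintype.card_fin, nsmul_eq_mul]
    rw [mul_div_assoc', div_le_iff₀ (by positivity)]
    nlinarith [hα.1]
  have h2 : α ≤ hν.fwer Finset.univ α := by
    have := hν.fwer_mono (Finset.subset_univ {(⟨0, hd⟩ : Fin d)}) α
    rwa [hν.fwer_singleton _ hα] at this
  obtain ⟨β, hβ, h⟩ := intermediate_value_Icc hle hcont ⟨h1, h2⟩
  exact ⟨β, hsub hβ, h⟩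

end limit

/-! ### Convergence of the local level and of the critical values. -/

section criticalValues

variable {d : ℕ} {ν : Measure (Fin d → ℝ)} [IsProbabilityMeasure ν]
  {Ω : Type*} [MeasurableSpace Ω] {P : Measure Ω} {B : ℕ → ℕ}
  {Y : (N : ℕ) → Ω → Fin (B N) → Fin d → ℝ}

/-- The proportions of replicates which exceed a threshold are consistent. -/
def EmpConsistent (ν : Measure (Fin d → ℝ)) (P : Measure Ω)
    (Y : (N : ℕ) → Ω → Fin (B N) → Fin d → ℝ) : Prop :=
  ∀ (T : Finset (Fin d)) (t : Fin d → ℝ) (η : ℝ), 0 < η →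
    WHP P (fun N ω => |empExceed T t (Y N ω) - ν.real (exceed T t)| < η)

lemma EmpConsistent.empCdf (hν : RegularLimit ν) (hY : EmpConsistent ν P Y)
    (hB : Tendsto B atTop atTop) {p η : ℝ} (hp : p ∈ Set.Ioo (0 : ℝ) 1) (hη : 0 < η) :
    WHP P (fun N ω => ∀ j, |QFMCT.empCdf (fun b => Y N ω b j) (hν.quantile p j) - p| < η) := by
  refine WHP.forall fun j => (hY {j} (hν.quantile p) η hη).mono ?_
  filter_upwards [hB.eventually_gt_atTop 0] with N hN ω h
  have hf := hν.fwer_singleton j (one_sub_mem_Ioo hp)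
  rw [RegularLimit.fwer, sub_sub_cancel] at hf
  rw [empCdf_eq_one_sub_empExceed hN, ← abs_neg]
  rw [hf] at h
  convert h using 2
  ring

/-- The gap between `p` and `q` absorbs the estimation error. The event is uniform in `r` because it
is applied at the random level `1 - localLevel`. -/
lemma EmpConsistent.quantile_lt_empQuantile (hν : RegularLimit ν) (hY : EmpConsistent ν P Y)
    (hB : Tendsto B atTop atTop) {p q : ℝ} (hp : p ∈ Set.Ioo (0 : ℝ) 1) (hpq : p < q) :
    WHP P (fun N ω => ∀ j, ∀ r, q ≤ r → r ≤ 1 →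
      hν.quantile p j < empQuantile (fun b => Y N ω b j) r) := by
  refine (hY.empCdf hν hB hp (sub_pos.2 hpq)).mono ?_
  filter_upwards [hB.eventually_gt_atTop 0] with N hN ω h j r hr hr1
  rw [lt_empQuantile_iff hN _ ⟨by linarith [hp.1], hr1⟩]
  have := (abs_lt.1 (h j)).2
  linarith

lemma EmpConsistent.empQuantile_le_quantile (hν : RegularLimit ν) (hY : EmpConsistent ν P Y)
    (hB : Tendsto B atTop atTop) {p q : ℝ} (hp : p ∈ Set.Ioo (0 : ℝ) 1) (hqp : q < p) :
    WHP P (fun N ω => ∀ j, ∀ r, 0 < r → r ≤ q →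
      empQuantile (fun b => Y N ω b j) r ≤ hν.quantile p j) := by
  refine (hY.empCdf hν hB hp (sub_pos.2 hqp)).mono ?_
  filter_upwards [hB.eventually_gt_atTop 0] with N hN ω h j r hr hr1
  rw [empQuantile_le_iff hN _ ⟨hr, by linarith [hp.2]⟩]
  have := (abs_lt.1 (h j)).1
  linarith

/-- The random thresholds at level `β` lie above the fixed quantiles for the larger level `γ`, and
exceedance proportions decrease in the threshold. Thus consistency is needed only at fixed
thresholds. -/
lemma EmpConsistent.estFWER_lt (hν : RegularLimit ν) (hY : EmpConsistent ν P Y)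
    (hB : Tendsto B atTop atTop) {β γ α : ℝ} (hβ : 0 < β) (hγ : γ ∈ Set.Ioo (0 : ℝ) 1)
    (hβγ : β < γ) (h : hν.fwer Finset.univ γ < α) :
    WHP P (fun N ω => estFWER (Y N ω) β < α) := by
  refine ((hY.quantile_lt_empQuantile hν hB (one_sub_mem_Ioo hγ)
    (q := 1 - β) (by linarith)).and (hY Finset.univ (hν.quantile (1 - γ))
    (α - hν.fwer Finset.univ γ) (sub_pos.2 h))).mono (Eventually.of_forall ?_)
  rintro N ω ⟨h1, h2⟩
  have h3 := (abs_lt.1 h2).2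
  rw [estFWER_eq]
  have h4 := empExceed_anti Finset.univ (Y N ω) (s := hν.quantile (1 - γ))
    (t := fun j => empQuantile (fun b => Y N ω b j) (1 - β))
    fun j _ => (h1 j (1 - β) le_rfl (by linarith)).le
  rw [RegularLimit.fwer] at h3
  linarith

lemma EmpConsistent.lt_estFWER (hν : RegularLimit ν) (hY : EmpConsistent ν P Y)
    (hB : Tendsto B atTop atTop) {β γ α : ℝ} (hβ : β < 1) (hγ : γ ∈ Set.Ioo (0 : ℝ) 1)
    (hγβ : γ < β) (h : α < hν.fwer Finset.univ γ) :
    WHP P (fun N ω => α < estFWER (Y N ω) β) := by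
  refine ((hY.empQuantile_le_quantile hν hB (one_sub_mem_Ioo hγ)
    (q := 1 - β) (by linarith)).and (hY Finset.univ (hν.quantile (1 - γ))
    (hν.fwer Finset.univ γ - α) (sub_pos.2 h))).mono (Eventually.of_forall ?_)
  rintro N ω ⟨h1, h2⟩
  have h3 := (abs_lt.1 h2).1
  rw [estFWER_eq]
  have h4 := empExceed_anti Finset.univ (Y N ω) (t := hν.quantile (1 - γ))
    (s := fun j => empQuantile (fun b => Y N ω b j) (1 - β))
    fun j _ => h1 j (1 - β) (by linarith) le_rfl
  rw [RegularLimit.fwer] at h3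
  linarith

/-- The local level lies near the level at which the limit family-wise error rate is `α`. -/
lemma EmpConsistent.localLevel (hν : RegularLimit ν) (hY : EmpConsistent ν P Y)
    (hB : Tendsto B atTop atTop) {α β β₁ β₂ : ℝ} (hα : 0 ≤ α)
    (hβ : hν.fwer Finset.univ β = α)
    (h₁ : 0 < β₁) (h₁β : β₁ < β) (hβ₂ : β < β₂) (h₂ : β₂ < 1) :
    WHP P (fun N ω => β₁ ≤ QFMCT.localLevel (Y N ω) α ∧ QFMCT.localLevel (Y N ω) α ≤ β₂) := by
  have hβm : β ∈ Set.Ioo (0 : ℝ) 1 := ⟨h₁.trans h₁β, hβ₂.trans h₂⟩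
  -- The order is `β₁ < γ < γ' < β < δ < β₂`. Estimated rates at `γ` and `β₂` are compared with
  -- limit rates at `γ'` and `δ`; the gap from `β₁` to `γ` absorbs the rounding loss `1 / B`.
  obtain ⟨γ, hγ1, hγ2⟩ := exists_between h₁β
  obtain ⟨γ', hγ1', hγ2'⟩ := exists_between hγ2
  obtain ⟨δ, hδ1, hδ2⟩ := exists_between hβ₂
  have hγ'm : γ' ∈ Set.Ioo (0 : ℝ) 1 := ⟨by linarith, by linarith⟩
  have hδm : δ ∈ Set.Ioo (0 : ℝ) 1 := ⟨by linarith [hβm.1], by linarith⟩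
  have hlo := hY.estFWER_lt hν hB (β := γ) (γ := γ') (α := α) (by linarith) hγ'm hγ1'
    (by rw [← hβ]; exact hν.fwer_lt hγ'm hβm hγ2')
  have hup := hY.lt_estFWER hν hB (β := β₂) (γ := δ) (α := α) h₂ hδm hδ2
    (by rw [← hβ]; exact hν.fwer_lt hβm hδm hδ1)
  refine (hlo.and hup).mono ?_
  have hinv : Tendsto (fun N => 1 / (B N : ℝ)) atTop (𝓝 0) :=
    (tendsto_const_div_atTop_nhds_zero_nat 1).comp hB
  filter_upwards [hB.eventually_gt_atTop 0, hinv.eventually_lt_const (sub_pos.2 hγ1)]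
    with N hN hN' ω hω
  refine ⟨?_, localLevel_le_of_lt_estFWER hN _ hα (by linarith [hβm.1]) hω.2⟩
  have := le_localLevel_of_estFWER_le hN (Y N ω) hα (by linarith) (by linarith) hω.1.le
  linarith

/-- The level is confined to `[γ, δ]` inside `(β₁, β₂)`, and the remaining gaps pay for the passage
from empirical to limit quantiles. -/
lemma EmpConsistent.critValue (hν : RegularLimit ν) (hY : EmpConsistent ν P Y)
    (hB : Tendsto B atTop atTop) {α β β₁ β₂ : ℝ} (hα : 0 ≤ α)
    (hβ : hν.fwer Finset.univ β = α)
    (h₁ : 0 < β₁) (h₁β : β₁ < β) (hβ₂ : β < β₂) (h₂ : β₂ < 1) :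
    WHP P (fun N ω => ∀ j, hν.quantile (1 - β₂) j < QFMCT.critValue (Y N ω) α j ∧
      QFMCT.critValue (Y N ω) α j ≤ hν.quantile (1 - β₁) j) := by
  obtain ⟨γ, hγ1, hγ2⟩ := exists_between h₁β
  obtain ⟨δ, hδ1, hδ2⟩ := exists_between hβ₂
  have hlev := hY.localLevel hν hB hα hβ (h₁.trans hγ1) hγ2 hδ1 (hδ2.trans h₂)
  have hlo := hY.quantile_lt_empQuantile hν hB (p := 1 - β₂) (q := 1 - δ)
    ⟨by linarith, by linarith⟩ (by linarith)
  have hup := hY.empQuantile_le_quantile hν hB (p := 1 - β₁) (q := 1 - γ)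
    ⟨by linarith, by linarith⟩ (by linarith)
  refine (hlev.and (hlo.and hup)).mono (Eventually.of_forall ?_)
  rintro N ω ⟨⟨hl1, hl2⟩, h1, h2⟩ j
  exact ⟨h1 j _ (by linarith) (by linarith), h2 j _ (by linarith) (by linarith)⟩

/-- Simultaneous tests with resampling critical values at a common local level: if the replicates
and the statistics of the true hypotheses have the same regular limit distribution, the
probability of a rejection of a true hypothesis converges to a limit which is at most `α`, and
equal to `α` if all hypotheses are true. -/
theorem EmpConsistent.tendsto_measure_reject [IsProbabilityMeasure P] (hd : 1 ≤ d)
    (hν : RegularLimit ν)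
    (hY : EmpConsistent ν P Y) (hB : Tendsto B atTop atTop) {α : ℝ}
    (hα : α ∈ Set.Ioo (0 : ℝ) 1) (T : Finset (Fin d)) {Q : ℕ → Ω → Fin d → ℝ}
    (hQ : ∀ t, Tendsto (fun N => P.real {ω | Q N ω ∈ exceed T t}) atTop
      (𝓝 (ν.real (exceed T t)))) :
    ∃ L ≤ α, (T = Finset.univ → L = α) ∧
      Tendsto (fun N => P.real {ω | ∃ j ∈ T,
        1 < ratio (Q N ω j) (QFMCT.critValue (Y N ω) α j)}) atTop (𝓝 L) := by
  obtain ⟨β, hβ, hβα⟩ := hν.exists_fwer_eq hd hα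
  refine ⟨hν.fwer T β, (hν.fwer_mono (Finset.subset_univ T) β).trans hβα.le,
    fun h => by rw [h, hβα], ?_⟩
  rw [Metric.tendsto_atTop']
  intro ε hε
  have hd' : (1 : ℝ) ≤ d := by exact_mod_cast hd
  -- The error `ε` is split into three thirds: the change of the limit rate over a level step `δ`,
  -- the convergence of `Q` at fixed thresholds, and the event that a critical value leaves its
  -- quantile bounds. The other two conditions keep `β - δ` and `β + δ` in `(0, 1)`.
  obtain ⟨δ, hδ0, hδ⟩ : ∃ δ > 0, d * δ < ε / 3 ∧ δ < β ∧ δ < 1 - β := by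
    obtain ⟨δ, h0, h1⟩ := exists_between
      (show 0 < min (ε / 3 / d) (min β (1 - β)) from
        lt_min (by positivity) (lt_min hβ.1 (by linarith [hβ.2])))
    rw [lt_min_iff, lt_min_iff, lt_div_iff₀ (by positivity), mul_comm] at h1
    exact ⟨δ, h0, h1⟩
  have hm1 : β - δ ∈ Set.Ioo (0 : ℝ) 1 := ⟨by linarith, by linarith [hβ.2]⟩
  have hm2 : β + δ ∈ Set.Ioo (0 : ℝ) 1 := ⟨by linarith [hβ.1], by linarith⟩
  have hcrit := hY.critValue hν hB hα.1.le hβα (β₁ := β - δ) (β₂ := β + δ) hm1.1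
    (by linarith) (by linarith) hm2.2
  have hbad : Tendsto (fun N => P.real {ω | ¬ ∀ j,
      hν.quantile (1 - (β + δ)) j < QFMCT.critValue (Y N ω) α j ∧
      QFMCT.critValue (Y N ω) α j ≤ hν.quantile (1 - (β - δ)) j}) atTop (𝓝 0) := by
    have := (ENNReal.tendsto_toReal ENNReal.zero_ne_top).comp hcrit
    rwa [ENNReal.toReal_zero] at this
  have hlip1 := (hν.fwer_le_add T hm1 hβ (by linarith)).2
  have hlip2 := (hν.fwer_le_add T hβ hm2 (by linarith)).2
  have e1 := (hQ (hν.quantile (1 - (β - δ)))).eventually_const_lt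
    (show ν.real (exceed T (hν.quantile (1 - (β - δ)))) - ε / 3 < _ by linarith)
  have e2 := (hQ (hν.quantile (1 - (β + δ)))).eventually_lt_const
    (show _ < ν.real (exceed T (hν.quantile (1 - (β + δ)))) + ε / 3 by linarith)
  have e3 := hbad.eventually_lt_const (show (0 : ℝ) < ε / 3 by positivity)
  obtain ⟨N₀, hN₀⟩ := eventually_atTop.1 (e1.and (e2.and e3))
  refine ⟨N₀, fun N hN => ?_⟩
  obtain ⟨h1, h2, h3⟩ := hN₀ N hN.le
  set R := {ω | ∃ j ∈ T, 1 < ratio (Q N ω j) (QFMCT.critValue (Y N ω) α j)}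
  set bad := {ω | ¬ ∀ j, hν.quantile (1 - (β + δ)) j < QFMCT.critValue (Y N ω) α j ∧
      QFMCT.critValue (Y N ω) α j ≤ hν.quantile (1 - (β - δ)) j} with hbaddef
  have hup : R ⊆ {ω | Q N ω ∈ exceed T (hν.quantile (1 - (β + δ)))} ∪ bad := by
    rintro ω ⟨j, hj, hlt⟩
    by_cases hω : ω ∈ bad
    · exact Or.inr hω
    · simp only [hbaddef, Set.mem_ofPred_eq, not_not] at hω
      have hq := (hν.quantile_pos (one_sub_mem_Ioo hm2) j).trans (hω j).1
      exact Or.inl ⟨j, hj, (hω j).1.trans ((one_lt_ratio_iff hq).1 hlt)⟩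
  have hlo : {ω | Q N ω ∈ exceed T (hν.quantile (1 - (β - δ)))} ⊆ R ∪ bad := by
    rintro ω ⟨j, hj, hlt⟩
    by_cases hω : ω ∈ bad
    · exact Or.inr hω
    · simp only [hbaddef, Set.mem_ofPred_eq, not_not] at hω
      have hq := (hν.quantile_pos (one_sub_mem_Ioo hm2) j).trans (hω j).1
      exact Or.inl ⟨j, hj, (one_lt_ratio_iff hq).2 ((hω j).2.trans_lt hlt)⟩
  have i1 := (measureReal_mono (μ := P) hup).trans (measureReal_union_le _ _)
  have i2 := (measureReal_mono (μ := P) hlo).trans (measureReal_union_le _ _)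
  rw [Real.dist_eq, abs_lt]
  unfold RegularLimit.fwer at *
  constructor
  · nlinarith [hδ.1]
  · nlinarith [hδ.1]

end criticalValues

/-! ### Quadratic forms of Gaussian vectors -/

section stdGaussian

variable {E : Type*} [NormedAddCommGroup E] [InnerProductSpace ℝ E] [FiniteDimensional ℝ E]
  [MeasurableSpace E] [BorelSpace E]

/-- Replacing the component of a standard Gaussian vector in a fixed direction by an independent
standard normal variable does not change the distribution. -/
lemma map_resample_stdGaussian (e : E) (he : ‖e‖ = 1) :
    ((stdGaussian E).prod (gaussianReal 0 1)).map
      (fun p => p.1 - inner ℝ e p.1 • e + p.2 • e) = stdGaussian E := by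
  have hm : Measurable (fun p : E × ℝ => p.1 - inner ℝ e p.1 • e + p.2 • e) := by fun_prop
  have : IsProbabilityMeasure (((stdGaussian E).prod (gaussianReal 0 1)).map
      (fun p => p.1 - inner ℝ e p.1 • e + p.2 • e)) :=
    Measure.isProbabilityMeasure_map hm.aemeasurable
  apply Measure.ext_of_charFun
  ext t
  rw [charFun_apply, integral_map hm.aemeasurable (by fun_prop)]
  -- Pairing with `t` separates the part of `t` orthogonal to `e`, seen by the vector, from its
  -- coefficient along `e`, seen by the new variable. Pythagoras then recombines the two Gaussian
  -- exponents.
  have hsplit : ∀ p : E × ℝ,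
      Complex.exp ((inner ℝ (p.1 - inner ℝ e p.1 • e + p.2 • e) t : ℝ) * Complex.I)
      = Complex.exp ((inner ℝ p.1 (t - inner ℝ e t • e) : ℝ) * Complex.I)
        * Complex.exp ((inner ℝ e t : ℝ) * p.2 * Complex.I) := fun p => by
    rw [← Complex.exp_add, ← add_mul]
    congr 2
    rw [inner_add_left, inner_sub_left, inner_smul_left, inner_smul_left, inner_sub_right,
      inner_smul_right, real_inner_comm e p.1]
    push_cast
    simp
    ring
  simp_rw [hsplit]
  rw [integral_prod_mul (fun x : E => Complex.exp ((inner ℝ x (t - inner ℝ e t • e) : ℝ)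
    * Complex.I)) (fun ξ : ℝ => Complex.exp ((inner ℝ e t : ℝ) * ξ * Complex.I)),
    ← charFun_apply, ← charFun_apply_real, charFun_stdGaussian, charFun_stdGaussian,
    charFun_gaussianReal, ← Complex.exp_add]
  congr 1
  have : ‖t - inner ℝ e t • e‖ ^ 2 = ‖t‖ ^ 2 - (inner ℝ e t) ^ 2 := by
    rw [norm_sub_sq_real, norm_smul, inner_smul_right, real_inner_comm, he]
    simp
    ring
  rw [← Complex.ofReal_pow, this]
  push_cast
  simp
  ring

lemma finite_quadratic_eq {a b c t : ℝ} (ha : a ≠ 0) :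
    {x : ℝ | a * x ^ 2 + b * x + c = t}.Finite := by
  by_cases h : ∃ x, a * x ^ 2 + b * x + c = t
  · obtain ⟨x₀, h₀⟩ := h
    refine Set.Finite.subset (Set.toFinite {x₀, -b / a - x₀}) fun x hx => ?_
    have hx' : a * x ^ 2 + b * x + c = t := hx
    have : (x - x₀) * (a * (x + x₀) + b) = 0 := by linear_combination hx' - h₀
    rcases mul_eq_zero.1 this with h | h
    · exact Or.inl (by linarith)
    · right
      rw [Set.mem_singleton_iff, eq_sub_iff_add_eq, eq_div_iff ha]
      linarith
  · rw [show {x : ℝ | a * x ^ 2 + b * x + c = t} = ∅ from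
      Set.eq_empty_of_forall_notMem fun x hx => h ⟨x, hx⟩]
    exact Set.finite_empty

/-- The level sets of a nonzero quadratic form are null sets of the standard Gaussian. -/
lemma stdGaussian_level_eq_zero (b : LinearMap.BilinForm ℝ E)
    (hb : Measurable fun x => b x x) {w : E} (hw : b w w ≠ 0) (t : ℝ) :
    stdGaussian E {x | b x x = t} = 0 := by
  have hw0 : w ≠ 0 := by rintro rfl; simp at hw
  set e : E := ‖w‖⁻¹ • w with he
  have he1 : ‖e‖ = 1 := by
    rw [he, norm_smul, norm_inv, norm_norm, inv_mul_cancel₀ (norm_ne_zero_iff.2 hw0)]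
  have hee : b e e ≠ 0 := by
    have : ‖w‖ ≠ 0 := norm_ne_zero_iff.2 hw0
    simp [he, hw, this]
  have hm : Measurable (fun p : E × ℝ => p.1 - inner ℝ e p.1 • e + p.2 • e) := by fun_prop
  have hs : MeasurableSet {x | b x x = t} := hb (measurableSet_singleton t)
  -- After resampling the coordinate along `e`, Fubini reduces the claim to a fixed remainder `v`:
  -- the level set becomes the root set of a quadratic polynomial in `ξ` with leading coefficient `b
  -- e e ≠ 0`.
  rw [← map_resample_stdGaussian e he1, Measure.map_apply hm hs,
    Measure.measure_prod_null (hm hs)]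
  refine Eventually.of_forall fun x => ?_
  have := nullSingletonClass_gaussianReal (μ := 0) (v := 1) one_ne_zero
  refine Set.Finite.measure_zero ?_ _
  set v := x - inner ℝ e x • e
  refine (finite_quadratic_eq (b := b e v + b v e) (c := b v v) (t := t) hee).subset ?_
  intro ξ hξ
  have hξ' : b (v + ξ • e) (v + ξ • e) = t := hξ
  simp only [map_add, map_smul, LinearMap.add_apply, LinearMap.smul_apply, smul_eq_mul] at hξ'
  change b e e * ξ ^ 2 + (b e v + b v e) * ξ + b v v = t
  linear_combination hξ'

instance isOpenPosMeasure_stdGaussian {ι : Type*} [Fintype ι] :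
    (stdGaussian (EuclideanSpace ℝ ι)).IsOpenPosMeasure := by
  have : (gaussianReal 0 1).IsOpenPosMeasure :=
    (gaussianReal_absolutelyContinuous' 0 one_ne_zero).isOpenPosMeasure
  rw [← map_pi_eq_stdGaussian]
  exact (PiLp.continuous_toLp 2 _).isOpenPosMeasure_map (WithLp.toLp_surjective 2)

end stdGaussian

/-! ### Regularity of the law of quadratic forms in a possibly degenerate Gaussian vector. -/

section limitLaw

variable {a d : ℕ}

lemma quadForm_of_pos {M S : Matrix (Fin a) (Fin a) ℝ} (h : 0 < variance M S) (u : Fin a → ℝ) :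
    quadForm M S u = (u ⬝ᵥ ((centering a)ᵀ * M * centering a) *ᵥ u) / √(variance M S) := by
  rw [quadForm, if_pos h, ← Matrix.mulVec_mulVec, ← Matrix.mulVec_mulVec,
    Matrix.dotProduct_mulVec u, Matrix.vecMul_transpose]

lemma quadForm_nonneg {M : Matrix (Fin a) (Fin a) ℝ} (hM : M.PosSemidef)
    (S : Matrix (Fin a) (Fin a) ℝ) (u : Fin a → ℝ) : 0 ≤ quadForm M S u := by
  unfold quadForm
  split_ifs
  · have := hM.dotProduct_mulVec_nonneg (centering a *ᵥ u)
    rw [star_trivial] at this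
    positivity
  · exact le_rfl

lemma quadForm_smul (M S : Matrix (Fin a) (Fin a) ℝ) (c : ℝ) (u : Fin a → ℝ) :
    quadForm M S (c • u) = c ^ 2 * quadForm M S u := by
  unfold quadForm
  split_ifs
  · simp only [Matrix.mulVec_smul, smul_dotProduct, dotProduct_smul, smul_eq_mul]
    ring
  · simp

/-- The vector of standardized quadratic forms in the component-wise parts of `z`, for matrices
and covariance matrices `w j`. -/
def quadForms (w : Fin d → (Fin a → Fin a → ℝ) × (Fin a → Fin a → ℝ))
    (z : EuclideanSpace ℝ (Fin d × Fin a)) : Fin d → ℝ :=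
  fun j => quadForm (Matrix.of (w j).1) (Matrix.of (w j).2) (fun i => z (j, i))

lemma continuous_quadForm (M S : Matrix (Fin a) (Fin a) ℝ) : Continuous (quadForm M S) := by
  unfold quadForm
  split_ifs
  · fun_prop
  · fun_prop

lemma continuous_quadForms (w : Fin d → (Fin a → Fin a → ℝ) × (Fin a → Fin a → ℝ)) :
    Continuous (quadForms w) :=
  continuous_pi fun j => (continuous_quadForm _ _).comp (by fun_prop)

variable {w : Fin d → (Fin a → Fin a → ℝ) × (Fin a → Fin a → ℝ)}
  {S : Matrix (Fin d × Fin a) (Fin d × Fin a) ℝ}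

/-- This is where positivity of the trace enters. A form that vanishes on the range of `R` satisfies
`N * Rj = 0` by semidefiniteness; since the `j`-th covariance block is `Rj * Rjᵀ`, the trace would
then be zero. -/
lemma exists_quadForms_pos {R : Matrix (Fin d × Fin a) (Fin d × Fin a) ℝ} (hR : R * Rᵀ = S)
    (hw : ∀ j, (Matrix.of (w j).1).PosSemidef)
    (hv : ∀ j, 0 < variance (Matrix.of (w j).1) (Matrix.of (w j).2))
    (hwS : ∀ j i i', (w j).2 i i' = S (j, i) (j, i')) (j : Fin d) :
    ∃ x : EuclideanSpace ℝ (Fin d × Fin a),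
      0 < quadForms w (Matrix.toEuclideanCLM (𝕜 := ℝ) R x) j := by
  by_contra! h
  set N : Matrix (Fin a) (Fin a) ℝ := (centering a)ᵀ * Matrix.of (w j).1 * centering a with hN
  have hNp : N.PosSemidef := by
    have := (hw j).conjTranspose_mul_mul_same (centering a)
    rwa [Matrix.conjTranspose_eq_transpose_of_trivial] at this
  set Rj : Matrix (Fin a) (Fin d × Fin a) ℝ := Matrix.of fun i p => R (j, i) p with hRj
  have hz : ∀ x : Fin d × Fin a → ℝ, N *ᵥ (Rj *ᵥ x) = 0 := fun x => by
    rw [← hNp.dotProduct_mulVec_zero_iff, star_trivial]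
    have h1 := h (WithLp.toLp 2 x)
    have h2 : quadForms w (Matrix.toEuclideanCLM (𝕜 := ℝ) R (WithLp.toLp 2 x)) j
        = ((Rj *ᵥ x) ⬝ᵥ N *ᵥ (Rj *ᵥ x)) / √(variance (Matrix.of (w j).1) (Matrix.of (w j).2)) := by
      rw [quadForms, quadForm_of_pos (hv j)]
      rfl
    rw [h2] at h1
    have h3 := hNp.dotProduct_mulVec_nonneg (Rj *ᵥ x)
    rw [star_trivial] at h3
    refine le_antisymm ?_ h3
    by_contra h4
    rw [not_le] at h4
    exact absurd (div_pos h4 (Real.sqrt_pos.2 (hv j))) (not_lt.2 h1)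
  have hNR : N * Rj = 0 := by
    refine Matrix.ext_of_mulVec_single fun p => ?_
    rw [← Matrix.mulVec_mulVec, hz, Matrix.zero_mulVec]
  have hS' : Matrix.of (w j).2 = Rj * Rjᵀ := by
    ext i i'
    rw [Matrix.of_apply, hwS, ← hR]
    rfl
  have := hv j
  rw [variance, ← hN, hS', ← Matrix.mul_assoc, hNR] at this
  simp at this

lemma regularLimit_map_quadForms_stdGaussian (hd : 1 ≤ d)
    {R : Matrix (Fin d × Fin a) (Fin d × Fin a) ℝ} (hR : R * Rᵀ = S)
    (hw : ∀ j, (Matrix.of (w j).1).PosSemidef)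
    (hv : ∀ j, 0 < variance (Matrix.of (w j).1) (Matrix.of (w j).2))
    (hwS : ∀ j i i', (w j).2 i i' = S (j, i) (j, i')) :
    RegularLimit ((stdGaussian (EuclideanSpace ℝ (Fin d × Fin a))).map
      (fun x => quadForms w (Matrix.toEuclideanCLM (𝕜 := ℝ) R x))) := by
  set A := Matrix.toEuclideanCLM (𝕜 := ℝ) R with hA
  have hc : Continuous fun x => quadForms w (A x) := (continuous_quadForms w).comp A.continuous
  have hmap : ∀ s : Set (Fin d → ℝ), MeasurableSet s →
      (stdGaussian (EuclideanSpace ℝ (Fin d × Fin a))).map (fun x => quadForms w (A x)) s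
      = stdGaussian (EuclideanSpace ℝ (Fin d × Fin a)) {x | quadForms w (A x) ∈ s} :=
    fun s hs => Measure.map_apply hc.measurable hs
  have hnn : ∀ j x, 0 ≤ quadForms w (A x) j := fun j x => quadForm_nonneg (hw j) _ _
  have hat : ∀ j t, (stdGaussian (EuclideanSpace ℝ (Fin d × Fin a))).map
      (fun x => quadForms w (A x)) {y | y j = t} = 0 := fun j t => by
    rw [hmap _ (measurableSet_eq_fun (by fun_prop) measurable_const)]
    obtain ⟨x₀, hx₀⟩ := exists_quadForms_pos hR hw hv hwS j
    set N : Matrix (Fin a) (Fin a) ℝ := (centering a)ᵀ * Matrix.of (w j).1 * centering a with hN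
    set L : EuclideanSpace ℝ (Fin d × Fin a) →ₗ[ℝ] (Fin a → ℝ) :=
      { toFun := fun x i => A x (j, i)
        map_add' := fun x y => by ext; simp
        map_smul' := fun c x => by ext; simp } with hL
    set b : LinearMap.BilinForm ℝ (EuclideanSpace ℝ (Fin d × Fin a)) :=
      (√(variance (Matrix.of (w j).1) (Matrix.of (w j).2)))⁻¹ •
        (Matrix.toBilin' N).compl₁₂ L L with hb
    have hbx : ∀ x, b x x = quadForms w (A x) j := fun x => by
      rw [quadForms, quadForm_of_pos (hv j), div_eq_inv_mul]
      simp [hb, hL, Matrix.toBilin'_apply', hN]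
    have := stdGaussian_level_eq_zero b (by
      simp_rw [hbx]
      exact ((continuous_apply j).comp hc).measurable) (w := x₀) (by rw [hbx]; exact hx₀.ne') t
    simp only [hbx] at this
    exact this
  refine ⟨hat, fun j => ?_, fun s t hst => ?_⟩
  -- The forms are nonnegative, so being at most `0` means being equal to `0`, which has no mass.
  · rw [← hat j 0, hmap _ (measurableSet_le (by fun_prop) measurable_const),
      hmap _ (measurableSet_eq_fun (by fun_prop) measurable_const)]
    congr 1
    ext x
    exact ⟨fun h => le_antisymm h (hnn j x), fun h => le_of_eq h⟩
  · have hset : {y : Fin d → ℝ | (∃ j, s j < y j) ∧ ∀ j, y j < t j}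
        = (⋃ j, {y | s j < y j}) ∩ ⋂ j, {y | y j < t j} := by ext; simp
    have hopen : IsOpen {y : Fin d → ℝ | (∃ j, s j < y j) ∧ ∀ j, y j < t j} := by
      rw [hset]
      exact (isOpen_iUnion fun j => isOpen_lt (by fun_prop) (by fun_prop)).inter
        (isOpen_iInter_of_finite fun j => isOpen_lt (by fun_prop) (by fun_prop))
    rw [hmap _ hopen.measurableSet]
    refine (hopen.preimage hc).measure_pos _ ?_
    obtain ⟨x, hx⟩ := exists_quadForms_pos hR hw hv hwS ⟨0, hd⟩
    set m : Fin d → ℝ := fun j => (s j + t j) / 2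
    -- It suffices to find one point in the open preimage. Scaling `x` by `√r` multiplies all forms
    -- by `r`; with the smallest ratio `m j / q j` over the positive coordinates, coordinate `j₀`
    -- reaches its midpoint `m j₀` while no other coordinate passes its own.
    obtain ⟨j₀, hj₀, hmin⟩ := Finset.exists_min_image
      (Finset.univ.filter fun j => 0 < quadForms w (A x) j)
      (fun j => m j / quadForms w (A x) j) ⟨⟨0, hd⟩, by simpa using hx⟩
    have hq₀ : 0 < quadForms w (A x) j₀ := by simpa using hj₀
    have hm : ∀ j, s j < m j ∧ m j < t j ∧ 0 < m j := fun j => by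
      obtain ⟨h1, h2⟩ := hst j
      refine ⟨?_, ?_, ?_⟩ <;> simp only [m] <;> linarith
    set r := m j₀ / quadForms w (A x) j₀ with hr
    have hr0 : 0 < r := div_pos (hm j₀).2.2 hq₀
    have hscale : ∀ j, quadForms w (A (√r • x)) j = r * quadForms w (A x) j := fun j => by
      rw [map_smul]
      have := quadForm_smul (Matrix.of (w j).1) (Matrix.of (w j).2) √r (fun i => A x (j, i))
      rw [Real.sq_sqrt hr0.le] at this
      exact this
    refine ⟨√r • x, ⟨j₀, ?_⟩, fun j => ?_⟩
    · change s j₀ < quadForms w (A (√r • x)) j₀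
      rw [hscale, hr, div_mul_cancel₀ _ hq₀.ne']
      exact (hm j₀).1
    · change quadForms w (A (√r • x)) j < t j
      rw [hscale]
      rcases (hnn j x).eq_or_lt with h0 | h0
      · rw [← h0, mul_zero]
        exact (hst j).1.trans (hst j).2
      · have := hmin j (by simpa using h0)
        rw [le_div_iff₀ h0] at this
        exact this.trans_lt (hm j).2.1

open scoped MatrixOrder in
lemma multivariateGaussian_zero_eq_map (hS : S.PosSemidef) :
    ∃ R : Matrix (Fin d × Fin a) (Fin d × Fin a) ℝ, R * Rᵀ = S ∧
      multivariateGaussian 0 S = (stdGaussian (EuclideanSpace ℝ (Fin d × Fin a))).map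
        (fun x => Matrix.toEuclideanCLM (𝕜 := ℝ) R x) := by
  refine ⟨CFC.sqrt S, ?_, ?_⟩
  · have h := (Matrix.nonneg_iff_posSemidef.1 (CFC.sqrt_nonneg S)).isHermitian.eq
    rw [Matrix.conjTranspose_eq_transpose_of_trivial] at h
    rw [h, CFC.sqrt_mul_sqrt_self _ hS.nonneg]
  · simp [multivariateGaussian]

/-- The limit distribution of the vector of test statistics is regular. -/
lemma regularLimit_map_quadForms (hd : 1 ≤ d) (hS : S.PosSemidef)
    (hw : ∀ j, (Matrix.of (w j).1).PosSemidef)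
    (hv : ∀ j, 0 < variance (Matrix.of (w j).1) (Matrix.of (w j).2))
    (hwS : ∀ j i i', (w j).2 i i' = S (j, i) (j, i')) :
    RegularLimit ((multivariateGaussian 0 S).map (quadForms w)) := by
  obtain ⟨R, hR, h⟩ := multivariateGaussian_zero_eq_map hS
  rw [h, Measure.map_map (continuous_quadForms w).measurable (by fun_prop)]
  exact regularLimit_map_quadForms_stdGaussian hd hR hw hv hwS

end limitLaw

/-! ### Convergence in probability to a constant -/

/-- Convergence in probability to a constant. -/
def ConvInProb {Ω F : Type*} [MeasurableSpace Ω] [TopologicalSpace F] (P : Measure Ω)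
    (V : ℕ → Ω → F) (v : F) : Prop :=
  ∀ U ∈ 𝓝 v, WHP P (fun N ω => V N ω ∈ U)

section ConvInProb

variable {Ω : Type*} [MeasurableSpace Ω] {P : Measure Ω}

/-- The neighbourhood formulation needs no metric, so it applies to matrices and passes through maps
that are continuous only at the limit. -/
lemma convInProb_iff_tendstoInMeasure {F : Type*} [PseudoMetricSpace F] {V : ℕ → Ω → F} {v : F} :
    ConvInProb P V v ↔ TendstoInMeasure P V atTop (fun _ => v) := by
  rw [tendstoInMeasure_iff_dist]
  constructor
  · intro h ε hε
    simpa [WHP] using h _ (Metric.ball_mem_nhds v hε)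
  · intro h _ hU
    obtain ⟨ε, hε, hU⟩ := Metric.mem_nhds_iff.1 hU
    have : WHP P (fun N ω => V N ω ∈ Metric.ball v ε) := by simpa [WHP] using h ε hε
    exact this.mono (Eventually.of_forall fun N ω hω => hU hω)

lemma ConvInProb.comp {F G : Type*} [TopologicalSpace F] [TopologicalSpace G] {V : ℕ → Ω → F}
    {v : F} (hV : ConvInProb P V v) {f : F → G} (hf : ContinuousAt f v) :
    ConvInProb P (fun N ω => f (V N ω)) (f v) :=
  fun _ hU => hV _ (hf hU)

lemma ConvInProb.pi {ι : Type*} [Finite ι] {F : ι → Type*} [∀ i, TopologicalSpace (F i)]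
    {V : ℕ → Ω → (i : ι) → F i} {v : (i : ι) → F i}
    (hV : ∀ i, ConvInProb P (fun N ω => V N ω i) (v i)) : ConvInProb P V v := by
  have := Fintype.ofFinite ι
  intro _ hU
  rw [nhds_pi, Filter.mem_pi'] at hU
  obtain ⟨I, t, ht, hU⟩ := hU
  exact (WHP.finset_forall I fun i _ => hV i _ (ht i)).mono
    (Eventually.of_forall fun N ω hω => hU hω)

lemma ConvInProb.prodMk {F G : Type*} [TopologicalSpace F] [TopologicalSpace G] {V : ℕ → Ω → F}
    {W : ℕ → Ω → G} {v : F} {w : G} (hV : ConvInProb P V v) (hW : ConvInProb P W w) :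
    ConvInProb P (fun N ω => (V N ω, W N ω)) (v, w) := by
  intro _ hU
  rw [nhds_prod_eq, Filter.mem_prod_iff] at hU
  obtain ⟨s, hs, t, ht, hU⟩ := hU
  exact ((hV s hs).and (hW t ht)).mono (Eventually.of_forall fun N ω hω => hU ⟨hω.1, hω.2⟩)

lemma ConvInProb.congr {F : Type*} [TopologicalSpace F] {V W : ℕ → Ω → F}
    {v : F} (hV : ConvInProb P V v) (h : ∀ᶠ N in atTop, ∀ ω, V N ω = W N ω) : ConvInProb P W v :=
  fun U hU => (hV U hU).mono (h.mono fun _ hN ω hω => hN ω ▸ hω)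

lemma ConvInProb.of_tendsto {F : Type*} [TopologicalSpace F] {V : ℕ → F} {v : F}
    (hV : Tendsto V atTop (𝓝 v)) : ConvInProb P (fun N _ => V N) v :=
  fun _ hU => WHP.of_forall ((hV.eventually hU).mono fun _ h _ => h)

lemma ConvInProb.comp_tendsto {F : Type*} [TopologicalSpace F] {V : ℕ → Ω → F} {v : F}
    (hV : ConvInProb P V v) {n : ℕ → ℕ} (hn : Tendsto n atTop atTop) :
    ConvInProb P (fun N => V (n N)) v :=
  fun U hU => (hV U hU).comp hn

end ConvInProb

/-! ### Weak convergence of the vector of quadratic forms -/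

section weak

variable {a d : ℕ}

/-- Pairs of matrices for all components. -/
abbrev Params (a d : ℕ) : Type := Fin d → (Fin a → Fin a → ℝ) × (Fin a → Fin a → ℝ)

instance borelSpace_params : BorelSpace (Params a d) := by
  have : BorelSpace ((Fin a → Fin a → ℝ) × (Fin a → Fin a → ℝ)) := inferInstance
  exact Pi.borelSpace

lemma continuous_variance :
    Continuous fun p : (Fin a → Fin a → ℝ) × (Fin a → Fin a → ℝ) =>
      variance (Matrix.of p.1) (Matrix.of p.2) := by
  have h1 : Continuous fun p : (Fin a → Fin a → ℝ) × (Fin a → Fin a → ℝ) =>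
    (Matrix.of p.1 : Matrix (Fin a) (Fin a) ℝ) := continuous_fst
  have h2 : Continuous fun p : (Fin a → Fin a → ℝ) × (Fin a → Fin a → ℝ) =>
    (Matrix.of p.2 : Matrix (Fin a) (Fin a) ℝ) := continuous_snd
  unfold variance
  fun_prop

lemma continuous_quadForm_num :
    Continuous fun p : (Fin a → Fin a → ℝ) × (Fin a → ℝ) =>
      (centering a *ᵥ p.2) ⬝ᵥ (Matrix.of p.1 *ᵥ (centering a *ᵥ p.2)) := by
  have h1 : Continuous fun p : (Fin a → Fin a → ℝ) × (Fin a → ℝ) =>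
    (Matrix.of p.1 : Matrix (Fin a) (Fin a) ℝ) := continuous_fst
  fun_prop

/-- Positivity of the trace is an open condition, so near `w` the default value `0` of `quadForm`
never occurs. -/
lemma continuousAt_quadForms {w : Params a d} {z : EuclideanSpace ℝ (Fin d × Fin a)}
    (hv : ∀ j, 0 < variance (Matrix.of (w j).1) (Matrix.of (w j).2)) :
    ContinuousAt (fun p : EuclideanSpace ℝ (Fin d × Fin a) × Params a d => quadForms p.2 p.1)
      (z, w) := by
  refine continuousAt_pi.2 fun j => ?_
  have hvc : Continuous fun p : EuclideanSpace ℝ (Fin d × Fin a) × Params a d =>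
      variance (Matrix.of (p.2 j).1) (Matrix.of (p.2 j).2) :=
    continuous_variance.comp (by fun_prop)
  have hnc : Continuous fun p : EuclideanSpace ℝ (Fin d × Fin a) × Params a d =>
      (centering a *ᵥ fun i => p.1 (j, i)) ⬝ᵥ
        (Matrix.of (p.2 j).1 *ᵥ (centering a *ᵥ fun i => p.1 (j, i))) :=
    continuous_quadForm_num.comp (f := fun p : EuclideanSpace ℝ (Fin d × Fin a) × Params a d =>
      ((p.2 j).1, fun i => p.1 (j, i))) (by fun_prop)
  have hpos : ∀ᶠ p : EuclideanSpace ℝ (Fin d × Fin a) × Params a d in 𝓝 (z, w),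
      0 < variance (Matrix.of (p.2 j).1) (Matrix.of (p.2 j).2) :=
    hvc.continuousAt.eventually_const_lt (hv j)
  have : ContinuousAt (fun p : EuclideanSpace ℝ (Fin d × Fin a) × Params a d =>
      ((centering a *ᵥ fun i => p.1 (j, i)) ⬝ᵥ
        (Matrix.of (p.2 j).1 *ᵥ (centering a *ᵥ fun i => p.1 (j, i)))) /
      √(variance (Matrix.of (p.2 j).1) (Matrix.of (p.2 j).2))) (z, w) :=
    hnc.continuousAt.div (Real.continuous_sqrt.continuousAt.comp hvc.continuousAt)
      (Real.sqrt_pos.2 (hv j)).ne'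
  refine this.congr ?_
  filter_upwards [hpos] with p hp
  rw [quadForms, quadForm, if_pos hp]

lemma measurable_quadForms :
    Measurable (fun p : EuclideanSpace ℝ (Fin d × Fin a) × Params a d => quadForms p.2 p.1) := by
  refine measurable_pi_lambda _ fun j => ?_
  have hvc : Continuous fun p : EuclideanSpace ℝ (Fin d × Fin a) × Params a d =>
      variance (Matrix.of (p.2 j).1) (Matrix.of (p.2 j).2) :=
    continuous_variance.comp (by fun_prop)
  have hnc : Continuous fun p : EuclideanSpace ℝ (Fin d × Fin a) × Params a d =>
      (centering a *ᵥ fun i => p.1 (j, i)) ⬝ᵥ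
        (Matrix.of (p.2 j).1 *ᵥ (centering a *ᵥ fun i => p.1 (j, i))) :=
    continuous_quadForm_num.comp (f := fun p : EuclideanSpace ℝ (Fin d × Fin a) × Params a d =>
      ((p.2 j).1, fun i => p.1 (j, i))) (by fun_prop)
  exact Measurable.ite (measurableSet_lt measurable_const hvc.measurable)
    (hnc.measurable.div hvc.measurable.sqrt) measurable_const

/-- Atomless marginals make this union null, so exceedance sets are continuity sets of the limit
law. -/
lemma frontier_exceed_subset (T : Finset (Fin d)) (t : Fin d → ℝ) :
    frontier (exceed T t) ⊆ ⋃ j, {y | y j = t j} := by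
  have hopen : IsOpen (exceed T t) := by
    have : exceed T t = ⋃ j ∈ T, {y | t j < y j} := by ext; simp [exceed]
    rw [this]
    exact isOpen_biUnion fun j _ => isOpen_lt (by fun_prop) (by fun_prop)
  have hcl : IsClosed (⋃ j ∈ T, {y : Fin d → ℝ | t j ≤ y j}) :=
    isClosed_biUnion_finset fun j _ => isClosed_le (by fun_prop) (by fun_prop)
  have hsub : exceed T t ⊆ ⋃ j ∈ T, {y : Fin d → ℝ | t j ≤ y j} := fun y ⟨j, hj, hlt⟩ =>
    Set.mem_biUnion hj hlt.le
  intro y hy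
  rw [hopen.frontier_eq] at hy
  have := closure_minimal hsub hcl hy.1
  simp only [Set.mem_iUnion] at this
  obtain ⟨j, hj, hle⟩ := this
  refine Set.mem_iUnion.2 ⟨j, ?_⟩
  by_contra hne
  exact hy.2 ⟨j, hj, lt_of_le_of_ne hle (Ne.symm hne)⟩

lemma mem_frontier_of_continuousAt {X Y : Type*} [TopologicalSpace X] [TopologicalSpace Y]
    {f : X → Y} {x : X} (hf : ContinuousAt f x) {s : Set Y} (hx : x ∈ frontier (f ⁻¹' s)) :
    f x ∈ frontier s := by
  refine ⟨hf.continuousWithinAt.mem_closure hx.1 (Set.mapsTo_preimage f s), fun hint => hx.2 ?_⟩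
  rw [mem_interior_iff_mem_nhds] at hint ⊢
  exact hf hint

/-- Portmanteau on the joint law of vector and matrices. The evaluation map is known to be
continuous only at points `(z, w)`, but the limit law lives there, and such frontier points are
mapped to the frontier of `exceed T t`. The lemma serves the statistics, whose matrices are random,
and the replicates, whose matrices are fixed given the data. -/
lemma tendsto_measure_quadForms_mem_exceed
    {ρ : ℕ → ProbabilityMeasure (EuclideanSpace ℝ (Fin d × Fin a) × Params a d)}
    {ρ₀ : ProbabilityMeasure (EuclideanSpace ℝ (Fin d × Fin a) × Params a d)}
    (hρ : Tendsto ρ atTop (𝓝 ρ₀)) {γ : Measure (EuclideanSpace ℝ (Fin d × Fin a))}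
    {w : Params a d} (h₀ : (ρ₀ : Measure _) = γ.map (fun z => (z, w)))
    (hv : ∀ j, 0 < variance (Matrix.of (w j).1) (Matrix.of (w j).2))
    (hν : RegularLimit (γ.map (quadForms w))) (T : Finset (Fin d)) (t : Fin d → ℝ) :
    Tendsto (fun N => (ρ N : Measure (EuclideanSpace ℝ (Fin d × Fin a) × Params a d)).real
      {p | quadForms p.2 p.1 ∈ exceed T t}) atTop
      (𝓝 ((γ.map (quadForms w)).real (exceed T t))) := by
  set f : EuclideanSpace ℝ (Fin d × Fin a) × Params a d → (Fin d → ℝ) :=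
    fun p => quadForms p.2 p.1 with hf
  have hmk : Measurable fun z : EuclideanSpace ℝ (Fin d × Fin a) => (z, w) := by fun_prop
  have hq : Measurable (quadForms (d := d) w) := (continuous_quadForms w).measurable
  have hmeas : MeasurableSet (f ⁻¹' exceed T t) := measurable_quadForms (measurableSet_exceed T t)
  have hnull : (ρ₀ : Measure _) (frontier (f ⁻¹' exceed T t)) = 0 := by
    rw [h₀, Measure.map_apply hmk isClosed_frontier.measurableSet]
    refine measure_mono_null (t := ⋃ j, {z | quadForms w z j = t j}) ?_ ?_
    · intro z hz
      have := frontier_exceed_subset T t (mem_frontier_of_continuousAt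
        (continuousAt_quadForms (z := z) hv) hz)
      simpa using this
    · refine measure_iUnion_null fun j => ?_
      have := hν.atomless j (t j)
      rwa [Measure.map_apply hq (measurableSet_eq_fun (by fun_prop) measurable_const)] at this
  have := ProbabilityMeasure.tendsto_measure_of_null_frontier_of_tendsto' hρ hnull
  rw [h₀, Measure.map_apply hmk hmeas] at this
  have h2 := (ENNReal.tendsto_toReal (by
    rw [← Measure.map_apply hmk hmeas, ← h₀]; exact measure_ne_top _ _)).comp this
  have h3 : (γ.map (quadForms w)).real (exceed T t)
      = (γ ((fun z => (z, w)) ⁻¹' (f ⁻¹' exceed T t))).toReal := by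
    rw [measureReal_def, Measure.map_apply hq (measurableSet_exceed T t)]
    rfl
  rw [h3]
  exact h2

variable {S : Matrix (Fin d × Fin a) (Fin d × Fin a) ℝ} {w : Params a d}

lemma tendsto_multivariateGaussian {Sn : ℕ → Matrix (Fin d × Fin a) (Fin d × Fin a) ℝ}
    (hSn : ∀ n, (Sn n).PosSemidef) (hS : S.PosSemidef) (h : Tendsto Sn atTop (𝓝 S)) :
    Tendsto (β := ProbabilityMeasure (EuclideanSpace ℝ (Fin d × Fin a)))
      (fun n => ⟨multivariateGaussian 0 (Sn n), inferInstance⟩) atTop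
      (𝓝 ⟨multivariateGaussian 0 S, inferInstance⟩) := by
  refine ProbabilityMeasure.tendsto_iff_tendsto_charFun.2 fun t => ?_
  simp only [ProbabilityMeasure.coe_mk]
  simp_rw [charFun_multivariateGaussian (hSn _)]
  rw [charFun_multivariateGaussian hS]
  refine (Complex.continuous_exp.tendsto _).comp ?_
  refine Tendsto.sub tendsto_const_nhds (Tendsto.div_const ?_ _)
  refine (Complex.continuous_ofReal.tendsto _).comp ?_
  have hc : Continuous fun A : Matrix (Fin d × Fin a) (Fin d × Fin a) ℝ =>
    (t : Fin d × Fin a → ℝ) ⬝ᵥ A *ᵥ (t : Fin d × Fin a → ℝ) := by fun_prop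
  exact (hc.tendsto S).comp h

lemma coe_prod_diracProba (γ : ProbabilityMeasure (EuclideanSpace ℝ (Fin d × Fin a)))
    (w : Params a d) : (γ.prod (diracProba w)).toMeasure
      = γ.toMeasure.map (fun z => (z, w)) :=
  Measure.prod_dirac w

/-- Fixed matrices are treated as random ones with Dirac law; product measures converge weakly when
both factors do. -/
lemma tendsto_multivariateGaussian_quadForms_mem_exceed (hd : 1 ≤ d)
    {Sn : ℕ → Matrix (Fin d × Fin a) (Fin d × Fin a) ℝ} {wn : ℕ → Params a d}
    (hSn : ∀ n, (Sn n).PosSemidef) (hS : S.PosSemidef) (h : Tendsto Sn atTop (𝓝 S))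
    (hwn : Tendsto wn atTop (𝓝 w))
    (hw : ∀ j, (Matrix.of (w j).1).PosSemidef)
    (hv : ∀ j, 0 < variance (Matrix.of (w j).1) (Matrix.of (w j).2))
    (hwS : ∀ j i i', (w j).2 i i' = S (j, i) (j, i'))
    (T : Finset (Fin d)) (t : Fin d → ℝ) :
    Tendsto (fun n => (multivariateGaussian 0 (Sn n)).real {z | quadForms (wn n) z ∈ exceed T t})
      atTop (𝓝 (((multivariateGaussian 0 S).map (quadForms w)).real (exceed T t))) := by
  have hprod := (ProbabilityMeasure.continuous_prod.tendsto
    ((⟨multivariateGaussian 0 S, inferInstance⟩ : ProbabilityMeasure _), diracProba w)).comp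
    ((tendsto_multivariateGaussian hSn hS h).prodMk_nhds
      ((continuous_diracProba.tendsto w).comp hwn))
  have key := tendsto_measure_quadForms_mem_exceed hprod (γ := multivariateGaussian 0 S) (w := w)
    (coe_prod_diracProba _ _) hv (regularLimit_map_quadForms hd hS hw hv hwS) T t
  refine key.congr fun n => ?_
  rw [Function.comp_apply, Function.comp_apply, coe_prod_diracProba]
  exact map_measureReal_apply (by fun_prop) (measurable_quadForms (measurableSet_exceed T t))

/-- Gaussian probabilities of the rejection regions depend continuously on the covariance matrix
and the matrices of the quadratic forms. -/
lemma eventually_multivariateGaussian_quadForms_mem_exceed (hd : 1 ≤ d) (hS : S.PosSemidef)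
    (hw : ∀ j, (Matrix.of (w j).1).PosSemidef)
    (hv : ∀ j, 0 < variance (Matrix.of (w j).1) (Matrix.of (w j).2))
    (hwS : ∀ j i i', (w j).2 i i' = S (j, i) (j, i'))
    (T : Finset (Fin d)) (t : Fin d → ℝ) {η : ℝ} (hη : 0 < η) :
    ∀ᶠ p : (Matrix (Fin d × Fin a) (Fin d × Fin a) ℝ) × Params a d in 𝓝 (S, w),
      p.1.PosSemidef →
      |(multivariateGaussian 0 p.1).real {z | quadForms p.2 z ∈ exceed T t}
        - ((multivariateGaussian 0 S).map (quadForms w)).real (exceed T t)| < η := by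
  have : FirstCountableTopology (Matrix (Fin d × Fin a) (Fin d × Fin a) ℝ) :=
    inferInstanceAs (FirstCountableTopology (Fin d × Fin a → Fin d × Fin a → ℝ))
  -- First countability turns a failure into a sequence of positive semidefinite covariances and
  -- matrices converging to `(S, w)`, against the sequential statement.
  by_contra hcon
  rw [Filter.not_eventually] at hcon
  obtain ⟨x, hx, hx'⟩ := exists_seq_forall_of_frequently hcon
  simp only [Classical.not_imp, not_lt] at hx'
  have h := tendsto_multivariateGaussian_quadForms_mem_exceed hd (fun n => (hx' n).1) hS
    ((continuous_fst.tendsto _).comp hx) ((continuous_snd.tendsto _).comp hx) hw hv hwS T t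
  obtain ⟨n, hn⟩ := (Metric.tendsto_nhds.1 h η hη).exists
  rw [Real.dist_eq] at hn
  exact absurd hn (not_lt.2 (hx' n).2)

end weak

section

/-! ### Consistency of the Monte-Carlo replicates -/

/-- Chebyshev's inequality for the proportion of independent replicates in a set. -/
lemma pi_measure_abs_proportion_sub_ge_le {E : Type*} [MeasurableSpace E] (γ : Measure E)
    [IsProbabilityMeasure γ] {B : ℕ} (hB : 0 < B) {A : Set E} (hA : MeasurableSet A)
    {η : ℝ} (hη : 0 < η) :
    Measure.pi (fun _ : Fin B => γ)
      {z | η ≤ |(∑ b, A.indicator (1 : E → ℝ) (z b)) / B - γ.real A|}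
      ≤ ENNReal.ofReal (1 / (B * η ^ 2)) := by
  set f : E → ℝ := fun e => A.indicator (1 : E → ℝ) e / B with hf
  have hB' : (0 : ℝ) < B := by positivity
  have hmf : Measurable f := (measurable_one.indicator hA).div_const _
  have hf01 : ∀ e, f e ∈ Set.Icc (0 : ℝ) (1 / B) := fun e => by
    by_cases he : e ∈ A <;> simp [hf, he]
  have hLp : MemLp f 2 γ := by
    refine MemLp.of_bound hmf.aestronglyMeasurable (1 / B) (ae_of_all _ fun e => ?_)
    rw [Real.norm_eq_abs, abs_of_nonneg (hf01 e).1]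
    exact (hf01 e).2
  -- Each summand takes values in `[0, 1 / B]`, so a variance bound of `1 / B ^ 2` suffices: the `B`
  -- independent summands together have variance at most `1 / B`.
  have hvar : Var[f; γ] ≤ (1 / (B : ℝ)) ^ 2 := by
    have h1 := variance_le_sub_mul_sub (μ := γ) (ae_of_all _ hf01) hmf.aemeasurable
    have h2 : 0 ≤ ∫ e, f e ∂γ := integral_nonneg fun e => (hf01 e).1
    have h3 : (0 : ℝ) ≤ 1 / B := by positivity
    rw [sub_zero] at h1
    nlinarith [sq_nonneg (1 / (B : ℝ) - ∫ e, f e ∂γ)]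
  have hsum := variance_sum_pi (μ := fun _ : Fin B => γ) (X := fun _ => f) (fun _ => hLp)
  have hLpi : ∀ b : Fin B, MemLp (fun z : Fin B → E => f (z b)) 2 (Measure.pi fun _ => γ) :=
    fun b => hLp.comp_measurePreserving (measurePreserving_eval _ b)
  have hLpS : MemLp (∑ b : Fin B, fun z : Fin B → E => f (z b)) 2 (Measure.pi fun _ => γ) :=
    memLp_finsetSum' _ fun b _ => hLpi b
  have hint : ∫ z, (∑ b : Fin B, fun z : Fin B → E => f (z b)) z ∂(Measure.pi fun _ => γ)
      = γ.real A := by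
    simp_rw [Finset.sum_apply]
    rw [integral_finsetSum _ fun b _ => (hLpi b).integrable one_le_two]
    have : ∀ b : Fin B, ∫ z : Fin B → E, f (z b) ∂(Measure.pi fun _ => γ) = γ.real A / B :=
      fun b => by
        rw [integral_comp_eval (μ := fun _ : Fin B => γ) hmf.aestronglyMeasurable]
        simp only [hf]
        rw [integral_div, integral_indicator_one hA]
    simp only [this, Finset.sum_const, Finset.card_univ, Fintype.card_fin, nsmul_eq_mul]
    field_simp
  have key := meas_ge_le_variance_div_sq hLpS hη
  rw [hint, hsum] at key
  refine le_trans (le_of_eq ?_) (key.trans (ENNReal.ofReal_le_ofReal ?_))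
  · congr 1
    ext z
    simp [hf, Finset.sum_div]
  · simp only [Finset.sum_const, Finset.card_univ, Fintype.card_fin, nsmul_eq_mul]
    rw [div_le_div_iff₀ (by positivity) (by positivity)]
    have : (B : ℝ) * Var[f; γ] * B ≤ 1 := by
      calc (B : ℝ) * Var[f; γ] * B ≤ B * (1 / (B : ℝ)) ^ 2 * B := by gcongr
        _ = 1 := by field_simp
    nlinarith [sq_nonneg η]

variable {a d : ℕ}

/-- The matrices which enter the Monte-Carlo statistics. -/
def mcParams {n : Fin a → ℕ}
    (M : Matrix (Fin a) (Fin a) ℝ → Matrix (Fin a) (Fin a) ℝ → Matrix (Fin a) (Fin a) ℝ)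
    (x : Sample d n) : Params a d :=
  fun j => (M (centering a) (empCovComp x j), empCovComp x j)

lemma measurable_groupMean {n : Fin a → ℕ} (i : Fin a) (j : Fin d) :
    Measurable fun x : Sample d n => groupMean x i j := by
  unfold groupMean
  fun_prop

lemma measurable_empCov {n : Fin a → ℕ} (i : Fin a) (j j' : Fin d) :
    Measurable fun x : Sample d n => empCov x i j j' := by
  have h : (fun x : Sample d n => empCov x i j j') = fun x => ((n i : ℝ) - 1)⁻¹ *
      ∑ k, (x i k j - groupMean x i j) * (x i k j' - groupMean x i j') := by
    ext x
    simp [empCov, Matrix.sum_apply, Matrix.vecMulVec_apply]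
  rw [h]
  have h1 := measurable_groupMean (d := d) (n := n) i j
  have h2 := measurable_groupMean (d := d) (n := n) i j'
  fun_prop

lemma empCovFull_apply {n : Fin a → ℕ} (x : Sample d n) (j j' : Fin d) (i i' : Fin a) :
    empCovFull x (j, i) (j', i')
      = totalSize n * (if i = i' then (n i : ℝ)⁻¹ * empCov x i j j' else 0) := by
  simp [empCovFull, Matrix.blockDiagonal_apply]

lemma empCovComp_apply {n : Fin a → ℕ} (x : Sample d n) (j : Fin d) (i i' : Fin a) :
    empCovComp x j i i' = empCovFull x (j, i) (j, i') := by
  rw [empCovFull_apply]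
  simp [empCovComp, Matrix.diagonal_apply]

lemma measurable_empCovFull {n : Fin a → ℕ} (p q : Fin d × Fin a) :
    Measurable fun x : Sample d n => empCovFull x p q := by
  obtain ⟨j, i⟩ := p
  obtain ⟨j', i'⟩ := q
  simp_rw [empCovFull_apply]
  have := measurable_empCov (n := n) i j j'
  split_ifs <;> fun_prop

lemma posSemidef_empCov {n : Fin a → ℕ} (x : Sample d n) (i : Fin a) :
    (empCov x i).PosSemidef := by
  unfold empCov
  -- For an empty group the factor `(0 - 1)⁻¹` is negative, but the sum is empty; for a single
  -- subject the factor is `0⁻¹ = 0`.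
  rcases Nat.eq_zero_or_pos (n i) with h | h
  · have : IsEmpty (Fin (n i)) := by rw [h]; infer_instance
    simpa using Matrix.PosSemidef.zero
  · refine Matrix.PosSemidef.smul (Matrix.posSemidef_sum _ fun k _ => ?_) ?_
    · simpa using Matrix.posSemidef_vecMulVec_self_star (x i k - groupMean x i)
    · have : (1 : ℝ) ≤ n i := by exact_mod_cast h
      rw [inv_nonneg]
      linarith

lemma posSemidef_blockDiagonal {A : Fin a → Matrix (Fin d) (Fin d) ℝ}
    (hA : ∀ i, (A i).PosSemidef) : (Matrix.blockDiagonal A).PosSemidef := by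
  refine Matrix.PosSemidef.of_dotProduct_mulVec_nonneg ?_ fun z => ?_
  · rw [Matrix.IsHermitian, Matrix.blockDiagonal_conjTranspose]
    congr 1
    funext i
    exact (hA i).isHermitian
  · have : star z ⬝ᵥ Matrix.blockDiagonal A *ᵥ z
        = ∑ i, star (fun j => z (j, i)) ⬝ᵥ A i *ᵥ (fun j => z (j, i)) := by
      simp only [dotProduct, Matrix.mulVec, Matrix.blockDiagonal_apply, Fintype.sum_prod_type,
        Pi.star_apply, star_trivial]
      rw [Finset.sum_comm]
      simp
    rw [this]
    exact Finset.sum_nonneg fun i _ => (hA i).dotProduct_mulVec_nonneg _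

lemma posSemidef_empCovFull {n : Fin a → ℕ} (x : Sample d n) : (empCovFull x).PosSemidef := by
  refine Matrix.PosSemidef.smul (posSemidef_blockDiagonal fun i => ?_) (by positivity)
  exact (posSemidef_empCov x i).smul (by positivity)

lemma measurable_mcParams {n : Fin a → ℕ}
    {M : Matrix (Fin a) (Fin a) ℝ → Matrix (Fin a) (Fin a) ℝ → Matrix (Fin a) (Fin a) ℝ}
    (hM : ∀ r s, Measurable
      (fun S : Fin a → Fin a → ℝ => M (centering a) (Matrix.of S) r s)) :
    Measurable fun x : Sample d n => mcParams M x := by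
  have h : ∀ j : Fin d, Measurable fun (x : Sample d n) i i' => empCovComp x j i i' :=
    fun j => measurable_pi_lambda _ fun i => measurable_pi_lambda _ fun i' => by
      simp_rw [empCovComp_apply]
      exact measurable_empCovFull _ _
  refine measurable_pi_lambda _ fun j => Measurable.prodMk ?_ (h j)
  exact measurable_pi_lambda _ fun i => measurable_pi_lambda _ fun i' => (hM i i').comp (h j)

lemma empExceed_eq_sum_indicator {B : ℕ} (T : Finset (Fin d)) (t : Fin d → ℝ)
    (y : Fin B → Fin d → ℝ) :
    empExceed T t y = (∑ b, (exceed T t).indicator (1 : (Fin d → ℝ) → ℝ) (y b)) / B := by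
  classical
  unfold empExceed
  rw [Finset.card_filter, Nat.cast_sum]
  congr 1
  refine Finset.sum_congr rfl fun b _ => ?_
  by_cases h : ∃ j ∈ T, t j < y b j
  · rw [Set.indicator_of_mem (by exact h), if_pos h]; simp
  · rw [Set.indicator_of_notMem (by exact h), if_neg h]; simp

lemma measurable_mcStat {n : Fin a → ℕ}
    {M : Matrix (Fin a) (Fin a) ℝ → Matrix (Fin a) (Fin a) ℝ → Matrix (Fin a) (Fin a) ℝ}
    (hM : ∀ r s, Measurable
      (fun S : Fin a → Fin a → ℝ => M (centering a) (Matrix.of S) r s))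
    {X : Type*} [MeasurableSpace X] {f : X → Sample d n}
    {g : X → EuclideanSpace ℝ (Fin d × Fin a)} (hf : Measurable f) (hg : Measurable g) :
    Measurable fun x => mcStat M (f x) (g x) := by
  have h : Measurable fun x => (g x, mcParams M (f x)) :=
    hg.prodMk ((measurable_mcParams hM).comp hf)
  have h2 : Measurable ((fun p : EuclideanSpace ℝ (Fin d × Fin a) × Params a d =>
    quadForms p.2 p.1) ∘ fun x => (g x, mcParams M (f x))) := measurable_quadForms.comp h
  exact h2

/-- If the Gaussian probability of a rejection region is close to `c` for data in `G`, the
proportion of replicates in this region is close to `c`, up to the probability of the complement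
of `G` and a Chebyshev bound. -/
lemma measure_abs_empExceed_mcStat_sub_ge_le
    {Ω : Type*} [MeasurableSpace Ω] {P : Measure Ω} [IsProbabilityMeasure P]
    {n : Fin a → ℕ} {X : Ω → Sample d n} (hX : Measurable X)
    {M : Matrix (Fin a) (Fin a) ℝ → Matrix (Fin a) (Fin a) ℝ → Matrix (Fin a) (Fin a) ℝ}
    (hM : ∀ r s, Measurable
      (fun S : Fin a → Fin a → ℝ => M (centering a) (Matrix.of S) r s))
    {B : ℕ} (hB : 0 < B) {Z : Ω → Fin B → EuclideanSpace ℝ (Fin d × Fin a)}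
    (hZ_meas : Measurable Z)
    (hZ : ∀ᵐ x ∂(P.map X), condDistrib Z X P x
        = Measure.pi (fun _ : Fin B => multivariateGaussian 0 (empCovFull x)))
    (T : Finset (Fin d)) (t : Fin d → ℝ) {c η : ℝ} (hη : 0 < η) {G : Set (Sample d n)}
    (hGm : MeasurableSet G)
    (hG : ∀ x ∈ G, |(multivariateGaussian 0 (empCovFull x)).real
      {z | quadForms (mcParams M x) z ∈ exceed T t} - c| < η / 2) :
    P {ω | ¬ |empExceed T t (fun b => mcStat M (X ω) (Z ω b)) - c| < η}
      ≤ P {ω | ¬ X ω ∈ G} + ENNReal.ofReal (1 / (B * (η / 2) ^ 2)) := by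
  have hstat : Measurable fun p : Sample d n × (Fin B → EuclideanSpace ℝ (Fin d × Fin a)) =>
      fun b => mcStat M p.1 (p.2 b) :=
    measurable_pi_lambda _ fun b => measurable_mcStat hM measurable_fst (by fun_prop)
  set C : Set (Sample d n × (Fin B → EuclideanSpace ℝ (Fin d × Fin a))) :=
    {p | η ≤ |empExceed T t (fun b => mcStat M p.1 (p.2 b)) - c|} with hC
  have hCm : MeasurableSet C := by
    have := measurable_empExceed T hstat (measurable_const (a := t))
    exact measurableSet_le measurable_const ((this.sub_const c).abs)
  -- The joint law of data and draws is disintegrated along the data.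
  have h1 : P {ω | ¬ |empExceed T t (fun b => mcStat M (X ω) (Z ω b)) - c| < η}
      = ∫⁻ x, condDistrib Z X P x (Prod.mk x ⁻¹' C) ∂(P.map X) := by
    rw [← Measure.compProd_apply hCm, compProd_map_condDistrib hZ_meas.aemeasurable,
      Measure.map_apply (hX.prodMk hZ_meas) hCm]
    congr 1
    ext ω
    exact not_lt
  -- On `G` the centre `c` is within `η / 2` of the conditional probability, so a deviation `η`
  -- forces a Chebyshev deviation `η / 2`. Off `G` the trivial bound `1` is used.
  have h2 : ∀ᵐ x ∂(P.map X), condDistrib Z X P x (Prod.mk x ⁻¹' C)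
      ≤ Gᶜ.indicator 1 x + ENNReal.ofReal (1 / (B * (η / 2) ^ 2)) := by
    filter_upwards [hZ] with x hx
    by_cases hxG : x ∈ G
    · rw [hx]
      refine le_add_of_nonneg_of_le zero_le ?_
      set A : Set (EuclideanSpace ℝ (Fin d × Fin a)) :=
        {z | quadForms (mcParams M x) z ∈ exceed T t} with hA
      have hAm : MeasurableSet A :=
        (continuous_quadForms _).measurable (measurableSet_exceed T t)
      refine le_trans (measure_mono ?_) (pi_measure_abs_proportion_sub_ge_le
        (multivariateGaussian 0 (empCovFull x)) hB hAm (half_pos hη))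
      intro z hz
      have hz' : η ≤ |empExceed T t (fun b => mcStat M x (z b)) - c| := hz
      rw [empExceed_eq_sum_indicator] at hz'
      have hind : ∀ b, A.indicator (1 : EuclideanSpace ℝ (Fin d × Fin a) → ℝ) (z b)
        = (exceed T t).indicator (1 : (Fin d → ℝ) → ℝ) (mcStat M x (z b)) := fun b => rfl
      simp only [Set.mem_ofPred_eq, hind]
      have htri := abs_sub_le
        ((∑ b, (exceed T t).indicator (1 : (Fin d → ℝ) → ℝ) (mcStat M x (z b))) / (B : ℝ))
        ((multivariateGaussian 0 (empCovFull x)).real A) c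
      have := hG x hxG
      linarith
    · rw [Set.indicator_of_mem (by exact hxG)]
      exact prob_le_one.trans (le_add_of_nonneg_right zero_le)
  rw [h1]
  refine (lintegral_mono_ae h2).trans ?_
  have hprob : IsProbabilityMeasure (P.map X) :=
    Measure.isProbabilityMeasure_map hX.aemeasurable
  rw [lintegral_add_right _ measurable_const, lintegral_indicator_one hGm.compl,
    lintegral_const, measure_univ, mul_one, Measure.map_apply hX hGm.compl]
  rfl

/-- The Monte-Carlo replicates are consistent for the limit distribution of the test statistics. -/
theorem empConsistent_mcStat (hd : 1 ≤ d)
    {Ω : Type*} [MeasurableSpace Ω] (P : Measure Ω) [IsProbabilityMeasure P]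
    (n : ℕ → Fin a → ℕ) {X : (N : ℕ) → Ω → Sample d (n N)} (hX : ∀ N, Measurable (X N))
    {M : Matrix (Fin a) (Fin a) ℝ → Matrix (Fin a) (Fin a) ℝ → Matrix (Fin a) (Fin a) ℝ}
    (hM : ∀ r s, Measurable
      (fun S : Fin a → Fin a → ℝ => M (centering a) (Matrix.of S) r s))
    {S : Matrix (Fin d × Fin a) (Fin d × Fin a) ℝ} {w : Params a d} (hS : S.PosSemidef)
    (hw : ∀ j, (Matrix.of (w j).1).PosSemidef)
    (hv : ∀ j, 0 < variance (Matrix.of (w j).1) (Matrix.of (w j).2))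
    (hwS : ∀ j i i', (w j).2 i i' = S (j, i) (j, i'))
    (hconvS : ConvInProb P (fun N ω => empCovFull (X N ω)) S)
    (hconvw : ConvInProb P (fun N ω => mcParams M (X N ω)) w)
    {B : ℕ → ℕ} (hB : Tendsto B atTop atTop)
    {Z : (N : ℕ) → Ω → Fin (B N) → EuclideanSpace ℝ (Fin d × Fin a)}
    (hZ_meas : ∀ N, Measurable (Z N))
    (hZ : ∀ N, ∀ᵐ x ∂(P.map (X N)), condDistrib (Z N) (X N) P x
        = Measure.pi (fun _ : Fin (B N) => multivariateGaussian 0 (empCovFull x))) :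
    EmpConsistent ((multivariateGaussian 0 S).map (quadForms w)) P
      (fun N ω b => mcStat M (X N ω) (Z N ω b)) := by
  intro T t η hη
  set c := ((multivariateGaussian 0 S).map (quadForms w)).real (exceed T t) with hc
  have hev := eventually_multivariateGaussian_quadForms_mem_exceed hd hS hw hv hwS T t
    (half_pos hη)
  rw [nhds_prod_eq] at hev
  obtain ⟨U₁, hU₁, U₂, hU₂, hU⟩ := Filter.mem_prod_iff.1 hev
  -- Open neighbourhoods are chosen so that the set of good data is measurable.
  obtain ⟨U₁', hU₁', hU₁o, hSU₁⟩ := mem_nhds_iff.1 hU₁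
  obtain ⟨U₂', hU₂', hU₂o, hwU₂⟩ := mem_nhds_iff.1 hU₂
  have hgood' : ∀ {n : Fin a → ℕ} (x : Sample d n), empCovFull x ∈ U₁' → mcParams M x ∈ U₂' →
      |(multivariateGaussian 0 (empCovFull x)).real
        {z | quadForms (mcParams M x) z ∈ exceed T t} - c| < η / 2 := by
    intro n x h1 h2
    have h3 := hU (Set.mk_mem_prod (hU₁' h1) (hU₂' h2))
    simp only [Set.mem_ofPred_eq] at h3
    exact h3 (posSemidef_empCovFull x)
  have hgood := (hconvS _ (hU₁o.mem_nhds hSU₁)).and (hconvw _ (hU₂o.mem_nhds hwU₂))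
  have hbd : ∀ᶠ N in atTop,
      P {ω | ¬ |empExceed T t (fun b => mcStat M (X N ω) (Z N ω b)) - c| < η}
      ≤ P {ω | ¬ (empCovFull (X N ω) ∈ U₁' ∧ mcParams M (X N ω) ∈ U₂')}
        + ENNReal.ofReal (1 / (B N * (η / 2) ^ 2)) := by
    filter_upwards [hB.eventually_gt_atTop 0] with N hN
    set G : Set (Sample d (n N)) := {x | empCovFull x ∈ U₁' ∧ mcParams M x ∈ U₂'} with hG
    have hmc := measurable_mcParams (d := d) (n := n N) hM
    have hGm : MeasurableSet G := by
      have h1 : Measurable fun (x : Sample d (n N)) p q => empCovFull x p q :=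
        measurable_pi_lambda _ fun p => measurable_pi_lambda _ fun q => measurable_empCovFull p q
      have hU₁m : MeasurableSet (α := Fin d × Fin a → Fin d × Fin a → ℝ) U₁' :=
        IsOpen.measurableSet (α := Fin d × Fin a → Fin d × Fin a → ℝ) hU₁o
      exact (h1 hU₁m).inter (hmc hU₂o.measurableSet)
    exact measure_abs_empExceed_mcStat_sub_ge_le (hX N) hM hN (hZ_meas N) (hZ N) T t hη hGm
      fun x hx => hgood' x hx.1 hx.2
  have hlim : Tendsto (fun N => ENNReal.ofReal (1 / (B N * (η / 2) ^ 2))) atTop (𝓝 0) := by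
    rw [← ENNReal.ofReal_zero]
    refine ENNReal.tendsto_ofReal ?_
    have h1 : Tendsto (fun N => 1 / (B N : ℝ)) atTop (𝓝 0) :=
      (tendsto_const_div_atTop_nhds_zero_nat 1).comp hB
    have h2 := h1.mul_const (1 / (η / 2) ^ 2)
    rw [zero_mul] at h2
    refine h2.congr fun N => ?_
    rw [div_mul_div_comm, one_mul]
  refine tendsto_of_tendsto_of_tendsto_of_le_of_le' tendsto_const_nhds
    (by simpa using Tendsto.add hgood hlim) (Eventually.of_forall fun _ => zero_le) hbd

end

/-! ### Bounds for characteristic functions -/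

/-- Telescoping: the factors are exchanged one at a time, and the others have modulus at most one.
-/
lemma norm_prod_sub_prod_le {ι : Type*} (s : Finset ι) {f g : ι → ℂ} (hf : ∀ i ∈ s, ‖f i‖ ≤ 1)
    (hg : ∀ i ∈ s, ‖g i‖ ≤ 1) : ‖∏ i ∈ s, f i - ∏ i ∈ s, g i‖ ≤ ∑ i ∈ s, ‖f i - g i‖ := by
  classical
  induction s using Finset.induction_on with
  | empty => simp
  | insert i s hi ih =>
    rw [Finset.prod_insert hi, Finset.prod_insert hi, Finset.sum_insert hi]
    have h1 := ih (fun k hk => hf k (Finset.mem_insert_of_mem hk))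
      (fun k hk => hg k (Finset.mem_insert_of_mem hk))
    have h2 : ‖∏ k ∈ s, g k‖ ≤ 1 := by
      rw [norm_prod]
      exact Finset.prod_le_one (fun k _ => norm_nonneg _)
        fun k hk => hg k (Finset.mem_insert_of_mem hk)
    calc ‖f i * ∏ k ∈ s, f k - g i * ∏ k ∈ s, g k‖
        = ‖f i * (∏ k ∈ s, f k - ∏ k ∈ s, g k) + (f i - g i) * ∏ k ∈ s, g k‖ := by ring_nf
      _ ≤ ‖f i‖ * ‖∏ k ∈ s, f k - ∏ k ∈ s, g k‖ + ‖f i - g i‖ * ‖∏ k ∈ s, g k‖ := by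
          refine (norm_add_le _ _).trans ?_
          rw [norm_mul, norm_mul]
      _ ≤ 1 * ∑ k ∈ s, ‖f k - g k‖ + ‖f i - g i‖ * 1 := by
          gcongr
          exact hf i (Finset.mem_insert_self _ _)
      _ = ‖f i - g i‖ + ∑ k ∈ s, ‖f k - g k‖ := by ring

/-- A bound for the second order Taylor remainder of the exponential function on the imaginary
axis. -/
def rem₂ (y : ℝ) : ℝ := 4 * min (y ^ 2) (|y| ^ 3)

/-- A bound for the first order Taylor remainder of the exponential function on the imaginary
axis. -/
def rem₁ (y : ℝ) : ℝ := 3 * min |y| (y ^ 2)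

lemma rem₂_nonneg (y : ℝ) : 0 ≤ rem₂ y := by unfold rem₂; positivity

lemma rem₁_nonneg (y : ℝ) : 0 ≤ rem₁ y := by unfold rem₁; positivity

lemma rem₂_mono {x y : ℝ} (h : |x| ≤ |y|) : rem₂ x ≤ rem₂ y := by
  unfold rem₂
  rw [← sq_abs x, ← sq_abs y]
  gcongr

lemma rem₁_mono {x y : ℝ} (h : |x| ≤ |y|) : rem₁ x ≤ rem₁ y := by
  unfold rem₁
  rw [← sq_abs x, ← sq_abs y]
  gcongr

@[fun_prop]
lemma continuous_rem₂ : Continuous rem₂ := by unfold rem₂; fun_prop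

@[fun_prop]
lemma continuous_rem₁ : Continuous rem₁ := by unfold rem₁; fun_prop

/-- For small `y` the exponential series gives the cubic bound; for `|y| > 1` the triangle
inequality gives `2 + |y| + y ^ 2 / 2 ≤ 4 * y ^ 2`. The minimum is integrable under second moments
alone and still of smaller order than `y ^ 2` at zero. -/
lemma norm_exp_sub_le_rem₂ (y : ℝ) :
    ‖Complex.exp (y * Complex.I) - (1 + y * Complex.I - (y : ℂ) ^ 2 / 2)‖ ≤ rem₂ y := by
  have hn : ‖(y : ℂ) * Complex.I‖ = |y| := by simp
  by_cases hy : |y| ≤ 1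
  · have h := Complex.exp_bound (x := (y : ℂ) * Complex.I) (by rw [hn]; exact hy)
      (n := 3) (by norm_num)
    rw [hn] at h
    have hs : ∑ m ∈ Finset.range 3, ((y : ℂ) * Complex.I) ^ m / (m.factorial : ℂ)
        = 1 + y * Complex.I - (y : ℂ) ^ 2 / 2 := by
      simp [Finset.sum_range_succ, Nat.factorial, mul_pow]
      ring
    rw [hs] at h
    refine h.trans ?_
    have h3 : 0 ≤ |y| ^ 3 := by positivity
    have h4 : |y| ^ 3 ≤ y ^ 2 := by
      rw [← sq_abs y]
      exact pow_le_pow_of_le_one (abs_nonneg y) hy (by norm_num)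
    rw [rem₂, min_eq_right h4]
    norm_num [Nat.factorial]
    linarith
  · rw [not_le] at hy
    have h4 : y ^ 2 ≤ |y| ^ 3 := by
      rw [← sq_abs y]
      exact pow_le_pow_right₀ hy.le (by norm_num)
    rw [rem₂, min_eq_left h4]
    have h5 : ‖Complex.exp (y * Complex.I)‖ = 1 := Complex.norm_exp_ofReal_mul_I y
    have h6 : ‖(y : ℂ) ^ 2 / 2‖ = y ^ 2 / 2 := by simp
    have h7 : |y| ≤ y ^ 2 := by rw [← sq_abs y]; nlinarith
    calc _ ≤ ‖Complex.exp (y * Complex.I)‖ + (‖(1 : ℂ)‖ + ‖(y : ℂ) * Complex.I‖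
          + ‖(y : ℂ) ^ 2 / 2‖) := by
          refine (norm_sub_le _ _).trans ?_
          gcongr
          refine (norm_sub_le _ _).trans ?_
          gcongr
          exact norm_add_le _ _
      _ ≤ 4 * y ^ 2 := by
          rw [h5, h6, hn, norm_one]
          nlinarith

lemma norm_exp_sub_le_rem₁ (y : ℝ) :
    ‖Complex.exp (y * Complex.I) - (1 + y * Complex.I)‖ ≤ rem₁ y := by
  have hn : ‖(y : ℂ) * Complex.I‖ = |y| := by simp
  by_cases hy : |y| ≤ 1
  · have h := Complex.exp_bound (x := (y : ℂ) * Complex.I) (by rw [hn]; exact hy)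
      (n := 2) (by norm_num)
    rw [hn] at h
    have hs : ∑ m ∈ Finset.range 2, ((y : ℂ) * Complex.I) ^ m / (m.factorial : ℂ)
        = 1 + y * Complex.I := by
      simp [Finset.sum_range_succ, Nat.factorial]
    rw [hs] at h
    refine h.trans ?_
    have h3 : 0 ≤ |y| ^ 2 := by positivity
    have h4 : y ^ 2 ≤ |y| := by
      rw [← sq_abs y]
      nlinarith [abs_nonneg y]
    rw [rem₁, min_eq_right h4]
    norm_num [Nat.factorial]
    nlinarith [sq_nonneg y]
  · rw [not_le] at hy
    have h7 : |y| ≤ y ^ 2 := by rw [← sq_abs y]; nlinarith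
    rw [rem₁, min_eq_left h7]
    have h5 : ‖Complex.exp (y * Complex.I)‖ = 1 := Complex.norm_exp_ofReal_mul_I y
    calc _ ≤ ‖Complex.exp (y * Complex.I)‖ + (‖(1 : ℂ)‖ + ‖(y : ℂ) * Complex.I‖) := by
          refine (norm_sub_le _ _).trans ?_
          gcongr
          exact norm_add_le _ _
      _ ≤ 3 * |y| := by
          rw [h5, hn, norm_one]
          linarith

section charFun

variable {Ω : Type*} [MeasurableSpace Ω] {P : Measure Ω}

lemma integrable_rem₂ {Y : Ω → ℝ} (hY : MemLp Y 2 P) (c : ℝ) :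
    Integrable (fun ω => rem₂ (c * Y ω)) P := by
  have hm := hY.aestronglyMeasurable.aemeasurable
  refine Integrable.mono' ((hY.integrable_sq.const_mul (c ^ 2)).const_mul 4)
    (continuous_rem₂.comp_aestronglyMeasurable (hY.aestronglyMeasurable.const_mul c))
    (ae_of_all _ fun ω => ?_)
  rw [Real.norm_eq_abs, abs_of_nonneg (rem₂_nonneg _), rem₂, ← mul_pow]
  gcongr
  exact min_le_left _ _

lemma integrable_rem₁ {Y : Ω → ℝ} (hY : Integrable Y P) (c : ℝ) :
    Integrable (fun ω => rem₁ (c * Y ω)) P := by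
  refine Integrable.mono' (((hY.const_mul c).abs).const_mul 3)
    (continuous_rem₁.comp_aestronglyMeasurable (hY.aestronglyMeasurable.const_mul c))
    (ae_of_all _ fun ω => ?_)
  rw [Real.norm_eq_abs, abs_of_nonneg (rem₁_nonneg _), rem₁]
  gcongr
  exact min_le_left _ _

/-- Factoring out `s N ^ 2` leaves the integral of `min (X ^ 2) (|s N| * |X| ^ 3)`, which vanishes
by dominated convergence with majorant `X ^ 2`. This takes the place of Lindeberg's condition. -/
lemma tendsto_mul_integral_rem₂ {X : Ω → ℝ} (hX : MemLp X 2 P) {s m : ℕ → ℝ} {L : ℝ}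
    (hs : Tendsto s atTop (𝓝 0)) (hm : Tendsto (fun N => m N * s N ^ 2) atTop (𝓝 L)) :
    Tendsto (fun N => m N * ∫ ω, rem₂ (s N * X ω) ∂P) atTop (𝓝 0) := by
  have h1 : Tendsto (fun N => ∫ ω, min (X ω ^ 2) (|s N| * |X ω| ^ 3) ∂P) atTop
      (𝓝 (∫ _, (0 : ℝ) ∂P)) := by
    refine tendsto_integral_of_dominated_convergence (fun ω => X ω ^ 2) (fun N => ?_)
      hX.integrable_sq (fun N => ae_of_all _ fun ω => ?_) (ae_of_all _ fun ω => ?_)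
    · have hc : Continuous fun x : ℝ => min (x ^ 2) (|s N| * |x| ^ 3) := by fun_prop
      exact hc.comp_aestronglyMeasurable hX.aestronglyMeasurable
    · rw [Real.norm_eq_abs, abs_of_nonneg (by positivity)]
      exact min_le_left _ _
    · have h2 : Tendsto (fun N => |s N| * |X ω| ^ 3) atTop (𝓝 0) := by
        simpa using hs.abs.mul_const (|X ω| ^ 3)
      have h3 := (tendsto_const_nhds (x := X ω ^ 2)).min h2
      rwa [min_eq_right (sq_nonneg _)] at h3
  rw [integral_zero] at h1
  have h2 := (hm.mul h1).const_mul 4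
  simp only [mul_zero] at h2
  refine h2.congr fun N => ?_
  have : ∀ ω, rem₂ (s N * X ω) = 4 * s N ^ 2 * min (X ω ^ 2) (|s N| * |X ω| ^ 3) := fun ω => by
    rw [rem₂, mul_assoc 4, mul_min_of_nonneg _ _ (sq_nonneg (s N)), abs_mul, mul_pow, mul_pow,
      ← sq_abs (s N)]
    ring_nf
  simp_rw [this]
  rw [integral_const_mul]
  ring

lemma tendsto_mul_integral_rem₁ {X : Ω → ℝ} (hX : Integrable X P) (t : ℝ) :
    Tendsto (fun n : ℕ => n * ∫ ω, rem₁ (t / n * X ω) ∂P) atTop (𝓝 0) := by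
  have hs : Tendsto (fun n : ℕ => t / (n : ℝ)) atTop (𝓝 0) :=
    tendsto_const_div_atTop_nhds_zero_nat t
  have h1 : Tendsto (fun n : ℕ => ∫ ω, min |X ω| (|t / n| * X ω ^ 2) ∂P) atTop
      (𝓝 (∫ _, (0 : ℝ) ∂P)) := by
    refine tendsto_integral_of_dominated_convergence (fun ω => |X ω|) (fun N => ?_)
      hX.abs (fun N => ae_of_all _ fun ω => ?_) (ae_of_all _ fun ω => ?_)
    · have hc : Continuous fun x : ℝ => min |x| (|t / N| * x ^ 2) := by fun_prop
      exact hc.comp_aestronglyMeasurable hX.aestronglyMeasurable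
    · rw [Real.norm_eq_abs, abs_of_nonneg (by positivity)]
      exact min_le_left _ _
    · have h2 : Tendsto (fun n : ℕ => |t / n| * X ω ^ 2) atTop (𝓝 0) := by
        simpa using hs.abs.mul_const (X ω ^ 2)
      have h3 := (tendsto_const_nhds (x := |X ω|)).min h2
      rwa [min_eq_right (abs_nonneg _)] at h3
  rw [integral_zero] at h1
  have h2 := h1.const_mul (3 * |t|)
  rw [mul_zero] at h2
  refine h2.congr' ?_
  filter_upwards [eventually_gt_atTop 0] with n hn
  have : ∀ ω, rem₁ (t / n * X ω) = 3 * |t / n| * min |X ω| (|t / n| * X ω ^ 2) := fun ω => by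
    rw [rem₁, mul_assoc 3, mul_min_of_nonneg _ _ (abs_nonneg (t / n)), abs_mul, mul_pow,
      ← sq_abs (t / n)]
    ring_nf
  simp_rw [this]
  rw [integral_const_mul, abs_div, Nat.abs_cast]
  have : (n : ℝ) ≠ 0 := by positivity
  field_simp

lemma charFun_map_eq_integral {Y : Ω → ℝ} (hY : AEMeasurable Y P) (c : ℝ) :
    charFun (P.map Y) c = ∫ ω, Complex.exp ((c * Y ω : ℝ) * Complex.I) ∂P := by
  rw [charFun_apply_real, integral_map hY (by fun_prop)]
  simp

variable [IsProbabilityMeasure P]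

lemma integrable_exp_mul_I {Y : Ω → ℝ} (hY : AEMeasurable Y P) :
    Integrable (fun ω => Complex.exp ((Y ω : ℝ) * Complex.I)) P := by
  refine Integrable.of_bound (C := 1) ?_ (ae_of_all _ fun ω => ?_)
  · have : AEMeasurable (fun ω => Complex.exp ((Y ω : ℝ) * Complex.I)) P := by fun_prop
    exact this.aestronglyMeasurable
  · rw [Complex.norm_exp_ofReal_mul_I]

lemma abs_exp_neg_sub_le {x : ℝ} (hx : 0 ≤ x) : |Real.exp (-x) - (1 - x)| ≤ x ^ 2 := by
  have h1 := Real.add_one_le_exp (-x)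
  have h2 : Real.exp (-x) ≤ 1 / (1 + x) := by
    rw [Real.exp_neg, ← one_div]
    exact one_div_le_one_div_of_le (by linarith) (by linarith [Real.add_one_le_exp x])
  have h3 : 1 / (1 + x) ≤ 1 - x + x ^ 2 := by
    rw [div_le_iff₀ (by linarith)]
    nlinarith [pow_nonneg hx 3]
  rw [abs_le]
  constructor <;> linarith

/-- Comparison with `exp (-x)` rather than `1 - x`, where `x = c ^ 2 * v / 2`, makes the product
over subjects an exact Gaussian characteristic function; the price is the term `x ^ 2`. -/
lemma norm_charFun_sub_exp_le {Y : Ω → ℝ} (hY : MemLp Y 2 P) (h0 : ∫ ω, Y ω ∂P = 0) {v : ℝ}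
    (hv : ∫ ω, Y ω ^ 2 ∂P = v) (c : ℝ) :
    ‖charFun (P.map Y) c - Complex.exp (-(c ^ 2 * v / 2 : ℝ))‖
      ≤ ∫ ω, rem₂ (c * Y ω) ∂P + (c ^ 2 * v / 2) ^ 2 := by
  have hm := hY.aestronglyMeasurable.aemeasurable
  have hi := hY.integrable one_le_two
  have hv0 : 0 ≤ v := hv ▸ integral_nonneg fun ω => sq_nonneg _
  have hpoly : ∫ ω, (1 + ((c * Y ω : ℝ) : ℂ) * Complex.I - ((c * Y ω : ℝ) : ℂ) ^ 2 / 2) ∂P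
      = ((1 - c ^ 2 * v / 2 : ℝ) : ℂ) := by
    have e1 : Integrable (fun ω => ((c * Y ω : ℝ) : ℂ) * Complex.I) P :=
      (hi.const_mul c).ofReal.mul_const _
    have e2 : Integrable (fun ω => ((c ^ 2 / 2 * Y ω ^ 2 : ℝ) : ℂ)) P :=
      (hY.integrable_sq.const_mul _).ofReal
    have e3 : ∀ ω, 1 + ((c * Y ω : ℝ) : ℂ) * Complex.I - ((c * Y ω : ℝ) : ℂ) ^ 2 / 2
        = (1 + ((c * Y ω : ℝ) : ℂ) * Complex.I) - ((c ^ 2 / 2 * Y ω ^ 2 : ℝ) : ℂ) := fun ω => by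
      push_cast; ring
    simp_rw [e3]
    have e4 : Integrable (fun ω => 1 + ((c * Y ω : ℝ) : ℂ) * Complex.I) P :=
      (integrable_const 1).add e1
    rw [integral_sub e4 e2, integral_add (integrable_const 1) e1, integral_mul_const,
      integral_complex_ofReal, integral_complex_ofReal, integral_const_mul, integral_const_mul,
      h0, hv]
    simp
    ring
  have hint : Integrable (fun ω =>
      1 + ((c * Y ω : ℝ) : ℂ) * Complex.I - ((c * Y ω : ℝ) : ℂ) ^ 2 / 2) P := by
    refine Integrable.sub ((integrable_const 1).add ((hi.const_mul c).ofReal.mul_const _)) ?_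
    have : Integrable (fun ω => (((c * Y ω) ^ 2 / 2 : ℝ) : ℂ)) P := by
      refine Integrable.ofReal ?_
      simp_rw [mul_pow]
      exact (hY.integrable_sq.const_mul _).div_const _
    simpa using this
  have h1 : ‖charFun (P.map Y) c - ((1 - c ^ 2 * v / 2 : ℝ) : ℂ)‖ ≤ ∫ ω, rem₂ (c * Y ω) ∂P := by
    rw [charFun_map_eq_integral hm, ← hpoly,
      ← integral_sub (integrable_exp_mul_I (hm.const_mul c)) hint]
    exact norm_integral_le_of_norm_le (integrable_rem₂ hY c)
      (ae_of_all _ fun ω => norm_exp_sub_le_rem₂ _)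
  have h2 : ‖((1 - c ^ 2 * v / 2 : ℝ) : ℂ) - Complex.exp (-(c ^ 2 * v / 2 : ℝ))‖
      ≤ (c ^ 2 * v / 2) ^ 2 := by
    rw [← Complex.ofReal_neg, ← Complex.ofReal_exp, ← Complex.ofReal_sub, Complex.norm_real,
      Real.norm_eq_abs, abs_sub_comm]
    exact abs_exp_neg_sub_le (by positivity)
  have := norm_sub_le_norm_sub_add_norm_sub (charFun (P.map Y) c)
    ((1 - c ^ 2 * v / 2 : ℝ) : ℂ) (Complex.exp (-(c ^ 2 * v / 2 : ℝ)))
  linarith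

lemma norm_charFun_sub_exp_mean_le {Y : Ω → ℝ} (hY : Integrable Y P) {m : ℝ}
    (hm : ∫ ω, Y ω ∂P = m) (c : ℝ) :
    ‖charFun (P.map Y) c - Complex.exp ((c * m : ℝ) * Complex.I)‖
      ≤ ∫ ω, rem₁ (c * Y ω) ∂P + rem₁ (c * m) := by
  have hYm := hY.aestronglyMeasurable.aemeasurable
  have e1 : Integrable (fun ω => ((c * Y ω : ℝ) : ℂ) * Complex.I) P :=
    (hY.const_mul c).ofReal.mul_const _
  have e2 : Integrable (fun ω => 1 + ((c * Y ω : ℝ) : ℂ) * Complex.I) P :=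
    (integrable_const 1).add e1
  have hpoly : ∫ ω, (1 + ((c * Y ω : ℝ) : ℂ) * Complex.I) ∂P
      = 1 + ((c * m : ℝ) : ℂ) * Complex.I := by
    rw [integral_add (integrable_const 1) e1, integral_mul_const, integral_complex_ofReal,
      integral_const_mul, hm]
    simp
  have h1 : ‖charFun (P.map Y) c - (1 + ((c * m : ℝ) : ℂ) * Complex.I)‖
      ≤ ∫ ω, rem₁ (c * Y ω) ∂P := by
    rw [charFun_map_eq_integral hYm, ← hpoly,
      ← integral_sub (integrable_exp_mul_I (hYm.const_mul c)) e2]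
    exact norm_integral_le_of_norm_le (integrable_rem₁ hY c)
      (ae_of_all _ fun ω => norm_exp_sub_le_rem₁ _)
  have h2 := norm_exp_sub_le_rem₁ (c * m)
  rw [norm_sub_rev] at h2
  have := norm_sub_le_norm_sub_add_norm_sub (charFun (P.map Y) c)
    (1 + ((c * m : ℝ) : ℂ) * Complex.I) (Complex.exp ((c * m : ℝ) * Complex.I))
  linarith

end charFun

/-! ### Sums of independent variables: Gaussian approximation and a weak law. -/

section independentSums

variable {Ω : Type*} [MeasurableSpace Ω] {P : Measure Ω} [IsProbabilityMeasure P]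

/-- The scaling is absorbed into the summands, whose variances may differ, so evaluation at `1` is
enough. -/
lemma norm_charFun_sum_sub_exp_le {ι : Type*} {Y : ι → Ω → ℝ} (hind : iIndepFun Y P)
    (hY : ∀ p, MemLp (Y p) 2 P) (h0 : ∀ p, ∫ ω, Y p ω ∂P = 0) {v : ι → ℝ}
    (hv : ∀ p, ∫ ω, Y p ω ^ 2 ∂P = v p) (F : Finset ι) :
    ‖charFun (P.map (fun ω => ∑ p ∈ F, Y p ω)) 1 - Complex.exp (-((∑ p ∈ F, v p) / 2 : ℝ))‖
      ≤ ∑ p ∈ F, (∫ ω, rem₂ (Y p ω) ∂P + (v p / 2) ^ 2) := by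
  have hv0 : ∀ p, 0 ≤ v p := fun p => hv p ▸ integral_nonneg fun ω => sq_nonneg _
  have hm := fun p => (hY p).aestronglyMeasurable.aemeasurable
  have hexp : Complex.exp (-((∑ p ∈ F, v p) / 2 : ℝ))
      = ∏ p ∈ F, Complex.exp (-((1 : ℝ) ^ 2 * v p / 2 : ℝ)) := by
    rw [← Complex.exp_sum]
    congr 1
    push_cast
    rw [Finset.sum_neg_distrib, Finset.sum_div]
    simp
  have hprob := fun p => Measure.isProbabilityMeasure_map (hm p)
  rw [(hind.restrict F).charFun_map_fun_finsetSum_eq_prod fun p _ => hm p, Finset.prod_apply, hexp]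
  refine (norm_prod_sub_prod_le F (fun p _ => norm_charFun_le_one _) fun p _ => ?_).trans
    (Finset.sum_le_sum fun p _ => ?_)
  · rw [← Complex.ofReal_neg, Complex.norm_exp_ofReal, Real.exp_le_one_iff, neg_nonpos]
    have := hv0 p
    positivity
  · simpa using norm_charFun_sub_exp_le (hY p) (h0 p) (hv p) 1

lemma norm_charFun_sum_sub_exp_mean_le {ι : Type*} {Y : ι → Ω → ℝ} (hind : iIndepFun Y P)
    (hY : ∀ p, Integrable (Y p) P) {m : ℝ} (hm : ∀ p, ∫ ω, Y p ω ∂P = m) (F : Finset ι) (c : ℝ) :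
    ‖charFun (P.map (fun ω => ∑ p ∈ F, Y p ω)) c - Complex.exp ((F.card * (c * m) : ℝ) * Complex.I)‖
      ≤ ∑ p ∈ F, (∫ ω, rem₁ (c * Y p ω) ∂P + rem₁ (c * m)) := by
  have hYm := fun p => (hY p).aestronglyMeasurable.aemeasurable
  have hexp : Complex.exp ((F.card * (c * m) : ℝ) * Complex.I)
      = ∏ p ∈ F, Complex.exp ((c * m : ℝ) * Complex.I) := by
    rw [Finset.prod_const, ← Complex.exp_nat_mul]
    push_cast
    ring_nf
  have hprob := fun p => Measure.isProbabilityMeasure_map (hYm p)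
  rw [(hind.restrict F).charFun_map_fun_finsetSum_eq_prod fun p _ => hYm p, Finset.prod_apply, hexp]
  refine (norm_prod_sub_prod_le F (fun p _ => norm_charFun_le_one _) fun p _ => ?_).trans
    (Finset.sum_le_sum fun p _ => norm_charFun_sub_exp_mean_le (hY p) (hm p) c)
  rw [Complex.norm_exp_ofReal_mul_I]

/-- Convergence of characteristic functions to that of a constant implies convergence in
probability. -/
lemma convInProb_of_tendsto_charFun {V : ℕ → Ω → ℝ} (hV : ∀ N, AEMeasurable (V N) P) {m : ℝ}
    (h : ∀ t : ℝ, Tendsto (fun N => charFun (P.map (V N)) t) atTop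
      (𝓝 (Complex.exp ((t * m : ℝ) * Complex.I)))) : ConvInProb P V m := by
  have hweak : Tendsto (β := ProbabilityMeasure ℝ)
      (fun N => ⟨P.map (V N), Measure.isProbabilityMeasure_map (hV N)⟩) atTop
      (𝓝 (diracProba m)) := by
    refine ProbabilityMeasure.tendsto_iff_tendsto_charFun.2 fun t => ?_
    have : charFun (diracProba m : Measure ℝ) t = Complex.exp ((t * m : ℝ) * Complex.I) := by
      change charFun (Measure.dirac m) t = _
      rw [charFun_dirac]
      simp
    rw [this]
    exact h t
  refine convInProb_iff_tendstoInMeasure.2 (tendstoInMeasure_iff_dist.2 fun ε hε => ?_)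
  -- The frontier of this closed set stays inside it and hence misses `m`, so the set is a
  -- continuity set of the Dirac limit.
  have hcl : IsClosed {x : ℝ | ε ≤ dist x m} := isClosed_le continuous_const (by fun_prop)
  have hnull : (diracProba m : Measure ℝ) (frontier {x : ℝ | ε ≤ dist x m}) = 0 := by
    change Measure.dirac m _ = 0
    rw [Measure.dirac_apply' _ isClosed_frontier.measurableSet]
    refine Set.indicator_of_notMem (fun hmem => ?_) _
    have h1 : ε ≤ dist m m := hcl.frontier_subset hmem
    rw [dist_self] at h1
    linarith
  have := ProbabilityMeasure.tendsto_measure_of_null_frontier_of_tendsto' hweak hnull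
  have h0 : (diracProba m : Measure ℝ) {x : ℝ | ε ≤ dist x m} = 0 := by
    change Measure.dirac m _ = 0
    rw [Measure.dirac_apply' _ hcl.measurableSet]
    refine Set.indicator_of_notMem (fun hmem => ?_) _
    have h1 : ε ≤ dist m m := hmem
    rw [dist_self] at h1
    linarith
  rw [h0] at this
  refine this.congr fun N => ?_
  change P.map (V N) _ = _
  rw [Measure.map_apply_of_aemeasurable (hV N) hcl.measurableSet]
  rfl

/-- A weak law of large numbers for independent random variables with the same mean, under a
uniform integrability condition. -/
lemma convInProb_average {X : ℕ → Ω → ℝ} (hind : iIndepFun X P) (hX : ∀ k, Integrable (X k) P)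
    {m : ℝ} (hm : ∀ k, ∫ ω, X k ω ∂P = m) {D₁ D₂ : Ω → ℝ} (hD₁ : Integrable D₁ P)
    (hD₂ : Integrable D₂ P) (hdom : ∀ k c, ∫ ω, rem₁ (c * X k ω) ∂P
      ≤ ∫ ω, rem₁ (c * D₁ ω) ∂P + ∫ ω, rem₁ (c * D₂ ω) ∂P) :
    ConvInProb P (fun n ω => (n : ℝ)⁻¹ * ∑ k ∈ Finset.range n, X k ω) m := by
  have hXm : ∀ k, AEMeasurable (X k) P := fun k => (hX k).aestronglyMeasurable.aemeasurable
  refine convInProb_of_tendsto_charFun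
    (fun n => (Finset.aemeasurable_fun_sum _ fun k _ => hXm k).const_mul _) fun t => ?_
  have hlim : Tendsto (fun n : ℕ => (n * ∫ ω, rem₁ (t / n * D₁ ω) ∂P
      + n * ∫ ω, rem₁ (t / n * D₂ ω) ∂P) + n * ∫ _, rem₁ (t / n * m) ∂P) atTop (𝓝 0) := by
    have h3 := ((tendsto_mul_integral_rem₁ hD₁ t).add (tendsto_mul_integral_rem₁ hD₂ t)).add
      (tendsto_mul_integral_rem₁ (P := P) (integrable_const m) t)
    rw [add_zero, add_zero] at h3
    exact h3
  rw [tendsto_iff_norm_sub_tendsto_zero]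
  refine squeeze_zero' (Eventually.of_forall fun n => norm_nonneg _) ?_ hlim
  filter_upwards [eventually_gt_atTop 0] with n hn
  have hn' : (n : ℝ) ≠ 0 := by positivity
  have h1 : (n : ℝ)⁻¹ * t = t / n := by ring
  have h2 := norm_charFun_sum_sub_exp_mean_le hind hX hm (Finset.range n) (t / n)
  rw [Finset.card_range, show (n : ℝ) * (t / n * m) = t * m by field_simp] at h2
  rw [charFun_map_mul_comp (Finset.aemeasurable_fun_sum _ fun k _ => hXm k), h1]
  refine h2.trans ((Finset.sum_le_sum fun k _ => add_le_add_left (hdom k (t / n)) _).trans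
    (le_of_eq ?_))
  simp

end independentSums

/-! ### The error vectors -/

/-- Independent centred square integrable error vectors, with covariance matrix `Sig i` in group
`i`, whose components are identically distributed within the groups. -/
structure IsErrorModel {Ω : Type*} [MeasurableSpace Ω] {a d : ℕ} (P : Measure Ω)
    (ε : Fin a → ℕ → Ω → Fin d → ℝ) (Sig : Fin a → Matrix (Fin d) (Fin d) ℝ) : Prop where
  meas : ∀ i k, Measurable (ε i k)
  indep : iIndepFun (fun p : Fin a × ℕ => ε p.1 p.2) P
  ident : ∀ i j k k', IdentDistrib (fun ω => ε i k ω j) (fun ω => ε i k' ω j) P P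
  memLp : ∀ i k j, MemLp (fun ω => ε i k ω j) 2 P
  mean : ∀ i k j, ∫ ω, ε i k ω j ∂P = 0
  cov : ∀ i k j j', cov[fun ω => ε i k ω j, fun ω => ε i k ω j'; P] = Sig i j j'

lemma tendsto_div_groupSize {n : ℕ → ℕ} {κ : ℝ} (hκ : 0 < κ)
    (h : Tendsto (fun N => (n N : ℝ) / N) atTop (𝓝 κ)) :
    Tendsto (fun N : ℕ => (N : ℝ) / n N) atTop (𝓝 κ⁻¹) :=
  (h.inv₀ hκ.ne').congr fun _ => inv_div _ _

lemma tendsto_groupSize_atTop {n : ℕ → ℕ} {κ : ℝ} (hκ : 0 < κ)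
    (h : Tendsto (fun N => (n N : ℝ) / N) atTop (𝓝 κ)) : Tendsto n atTop atTop := by
  rw [← tendsto_natCast_atTop_iff (R := ℝ)]
  refine (h.pos_mul_atTop hκ tendsto_natCast_atTop_atTop).congr' ?_
  filter_upwards [eventually_gt_atTop 0] with N hN
  have : (N : ℝ) ≠ 0 := by positivity
  field_simp

lemma mul_sqrt_div_sq (n N : ℕ) : (n : ℝ) * (√(N : ℝ) / n) ^ 2 = N / n := by
  rcases Nat.eq_zero_or_pos n with rfl | hn
  · simp
  · rw [div_pow, Real.sq_sqrt (Nat.cast_nonneg N)]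
    field_simp

lemma tendsto_sqrt_div_groupSize {n : ℕ → ℕ} {κ : ℝ} (hκ : 0 < κ)
    (h : Tendsto (fun N => (n N : ℝ) / N) atTop (𝓝 κ)) :
    Tendsto (fun N : ℕ => √(N : ℝ) / n N) atTop (𝓝 0) := by
  have h1 := (tendsto_div_groupSize hκ h).mul ((tendsto_inv_atTop_nhds_zero_nat (𝕜 := ℝ)).comp
    (tendsto_groupSize_atTop hκ h))
  rw [mul_zero] at h1
  have h2 := (Real.continuous_sqrt.tendsto 0).comp h1
  rw [Real.sqrt_zero] at h2
  refine h2.congr fun N => ?_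
  rw [Function.comp_apply, Function.comp_apply, div_mul_eq_mul_div, ← div_eq_mul_inv, div_div,
    Real.sqrt_div (Nat.cast_nonneg N), Real.sqrt_mul_self (Nat.cast_nonneg _)]

/-- A linear combination is at most `∑ |t l|` times the largest `|x j|`, and the term of that index
is one of the nonnegative summands. The right side involves single components only, whose laws do
not depend on the subject. -/
lemma rem₂_sum_le (c : ℝ) (t x : Fin d → ℝ) :
    rem₂ (c * ∑ j, t j * x j) ≤ ∑ j, rem₂ (c * (∑ l, |t l|) * x j) := by
  rcases isEmpty_or_nonempty (Fin d) with hd | hd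
  · simp [rem₂]
  · obtain ⟨m, -, hm⟩ := Finset.exists_max_image Finset.univ (fun j => |x j|)
      Finset.univ_nonempty
    refine le_trans (rem₂_mono ?_) (Finset.single_le_sum
      (f := fun j => rem₂ (c * (∑ l, |t l|) * x j))
      (fun j _ => rem₂_nonneg _) (Finset.mem_univ m))
    rw [mul_assoc, abs_mul, abs_mul c, abs_mul (∑ l, |t l|),
      abs_of_nonneg (Finset.sum_nonneg fun l _ => abs_nonneg (t l)), Finset.sum_mul]
    gcongr
    refine (Finset.abs_sum_le_sum_abs _ _).trans (Finset.sum_le_sum fun j hj => ?_)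
    rw [abs_mul]
    exact mul_le_mul_of_nonneg_left (hm j hj) (abs_nonneg _)

/-- The product is at most the larger square in absolute value; squares of components, unlike mixed
products, have laws that do not depend on the subject. -/
lemma rem₁_mul_le (c x y : ℝ) : rem₁ (c * (x * y)) ≤ rem₁ (c * x ^ 2) + rem₁ (c * y ^ 2) := by
  rcases le_total |x| |y| with h | h
  · refine le_add_of_nonneg_of_le (rem₁_nonneg _) (rem₁_mono ?_)
    rw [abs_mul, abs_mul, abs_mul, abs_pow, sq]
    gcongr
  · refine le_add_of_le_of_nonneg (rem₁_mono ?_) (rem₁_nonneg _)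
    rw [abs_mul, abs_mul, abs_mul, abs_pow, sq]
    gcongr

/-- The limit covariance matrix of the vector of the scaled means. -/
def limCovFull {a d : ℕ} (κ : Fin a → ℝ) (Sig : Fin a → Matrix (Fin d) (Fin d) ℝ) :
    Matrix (Fin d × Fin a) (Fin d × Fin a) ℝ :=
  Matrix.blockDiagonal fun i => (κ i)⁻¹ • Sig i

lemma limCovFull_apply {a d : ℕ} (κ : Fin a → ℝ) (Sig : Fin a → Matrix (Fin d) (Fin d) ℝ)
    (j j' : Fin d) (i i' : Fin a) : limCovFull κ Sig (j, i) (j', i')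
      = if i = i' then (κ i)⁻¹ * Sig i j j' else 0 := by
  simp [limCovFull, Matrix.blockDiagonal_apply]

lemma limCovComp_apply {a d : ℕ} (κ : Fin a → ℝ) (Sig : Fin a → Matrix (Fin d) (Fin d) ℝ)
    (j : Fin d) (i i' : Fin a) : limCovComp κ Sig j i i' = limCovFull κ Sig (j, i) (j, i') := by
  rw [limCovFull_apply]
  simp [limCovComp, Matrix.diagonal_apply]

lemma dotProduct_limCovFull_mulVec {a d : ℕ} (κ : Fin a → ℝ)
    (Sig : Fin a → Matrix (Fin d) (Fin d) ℝ) (t : Fin d × Fin a → ℝ) :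
    t ⬝ᵥ limCovFull κ Sig *ᵥ t
      = ∑ i, (κ i)⁻¹ * ((fun j => t (j, i)) ⬝ᵥ Sig i *ᵥ (fun j => t (j, i))) := by
  simp only [dotProduct, Matrix.mulVec, limCovFull, Matrix.blockDiagonal_apply,
    Fintype.sum_prod_type, Matrix.smul_apply, smul_eq_mul]
  rw [Finset.sum_comm]
  simp [Finset.mul_sum, mul_left_comm, mul_assoc]

/-- The vector of the means of the errors, multiplied by the root of the total sample size. -/
def scaledErrorMean {Ω : Type*} {a d : ℕ} (ε : Fin a → ℕ → Ω → Fin d → ℝ) (n : Fin a → ℕ)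
    (ω : Ω) : EuclideanSpace ℝ (Fin d × Fin a) :=
  WithLp.toLp 2 fun q =>
    √(totalSize n : ℝ) * ((n q.2 : ℝ)⁻¹ * ∑ k ∈ Finset.range (n q.2), ε q.2 k ω q.1)

namespace IsErrorModel

variable {Ω : Type*} [MeasurableSpace Ω] {a d : ℕ} {P : Measure Ω}
  {ε : Fin a → ℕ → Ω → Fin d → ℝ} {Sig : Fin a → Matrix (Fin d) (Fin d) ℝ}

lemma integrable_mul (h : IsErrorModel P ε Sig) (i : Fin a) (k : ℕ) (j j' : Fin d) :
    Integrable (fun ω => ε i k ω j * ε i k ω j') P :=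
  (h.memLp i k j).integrable_mul (h.memLp i k j')

lemma memLp_linear (h : IsErrorModel P ε Sig) (i : Fin a) (k : ℕ) (t : Fin d → ℝ) :
    MemLp (fun ω => ∑ j, t j * ε i k ω j) 2 P :=
  memLp_finsetSum _ fun j _ => (h.memLp i k j).const_mul (t j)

lemma integral_rem₂_linear_le (h : IsErrorModel P ε Sig) (i : Fin a) (k : ℕ) (t : Fin d → ℝ)
    (c : ℝ) : ∫ ω, rem₂ (c * ∑ j, t j * ε i k ω j) ∂P
      ≤ ∑ j, ∫ ω, rem₂ (c * (∑ l, |t l|) * ε i 0 ω j) ∂P := by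
  calc ∫ ω, rem₂ (c * ∑ j, t j * ε i k ω j) ∂P
      ≤ ∫ ω, ∑ j, rem₂ (c * (∑ l, |t l|) * ε i k ω j) ∂P :=
        integral_mono (integrable_rem₂ (h.memLp_linear i k t) c)
          (integrable_finsetSum _ fun j _ => integrable_rem₂ (h.memLp i k j) _)
          fun ω => rem₂_sum_le c t (ε i k ω)
    _ = ∑ j, ∫ ω, rem₂ (c * (∑ l, |t l|) * ε i k ω j) ∂P :=
        integral_finsetSum _ fun j _ => integrable_rem₂ (h.memLp i k j) _
    _ = _ := Finset.sum_congr rfl fun j _ =>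
        ((h.ident i j k 0).comp (u := fun x => rem₂ (c * (∑ l, |t l|) * x))
          (by fun_prop)).integral_eq

variable [IsProbabilityMeasure P]

lemma integral_mul (h : IsErrorModel P ε Sig) (i : Fin a) (k : ℕ) (j j' : Fin d) :
    ∫ ω, ε i k ω j * ε i k ω j' ∂P = Sig i j j' := by
  rw [← h.cov i k j j', covariance_eq_sub (h.memLp i k j) (h.memLp i k j'), h.mean, zero_mul,
    sub_zero]
  rfl

lemma integral_linear (h : IsErrorModel P ε Sig) (i : Fin a) (k : ℕ) (t : Fin d → ℝ) :
    ∫ ω, ∑ j, t j * ε i k ω j ∂P = 0 := by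
  rw [integral_finsetSum _ fun j _ => ((h.memLp i k j).integrable one_le_two).const_mul (t j)]
  simp [integral_const_mul, h.mean]

lemma integral_linear_sq (h : IsErrorModel P ε Sig) (i : Fin a) (k : ℕ) (t : Fin d → ℝ) :
    ∫ ω, (∑ j, t j * ε i k ω j) ^ 2 ∂P = t ⬝ᵥ Sig i *ᵥ t := by
  have h1 : ∀ ω, (∑ j, t j * ε i k ω j) ^ 2
      = ∑ j, ∑ j', (t j * t j') * (ε i k ω j * ε i k ω j') := fun ω => by
    rw [sq, Finset.sum_mul_sum]
    exact Finset.sum_congr rfl fun j _ => Finset.sum_congr rfl fun j' _ => by ring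
  simp_rw [h1]
  rw [integral_finsetSum _ fun j _ => integrable_finsetSum _ fun j' _ =>
    (h.integrable_mul i k j j').const_mul _]
  simp only [dotProduct, Matrix.mulVec, Finset.mul_sum]
  refine Finset.sum_congr rfl fun j _ => ?_
  rw [integral_finsetSum _ fun j' _ => (h.integrable_mul i k j j').const_mul _]
  refine Finset.sum_congr rfl fun j' _ => ?_
  rw [integral_const_mul, h.integral_mul]
  ring

lemma posSemidef (h : IsErrorModel P ε Sig) (i : Fin a) : (Sig i).PosSemidef := by
  refine Matrix.PosSemidef.of_dotProduct_mulVec_nonneg ?_ fun t => ?_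
  · ext j j'
    rw [Matrix.conjTranspose_apply, star_trivial, ← h.integral_mul i 0, ← h.integral_mul i 0]
    simp_rw [mul_comm]
  · rw [star_trivial, ← h.integral_linear_sq i 0 t]
    exact integral_nonneg fun ω => sq_nonneg _

lemma posSemidef_limCovFull (h : IsErrorModel P ε Sig) {κ : Fin a → ℝ} (hκ : ∀ i, 0 < κ i) :
    (limCovFull κ Sig).PosSemidef :=
  posSemidef_blockDiagonal fun i => (h.posSemidef i).smul (inv_nonneg.2 (hκ i).le)

end IsErrorModel

/-! ### The central limit theorem -/

/-- The subjects in the sample. -/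
def subjects {a : ℕ} (n : Fin a → ℕ) : Finset (Fin a × ℕ) :=
  (Finset.univ ×ˢ Finset.range (∑ i, n i)).filter fun p => p.2 < n p.1

lemma sum_subjects {a : ℕ} (n : Fin a → ℕ) {β : Type*} [AddCommMonoid β] (f : Fin a × ℕ → β) :
    ∑ p ∈ subjects n, f p = ∑ i, ∑ k ∈ Finset.range (n i), f (i, k) := by
  refine Finset.sum_finset_product _ _ (fun i => Finset.range (n i)) fun p => ?_
  have : n p.1 ≤ ∑ i, n i := Finset.single_le_sum (fun _ _ => Nat.zero_le _) (Finset.mem_univ p.1)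
  simp only [subjects, Finset.mem_filter, Finset.mem_product, Finset.mem_univ, Finset.mem_range,
    true_and]
  omega

namespace IsErrorModel

variable {Ω : Type*} [MeasurableSpace Ω] {a d : ℕ} {P : Measure Ω}
  {ε : Fin a → ℕ → Ω → Fin d → ℝ} {Sig : Fin a → Matrix (Fin d) (Fin d) ℝ}

lemma measurable_scaledErrorMean (h : IsErrorModel P ε Sig) (n : Fin a → ℕ) :
    Measurable (scaledErrorMean ε n) := by
  refine (WithLp.measurable_toLp 2 _).comp (measurable_pi_lambda _ fun q => ?_)
  refine ((Finset.measurable_fun_sum _ fun k _ => ?_).const_mul _).const_mul _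
  exact (measurable_pi_apply q.1).comp (h.meas q.2 k)

/-- A linear functional of the scaled means is a sum of independent real variables, one for each
subject, which reduces the vector statement to the bound for real sums. -/
lemma charFun_scaledErrorMean (h : IsErrorModel P ε Sig) (n : Fin a → ℕ)
    (t : EuclideanSpace ℝ (Fin d × Fin a)) :
    charFun (P.map (scaledErrorMean ε n)) t
      = charFun (P.map fun ω => ∑ p ∈ subjects n,
          √(totalSize n : ℝ) / n p.1 * ∑ j, t (j, p.1) * ε p.1 p.2 ω j) 1 := by
  have hm : ∀ p : Fin a × ℕ, Measurable fun ω =>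
      √(totalSize n : ℝ) / n p.1 * ∑ j, t (j, p.1) * ε p.1 p.2 ω j := fun p => by
    refine (Finset.measurable_fun_sum _ fun j _ => Measurable.const_mul ?_ _).const_mul _
    exact (measurable_pi_apply j).comp (h.meas p.1 p.2)
  rw [charFun_map_eq_integral (Finset.measurable_fun_sum _ fun p _ => hm p).aemeasurable,
    charFun_apply, integral_map (h.measurable_scaledErrorMean n).aemeasurable
      (by fun_prop)]
  refine integral_congr_ae (ae_of_all _ fun ω => ?_)
  have : inner ℝ (scaledErrorMean ε n ω) t
      = ∑ p ∈ subjects n, √(totalSize n : ℝ) / n p.1 * ∑ j, t (j, p.1) * ε p.1 p.2 ω j := by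
    rw [sum_subjects, PiLp.inner_apply, Fintype.sum_prod_type, Finset.sum_comm]
    refine Finset.sum_congr rfl fun i _ => ?_
    simp only [scaledErrorMean, RCLike.inner_apply, conj_trivial]
    simp_rw [Finset.mul_sum]
    rw [Finset.sum_comm]
    refine Finset.sum_congr rfl fun k _ => Finset.sum_congr rfl fun j _ => ?_
    ring
  simp only [this, one_mul]

variable [IsProbabilityMeasure P]

lemma norm_charFun_scaledErrorMean_sub_le (h : IsErrorModel P ε Sig) (n : Fin a → ℕ)
    (t : EuclideanSpace ℝ (Fin d × Fin a)) (τ : Fin a → ℝ)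
    (hτ : ∀ i, τ i = (fun j => t (j, i)) ⬝ᵥ Sig i *ᵥ (fun j => t (j, i))) :
    ‖charFun (P.map (scaledErrorMean ε n)) t
      - Complex.exp (-((∑ i, n i * (√(totalSize n : ℝ) / n i) ^ 2 * τ i) / 2 : ℝ))‖
      ≤ ∑ i, (∑ j, n i * ∫ ω, rem₂ (√(totalSize n : ℝ) / n i * (∑ l, |t (l, i)|) * ε i 0 ω j) ∂P
        + n i * ((√(totalSize n : ℝ) / n i) ^ 2 * τ i / 2) ^ 2) := by
  have hind : iIndepFun (fun p : Fin a × ℕ => fun ω =>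
      √(totalSize n : ℝ) / n p.1 * ∑ j, t (j, p.1) * ε p.1 p.2 ω j) P :=
    h.indep.comp (fun p x => √(totalSize n : ℝ) / n p.1 * ∑ j, t (j, p.1) * x j)
      fun p => by fun_prop
  have key := norm_charFun_sum_sub_exp_le hind
    (fun p => (h.memLp_linear p.1 p.2 fun j => t (j, p.1)).const_mul _)
    (fun p => by rw [integral_const_mul, h.integral_linear p.1 p.2 fun j => t (j, p.1), mul_zero])
    (v := fun p => (√(totalSize n : ℝ) / n p.1) ^ 2 * τ p.1)
    (fun p => by
      simp_rw [mul_pow]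
      rw [integral_const_mul, h.integral_linear_sq p.1 p.2 fun j => t (j, p.1), hτ])
    (subjects n)
  rw [sum_subjects, sum_subjects, ← h.charFun_scaledErrorMean n t] at key
  simp only [Finset.sum_const, Finset.card_range, nsmul_eq_mul, ← mul_assoc] at key
  refine key.trans (Finset.sum_le_sum fun i _ => ?_)
  refine (Finset.sum_le_sum fun k _ => add_le_add_left
    (h.integral_rem₂_linear_le i k (fun j => t (j, i)) _) _).trans (le_of_eq ?_)
  rw [Finset.sum_const, Finset.card_range, nsmul_eq_mul, mul_add, Finset.mul_sum]

/-- The central limit theorem for the vector of the scaled means. -/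
theorem tendstoInDistribution_scaledErrorMean (h : IsErrorModel P ε Sig) {n : ℕ → Fin a → ℕ}
    (hn : ∀ N, totalSize (n N) = N) {κ : Fin a → ℝ} (hκ : ∀ i, 0 < κ i)
    (hnκ : ∀ i, Tendsto (fun N => (n N i : ℝ) / N) atTop (𝓝 (κ i))) :
    TendstoInDistribution (fun N => scaledErrorMean ε (n N)) atTop id (fun _ => P)
      (multivariateGaussian 0 (limCovFull κ Sig)) := by
  refine ⟨fun N => (h.measurable_scaledErrorMean (n N)).aemeasurable, aemeasurable_id, ?_⟩
  refine ProbabilityMeasure.tendsto_iff_tendsto_charFun.2 fun t => ?_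
  simp only [ProbabilityMeasure.coe_mk, Measure.map_id]
  rw [charFun_multivariateGaussian (h.posSemidef_limCovFull hκ), dotProduct_limCovFull_mulVec]
  set τ : Fin a → ℝ := fun i => (fun j => t (j, i)) ⬝ᵥ Sig i *ᵥ (fun j => t (j, i)) with hτ
  have hs := fun i => tendsto_sqrt_div_groupSize (hκ i) (hnκ i)
  have hs2 : ∀ i, Tendsto (fun N => (n N i : ℝ) * (√(N : ℝ) / n N i) ^ 2) atTop (𝓝 (κ i)⁻¹) :=
    fun i => by
      simp_rw [mul_sqrt_div_sq]
      exact tendsto_div_groupSize (hκ i) (hnκ i)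
  have hbound : Tendsto (fun N => ∑ i, (∑ j, n N i *
      ∫ ω, rem₂ (√(N : ℝ) / n N i * (∑ l, |t (l, i)|) * ε i 0 ω j) ∂P
        + n N i * ((√(N : ℝ) / n N i) ^ 2 * τ i / 2) ^ 2)) atTop (𝓝 0) := by
    have h0 : (0 : ℝ) = ∑ _i : Fin a, (∑ _j : Fin d, (0 : ℝ) + 0) := by simp
    rw [h0]
    refine tendsto_finsetSum _ fun i _ => Tendsto.add (tendsto_finsetSum _ fun j _ => ?_) ?_
    · refine tendsto_mul_integral_rem₂ (L := (κ i)⁻¹ * (∑ l, |t (l, i)|) ^ 2) (h.memLp i 0 j)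
        (by simpa using (hs i).mul_const (∑ l, |t (l, i)|)) ?_
      simp_rw [mul_pow, ← mul_assoc]
      exact (hs2 i).mul_const _
    -- With `s = √N / n` the term is of order `n * s ^ 4 = (n * s ^ 2) * s ^ 2`, where the first
    -- factor converges and the second vanishes.
    · have h1 := ((hs2 i).mul ((hs i).pow 2)).mul_const ((τ i / 2) ^ 2)
      rw [zero_pow two_ne_zero, mul_zero, zero_mul] at h1
      refine h1.congr fun N => ?_
      ring
  have hexp : Tendsto (fun N => Complex.exp
      (-((∑ i, n N i * (√(N : ℝ) / n N i) ^ 2 * τ i) / 2 : ℝ))) atTop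
      (𝓝 (Complex.exp (-((∑ i, (κ i)⁻¹ * τ i) / 2 : ℝ)))) := by
    have h1 : Tendsto (fun N => (∑ i, n N i * (√(N : ℝ) / n N i) ^ 2 * τ i) / 2) atTop
        (𝓝 ((∑ i, (κ i)⁻¹ * τ i) / 2)) :=
      (tendsto_finsetSum _ fun i _ => (hs2 i).mul_const _).div_const _
    exact (Complex.continuous_exp.tendsto _).comp
      ((Complex.continuous_ofReal.tendsto _).comp h1).neg
  have hdiff : Tendsto (fun N => charFun (P.map (scaledErrorMean ε (n N))) t - Complex.exp
      (-((∑ i, n N i * (√(N : ℝ) / n N i) ^ 2 * τ i) / 2 : ℝ))) atTop (𝓝 0) := by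
    refine squeeze_zero_norm (fun N => ?_) hbound
    have := h.norm_charFun_scaledErrorMean_sub_le (n N) t τ fun i => rfl
    rwa [hn] at this
  have hsum := hdiff.add hexp
  simp only [sub_add_cancel, zero_add] at hsum
  convert hsum using 3
  simp [hτ]

end IsErrorModel

/-! ### Consistency of the empirical covariance matrices -/

lemma groupMean_observed {Ω : Type*} {a d : ℕ} (mean : Fin a → Fin d → ℝ)
    (ε : Fin a → ℕ → Ω → Fin d → ℝ) {n : Fin a → ℕ} {i : Fin a} (hn : 0 < n i) (ω : Ω)
    (j : Fin d) : groupMean (observed mean ε n ω) i j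
      = mean i j + (n i : ℝ)⁻¹ * ∑ k ∈ Finset.range (n i), ε i k ω j := by
  have : (n i : ℝ) ≠ 0 := by positivity
  simp only [groupMean, observed, Pi.add_apply, Finset.sum_add_distrib, Finset.sum_range]
  rw [mul_add]
  simp [this]

/-- The group mean of the observations carries the true mean, which cancels; what remains is the raw
second moment minus the product of the error means, corrected by `n / (n - 1)`. Both sides are `0`
for a single subject. -/
lemma empCov_observed {Ω : Type*} {a d : ℕ} (mean : Fin a → Fin d → ℝ)
    (ε : Fin a → ℕ → Ω → Fin d → ℝ) {n : Fin a → ℕ} {i : Fin a} (hn : 0 < n i) (ω : Ω)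
    (j j' : Fin d) : empCov (observed mean ε n ω) i j j' = (n i : ℝ) / (n i + -1) *
      ((n i : ℝ)⁻¹ * ∑ k ∈ Finset.range (n i), ε i k ω j * ε i k ω j'
        - ((n i : ℝ)⁻¹ * ∑ k ∈ Finset.range (n i), ε i k ω j)
          * ((n i : ℝ)⁻¹ * ∑ k ∈ Finset.range (n i), ε i k ω j')) := by
  have h0 : (n i : ℝ) ≠ 0 := by positivity
  set m := (n i : ℝ)⁻¹ * ∑ k ∈ Finset.range (n i), ε i k ω j with hm
  set m' := (n i : ℝ)⁻¹ * ∑ k ∈ Finset.range (n i), ε i k ω j' with hm'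
  have h1 : empCov (observed mean ε n ω) i j j' = ((n i : ℝ) - 1)⁻¹ *
      ∑ k ∈ Finset.range (n i), (ε i k ω j - m) * (ε i k ω j' - m') := by
    rw [← Fin.sum_univ_eq_sum_range (fun k => (ε i k ω j - m) * (ε i k ω j' - m'))]
    simp only [empCov, Matrix.smul_apply, Matrix.sum_apply, Matrix.vecMulVec_apply, Pi.sub_apply,
      groupMean_observed mean ε hn, smul_eq_mul]
    simp [observed, hm, hm']
  rw [h1]
  simp only [sub_mul, mul_sub, Finset.sum_sub_distrib, ← Finset.mul_sum, ← Finset.sum_mul,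
    Finset.sum_const, Finset.card_range, nsmul_eq_mul]
  have hs : ∑ k ∈ Finset.range (n i), ε i k ω j = n i * m := by rw [hm]; field_simp
  have hs' : ∑ k ∈ Finset.range (n i), ε i k ω j' = n i * m' := by rw [hm']; field_simp
  rw [hs, hs', ← sub_eq_add_neg]
  field_simp
  ring

namespace IsErrorModel

variable {Ω : Type*} [MeasurableSpace Ω] {a d : ℕ} {P : Measure Ω}
  {ε : Fin a → ℕ → Ω → Fin d → ℝ} {Sig : Fin a → Matrix (Fin d) (Fin d) ℝ}

lemma iIndepFun_comp (h : IsErrorModel P ε Sig) (i : Fin a) {g : (Fin d → ℝ) → ℝ}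
    (hg : Measurable g) : iIndepFun (fun k ω => g (ε i k ω)) P :=
  (h.indep.precomp (g := fun k : ℕ => (i, k)) (Prod.mk_right_injective i)).comp (fun _ => g)
    fun _ => hg

variable [IsProbabilityMeasure P]

/-- Mixed products of components need not be identically distributed over the subjects, so the weak
law is applied with the squares of both components as dominating variables. -/
lemma convInProb_average_mul (h : IsErrorModel P ε Sig) (i : Fin a) (j j' : Fin d) :
    ConvInProb P (fun n ω => (n : ℝ)⁻¹ * ∑ k ∈ Finset.range n, ε i k ω j * ε i k ω j')
      (Sig i j j') := by
  have hint : ∀ k c, ∀ l : Fin d, Integrable (fun ω => rem₁ (c * ε i k ω l ^ 2)) P :=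
    fun k c l => integrable_rem₁ (h.memLp i k l).integrable_sq c
  have hident : ∀ k c, ∀ l : Fin d, ∫ ω, rem₁ (c * ε i k ω l ^ 2) ∂P
      = ∫ ω, rem₁ (c * ε i 0 ω l ^ 2) ∂P := fun k c l =>
    ((h.ident i l k 0).comp (u := fun x => rem₁ (c * x ^ 2)) (by fun_prop)).integral_eq
  refine convInProb_average (h.iIndepFun_comp i (g := fun x => x j * x j') (by fun_prop))
    (fun k => h.integrable_mul i k j j') (fun k => h.integral_mul i k j j')
    (h.memLp i 0 j).integrable_sq (h.memLp i 0 j').integrable_sq fun k c => ?_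
  rw [← hident k, ← hident k, ← integral_add (hint k c j) (hint k c j')]
  exact integral_mono (integrable_rem₁ (h.integrable_mul i k j j') c)
    ((hint k c j).add (hint k c j')) fun ω => rem₁_mul_le _ _ _

lemma convInProb_average (h : IsErrorModel P ε Sig) (i : Fin a) (j : Fin d) :
    ConvInProb P (fun n ω => (n : ℝ)⁻¹ * ∑ k ∈ Finset.range n, ε i k ω j) 0 := by
  refine QFMCT.convInProb_average (h.iIndepFun_comp i (g := fun x => x j) (by fun_prop))
    (fun k => (h.memLp i k j).integrable one_le_two) (fun k => h.mean i k j)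
    ((h.memLp i 0 j).integrable one_le_two) (integrable_zero Ω ℝ P) fun k c => ?_
  refine le_add_of_le_of_nonneg (le_of_eq ?_) (integral_nonneg fun ω => rem₁_nonneg _)
  exact ((h.ident i j k 0).comp (u := fun x => rem₁ (c * x)) (by fun_prop)).integral_eq

variable {n : ℕ → Fin a → ℕ} {κ : Fin a → ℝ}

lemma convInProb_empCov (h : IsErrorModel P ε Sig) (mean : Fin a → Fin d → ℝ) {i : Fin a}
    (hn : Tendsto (fun N => n N i) atTop atTop) (j j' : Fin d) :
    ConvInProb P (fun N ω => empCov (observed mean ε (n N) ω) i j j') (Sig i j j') := by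
  have h1 : ConvInProb P (fun N (_ : Ω) => (n N i : ℝ) / (n N i + -1)) 1 :=
    ConvInProb.of_tendsto ((tendsto_natCast_div_add_atTop (-1 : ℝ)).comp hn)
  have h2 := h1.prodMk (((h.convInProb_average_mul i j j').prodMk
    ((h.convInProb_average i j).prodMk (h.convInProb_average i j'))).comp_tendsto hn)
  have h3 := h2.comp (f := fun p : ℝ × ℝ × ℝ × ℝ => p.1 * (p.2.1 - p.2.2.1 * p.2.2.2))
    (Continuous.continuousAt (by fun_prop))
  simp only [one_mul, mul_zero, sub_zero] at h3
  refine h3.congr ?_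
  filter_upwards [hn.eventually_gt_atTop 0] with N hN ω
  exact (empCov_observed mean ε hN ω j j').symm

lemma convInProb_empCovFull (h : IsErrorModel P ε Sig) (mean : Fin a → Fin d → ℝ)
    (hn : ∀ N, totalSize (n N) = N) (hκ : ∀ i, 0 < κ i)
    (hnκ : ∀ i, Tendsto (fun N => (n N i : ℝ) / N) atTop (𝓝 (κ i))) :
    ConvInProb P (fun N ω => empCovFull (observed mean ε (n N) ω)) (limCovFull κ Sig) := by
  refine ConvInProb.pi (F := fun _ => Fin d × Fin a → ℝ) fun p =>
    ConvInProb.pi (F := fun _ => ℝ) fun q => ?_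
  obtain ⟨j, i⟩ := p
  obtain ⟨j', i'⟩ := q
  have key : ConvInProb P (fun N ω => (N : ℝ) / n N i * empCov (observed mean ε (n N) ω) i j j')
      ((κ i)⁻¹ * Sig i j j') :=
    ((ConvInProb.of_tendsto (tendsto_div_groupSize (hκ i) (hnκ i))).prodMk
      (h.convInProb_empCov mean (tendsto_groupSize_atTop (hκ i) (hnκ i)) j j')).comp
      (f := fun p : ℝ × ℝ => p.1 * p.2) (Continuous.continuousAt (by fun_prop))
  rw [limCovFull_apply]
  simp_rw [empCovFull_apply, hn]
  by_cases hi : i = i'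
  · simp only [hi, if_true] at key ⊢
    refine key.congr (Eventually.of_forall fun N ω => ?_)
    ring
  · simp only [hi, if_false, mul_zero]
    exact ConvInProb.of_tendsto tendsto_const_nhds

lemma convInProb_mcParams (h : IsErrorModel P ε Sig) (mean : Fin a → Fin d → ℝ)
    (hn : ∀ N, totalSize (n N) = N) (hκ : ∀ i, 0 < κ i)
    (hnκ : ∀ i, Tendsto (fun N => (n N i : ℝ) / N) atTop (𝓝 (κ i)))
    {M : Matrix (Fin a) (Fin a) ℝ → Matrix (Fin a) (Fin a) ℝ → Matrix (Fin a) (Fin a) ℝ}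
    (hM : ∀ j, TendstoInProb P
      (fun N ω => M (centering a) (empCovComp (observed mean ε (n N) ω) j))
      (M (centering a) (limCovComp κ Sig j))) :
    ConvInProb P (fun N ω => mcParams M (observed mean ε (n N) ω))
      (fun j => (M (centering a) (limCovComp κ Sig j), limCovComp κ Sig j)) := by
  refine ConvInProb.pi (F := fun _ => (Fin a → Fin a → ℝ) × (Fin a → Fin a → ℝ)) fun j =>
    ConvInProb.prodMk (F := Fin a → Fin a → ℝ) (G := Fin a → Fin a → ℝ) ?_ ?_
  · exact ConvInProb.pi fun i => ConvInProb.pi fun i' =>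
      convInProb_iff_tendstoInMeasure.2 (hM j i i')
  · refine ConvInProb.pi fun i => ConvInProb.pi fun i' => ?_
    rw [limCovComp_apply]
    simp_rw [empCovComp_apply]
    exact (h.convInProb_empCovFull mean hn hκ hnκ).comp
      (f := fun A : Matrix (Fin d × Fin a) (Fin d × Fin a) ℝ => A (j, i) (j, i'))
      (Continuous.continuousAt (by fun_prop))

end IsErrorModel

section

/-! ### The limit distribution of the test statistics -/

variable {a d : ℕ}

lemma centering_mulVec_const (c : ℝ) : centering a *ᵥ (fun _ => c) = 0 := by
  ext i
  have : (a : ℝ) ≠ 0 := by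
    have := i.pos
    positivity
  simp [centering, Matrix.mulVec, dotProduct, sub_mul, Finset.sum_sub_distrib, Matrix.one_apply,
    this]

lemma quadForm_const_add (M S : Matrix (Fin a) (Fin a) ℝ) (c : ℝ) (u : Fin a → ℝ) :
    quadForm M S (fun i => c + u i) = quadForm M S u := by
  have : centering a *ᵥ (fun i => c + u i) = centering a *ᵥ u := by
    rw [show (fun i => c + u i) = (fun _ => c) + u from rfl, Matrix.mulVec_add,
      centering_mulVec_const, zero_add]
  rw [quadForm, quadForm, this]

/-- The matrices which enter the test statistics, for the estimates `S`. -/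
def testParams (M : Matrix (Fin a) (Fin a) ℝ → Matrix (Fin a) (Fin a) ℝ → Matrix (Fin a) (Fin a) ℝ)
    (S : Fin d → Matrix (Fin a) (Fin a) ℝ) : Params a d :=
  fun j => (M (centering a) (S j), S j)

variable {Ω : Type*} {M : Matrix (Fin a) (Fin a) ℝ → Matrix (Fin a) (Fin a) ℝ →
  Matrix (Fin a) (Fin a) ℝ} {mean : Fin a → Fin d → ℝ} {ε : Fin a → ℕ → Ω → Fin d → ℝ}

/-- Under the local hypothesis the test statistic is a quadratic form in the scaled means of the
errors. -/
lemma testStat_observed_eq {n : Fin a → ℕ} (hn : ∀ i, 0 < n i) {j : Fin d}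
    (hj : ∀ i i', mean i j = mean i' j) (S : Fin d → Matrix (Fin a) (Fin a) ℝ) (ω : Ω) :
    testStat M (S j) (observed mean ε n ω) j
      = quadForms (testParams M S) (scaledErrorMean ε n ω) j := by
  obtain ⟨c, hc⟩ : ∃ c, ∀ i, mean i j = c := by
    rcases isEmpty_or_nonempty (Fin a) with h | ⟨⟨i₀⟩⟩
    · exact ⟨0, fun i => h.elim i⟩
    · exact ⟨mean i₀ j, fun i => hj i i₀⟩
  have h1 : compMean (observed mean ε n ω) j
      = fun i => c + (n i : ℝ)⁻¹ * ∑ k ∈ Finset.range (n i), ε i k ω j := by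
    ext i
    rw [compMean, groupMean_observed mean ε (hn i), hc]
  -- The factor `N` in front of the statistic enters the quadratic form as `√N` in front of the
  -- means.
  have h2 := quadForm_smul (M (centering a) (S j)) (S j) √(totalSize n : ℝ)
    (fun i => (n i : ℝ)⁻¹ * ∑ k ∈ Finset.range (n i), ε i k ω j)
  rw [Real.sq_sqrt (Nat.cast_nonneg _)] at h2
  rw [testStat, h1, quadForm_const_add, ← h2]
  rfl

variable [MeasurableSpace Ω]

lemma measurable_observed (hε : ∀ i k, Measurable (ε i k)) (n : Fin a → ℕ) :
    Measurable (observed mean ε n) :=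
  measurable_pi_lambda _ fun i => measurable_pi_lambda _ fun k => (hε i k).const_add _

lemma measurable_testParams
    (hM : ∀ r s, Measurable
      (fun S : Fin a → Fin a → ℝ => M (centering a) (Matrix.of S) r s))
    {S : Fin d → Ω → Matrix (Fin a) (Fin a) ℝ}
    (hS : ∀ j r s, Measurable (fun ω => S j ω r s)) :
    Measurable fun ω => testParams M fun j => S j ω := by
  have h : ∀ j : Fin d, Measurable fun (ω : Ω) r s => S j ω r s :=
    fun j => measurable_pi_lambda _ fun r => measurable_pi_lambda _ fun s => hS j r s
  refine measurable_pi_lambda _ fun j => Measurable.prodMk ?_ (h j)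
  exact measurable_pi_lambda _ fun r => measurable_pi_lambda _ fun s => (hM r s).comp (h j)

lemma measurable_testStat {n : Fin a → ℕ} (hε : ∀ i k, Measurable (ε i k))
    (hM : ∀ r s, Measurable
      (fun S : Fin a → Fin a → ℝ => M (centering a) (Matrix.of S) r s))
    {S : Fin d → Ω → Matrix (Fin a) (Fin a) ℝ}
    (hS : ∀ j r s, Measurable (fun ω => S j ω r s)) :
    Measurable fun ω j => testStat M (S j ω) (observed mean ε n ω) j := by
  have hz : Measurable fun ω =>
      (WithLp.toLp 2 (fun q : Fin d × Fin a => groupMean (observed mean ε n ω) q.2 q.1) :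
        EuclideanSpace ℝ (Fin d × Fin a)) :=
    (WithLp.measurable_toLp 2 _).comp (measurable_pi_lambda _ fun q =>
      (measurable_groupMean q.2 q.1).comp (measurable_observed hε n))
  have h2 : Measurable ((fun p : EuclideanSpace ℝ (Fin d × Fin a) × Params a d =>
      quadForms p.2 p.1) ∘ fun ω => (_, testParams M fun j => S j ω)) :=
    measurable_quadForms.comp (hz.prodMk (measurable_testParams hM hS))
  exact measurable_pi_lambda _ fun j => ((measurable_pi_apply j).comp h2).const_mul _

lemma integral_mcTest_eq {P : Measure Ω} {n : Fin a → ℕ} (hε : ∀ i k, Measurable (ε i k))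
    (hM : ∀ r s, Measurable
      (fun S : Fin a → Fin a → ℝ => M (centering a) (Matrix.of S) r s))
    {S : Fin d → Ω → Matrix (Fin a) (Fin a) ℝ}
    (hS : ∀ j r s, Measurable (fun ω => S j ω r s)) {B : ℕ} (hB : 0 < B) {α : ℝ} (hα : 0 ≤ α)
    {Z : Ω → Fin B → EuclideanSpace ℝ (Fin d × Fin a)} (hZ : Measurable Z) (T : Finset (Fin d)) :
    ∫ ω, (mcTest T α M (fun j => S j ω) (observed mean ε n ω) (Z ω) : ℝ) ∂P
      = P.real {ω | ∃ j ∈ T, 1 < ratio (testStat M (S j ω) (observed mean ε n ω) j)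
          (critValue (fun b => mcStat M (observed mean ε n ω) (Z ω b)) α j)} := by
  have hQ := measurable_testStat (mean := mean) (n := n) hε hM hS
  have hY : Measurable fun ω b => mcStat M (observed mean ε n ω) (Z ω b) :=
    measurable_pi_lambda _ fun b => measurable_mcStat hM (measurable_observed hε n)
      ((measurable_pi_apply b).comp hZ)
  have hq : Measurable fun ω =>
      critValue (fun b => mcStat M (observed mean ε n ω) (Z ω b)) α :=
    measurable_pi_lambda _ fun j => by
      have h2 : Measurable ((fun y : Fin B → Fin d → ℝ => critValue y α j) ∘
        fun ω b => mcStat M (observed mean ε n ω) (Z ω b)) := (measurable_critValue hB hα j).comp hY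
      exact h2
  refine (integral_congr_ae (ae_of_all _ fun ω => ?_)).trans (integral_indicator_one
    ((hQ.prodMk hq) (measurableSet_exists_one_lt_ratio T)))
  simp only [mcTest]
  rw [maxReject_eq_indicator]
  rfl

/-- The distribution of the vector of test statistics converges to the distribution of the vector
of quadratic forms in a Gaussian vector, for the components with true local hypotheses. -/
lemma tendsto_measure_testStat_mem_exceed {P : Measure Ω} [IsProbabilityMeasure P]
    {Sig : Fin a → Matrix (Fin d) (Fin d) ℝ} (h : IsErrorModel P ε Sig) {n : ℕ → Fin a → ℕ}
    (hn : ∀ N, totalSize (n N) = N) {κ : Fin a → ℝ} (hκ : ∀ i, 0 < κ i)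
    (hnκ : ∀ i, Tendsto (fun N => (n N i : ℝ) / N) atTop (𝓝 (κ i)))
    (hM : ∀ r s, Measurable
      (fun S : Fin a → Fin a → ℝ => M (centering a) (Matrix.of S) r s))
    {S : ℕ → Fin d → Ω → Matrix (Fin a) (Fin a) ℝ}
    (hSm : ∀ N j r s, Measurable (fun ω => S N j ω r s))
    (hS : ∀ j, TendstoInProb P (fun N => S N j) (limCovComp κ Sig j))
    (hMS : ∀ j, TendstoInProb P (fun N ω => M (centering a) (S N j ω))
      (M (centering a) (limCovComp κ Sig j)))
    (hv : ∀ j, 0 < variance (M (centering a) (limCovComp κ Sig j)) (limCovComp κ Sig j))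
    (hν : RegularLimit ((multivariateGaussian 0 (limCovFull κ Sig)).map
      (quadForms (testParams M (limCovComp κ Sig)))))
    {T : Finset (Fin d)} (hT : ∀ j ∈ T, ∀ i i', mean i j = mean i' j) (t : Fin d → ℝ) :
    Tendsto (fun N => P.real {ω | (fun j => testStat M (S N j ω) (observed mean ε (n N) ω) j)
      ∈ exceed T t}) atTop (𝓝 (((multivariateGaussian 0 (limCovFull κ Sig)).map
        (quadForms (testParams M (limCovComp κ Sig)))).real (exceed T t))) := by
  have hparm : ∀ N, Measurable fun ω => testParams M fun j => S N j ω :=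
    fun N => measurable_testParams hM (hSm N)
  have hpar : TendstoInMeasure P (fun N ω => testParams M fun j => S N j ω) atTop
      (fun _ => testParams M (limCovComp κ Sig)) := by
    refine convInProb_iff_tendstoInMeasure.1 (ConvInProb.pi
      (F := fun _ => (Fin a → Fin a → ℝ) × (Fin a → Fin a → ℝ)) fun j =>
      ConvInProb.prodMk (F := Fin a → Fin a → ℝ) (G := Fin a → Fin a → ℝ) ?_ ?_)
    · exact ConvInProb.pi fun i => ConvInProb.pi fun i' =>
        convInProb_iff_tendstoInMeasure.2 (hMS j i i')
    · exact ConvInProb.pi fun i => ConvInProb.pi fun i' =>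
        convInProb_iff_tendstoInMeasure.2 (hS j i i')
  -- Slutsky: the scaled means and the random matrices converge jointly because the matrices have a
  -- constant limit.
  have hslutsky := (h.tendstoInDistribution_scaledErrorMean hn hκ
    hnκ).prodMk_of_tendstoInMeasure_const _ _ _ hpar fun N => (hparm N).aemeasurable
  have key := tendsto_measure_quadForms_mem_exceed hslutsky.tendsto rfl hv hν T t
  refine key.congr' ?_
  have hpos : ∀ᶠ N in atTop, ∀ i, 0 < n N i := eventually_all.2 fun i =>
    (tendsto_groupSize_atTop (hκ i) (hnκ i)).eventually_gt_atTop 0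
  filter_upwards [hpos] with N hN
  refine (map_measureReal_apply ((h.measurable_scaledErrorMean (n N)).prodMk (hparm N))
    (measurable_quadForms (measurableSet_exceed T t))).trans ?_
  congr 1
  ext ω
  -- `exceed T t` looks only at components in `T`, and only there does the statistic reduce to the
  -- errors; false hypotheses never enter.
  refine exists_congr fun j => and_congr_right fun hj => ?_
  have := testStat_observed_eq (M := M) (ε := ε) hN (hT j hj) (fun j => S N j ω) ω
  exact Eq.to_iff (congrArg (t j < ·) this.symm)

/-- The rejection probability for a set of true local hypotheses converges to a limit which is at
most the level, and equal to the level for the set of all hypotheses. -/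
theorem tendsto_integral_mcTest (hd : 1 ≤ d) {P : Measure Ω} [IsProbabilityMeasure P]
    {Sig : Fin a → Matrix (Fin d) (Fin d) ℝ} (h : IsErrorModel P ε Sig) {n : ℕ → Fin a → ℕ}
    (hn : ∀ N, totalSize (n N) = N) {κ : Fin a → ℝ} (hκ : ∀ i, 0 < κ i)
    (hnκ : ∀ i, Tendsto (fun N => (n N i : ℝ) / N) atTop (𝓝 (κ i)))
    (hM : ∀ r s, Measurable
      (fun S : Fin a → Fin a → ℝ => M (centering a) (Matrix.of S) r s))
    (hM_psd : ∀ S : Matrix (Fin a) (Fin a) ℝ, S.PosSemidef → (M (centering a) S).PosSemidef)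
    {S : ℕ → Fin d → Ω → Matrix (Fin a) (Fin a) ℝ}
    (hSm : ∀ N j r s, Measurable (fun ω => S N j ω r s))
    (hS : ∀ j, TendstoInProb P (fun N => S N j) (limCovComp κ Sig j))
    (hMS : ∀ j, TendstoInProb P (fun N ω => M (centering a) (S N j ω))
      (M (centering a) (limCovComp κ Sig j)))
    (hM_emp : ∀ j, TendstoInProb P
      (fun N ω => M (centering a) (empCovComp (observed mean ε (n N) ω) j))
      (M (centering a) (limCovComp κ Sig j)))
    (hv : ∀ j, 0 < variance (M (centering a) (limCovComp κ Sig j)) (limCovComp κ Sig j))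
    {α : ℝ} (hα : α ∈ Set.Ioo (0 : ℝ) 1) {B : ℕ → ℕ} (hB : Tendsto B atTop atTop)
    {Z : (N : ℕ) → Ω → Fin (B N) → EuclideanSpace ℝ (Fin d × Fin a)}
    (hZ_meas : ∀ N, Measurable (Z N))
    (hZ : ∀ N, ∀ᵐ x ∂(P.map (observed mean ε (n N))),
      condDistrib (Z N) (observed mean ε (n N)) P x
        = Measure.pi (fun _ : Fin (B N) => multivariateGaussian 0 (empCovFull x)))
    (T : Finset (Fin d)) (hT : ∀ j ∈ T, ∀ i i', mean i j = mean i' j) :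
    ∃ L ≤ α, (T = Finset.univ → L = α) ∧
      Tendsto (fun N => ∫ ω, (mcTest T α M (fun j => S N j ω)
        (observed mean ε (n N) ω) (Z N ω) : ℝ) ∂P) atTop (𝓝 L) := by
  set w := testParams M (limCovComp κ Sig) with hw
  have hpsd := h.posSemidef_limCovFull hκ
  have hwS : ∀ j i i', (w j).2 i i' = limCovFull κ Sig (j, i) (j, i') :=
    fun j i i' => limCovComp_apply κ Sig j i i'
  have hwp : ∀ j, (Matrix.of (w j).1).PosSemidef := fun j => by
    refine hM_psd _ ?_
    -- A principal submatrix of a positive semidefinite matrix is positive semidefinite, so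
    -- semidefiniteness of the matrix function applies at the limit.
    have : limCovComp κ Sig j = (limCovFull κ Sig).submatrix (fun i => (j, i)) fun i => (j, i) := by
      ext i i'
      exact limCovComp_apply κ Sig j i i'
    rw [this]
    exact hpsd.submatrix _
  have hν : RegularLimit ((multivariateGaussian 0 (limCovFull κ Sig)).map (quadForms w)) :=
    regularLimit_map_quadForms hd hpsd hwp hv hwS
  have hprob := Measure.isProbabilityMeasure_map (μ := multivariateGaussian 0 (limCovFull κ Sig))
    (continuous_quadForms w).measurable.aemeasurable
  have hobs := fun N => measurable_observed (mean := mean) h.meas (n N)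
  have hY := empConsistent_mcStat hd P n hobs hM hpsd hwp hv hwS
    (h.convInProb_empCovFull mean hn hκ hnκ)
    (h.convInProb_mcParams mean hn hκ hnκ hM_emp) hB hZ_meas hZ
  obtain ⟨L, hL, hLT, hlim⟩ := hY.tendsto_measure_reject hd hν hB hα T
    (tendsto_measure_testStat_mem_exceed h hn hκ hnκ hM hSm hS hMS hv hν hT)
  refine ⟨L, hL, hLT, hlim.congr' ?_⟩
  filter_upwards [hB.eventually_gt_atTop 0] with N hN
  exact (integral_mcTest_eq h.meas hM (hSm N) hN hα.1.le (hZ_meas N) T).symm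

end

end QFMCT

end

theorem mainTheorem8
    {a d : ℕ} (ha : 2 ≤ a) (hd : 1 ≤ d)
    {Ω : Type*} [MeasurableSpace Ω] (P : Measure Ω) [IsProbabilityMeasure P]
    -- the model: independent errors; within a group each component is identically distributed,
    -- centred and square integrable, and the covariance matrix does not depend on the subject
    (mean : Fin a → Fin d → ℝ)
    (ε : Fin a → ℕ → Ω → Fin d → ℝ)
    (hε_meas : ∀ i k, Measurable (ε i k))
    (hε_indep : iIndepFun (fun p : Fin a × ℕ => ε p.1 p.2) P)
    (hε_ident : ∀ i j k k', IdentDistrib (fun ω => ε i k ω j) (fun ω => ε i k' ω j) P P)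
    (hε_sq : ∀ i k j, MemLp (fun ω => ε i k ω j) 2 P)
    (hε_mean : ∀ i k j, ∫ ω, ε i k ω j ∂P = 0)
    (Sig : Fin a → Matrix (Fin d) (Fin d) ℝ)
    (hε_cov : ∀ i k j j', cov[fun ω => ε i k ω j, fun ω => ε i k ω j'; P] = Sig i j j')
    -- the group sizes
    (n : ℕ → Fin a → ℕ) (hn : ∀ N, ∑ i, n N i = N)
    (κ : Fin a → ℝ) (hκ : ∀ i, κ i ∈ Set.Ioc (0 : ℝ) 1)
    (hnκ : ∀ i, Tendsto (fun N => (n N i : ℝ) / N) atTop (𝓝 (κ i)))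
    -- the matrix function of the quadratic form and the covariance estimators
    (M : Matrix (Fin a) (Fin a) ℝ → Matrix (Fin a) (Fin a) ℝ → Matrix (Fin a) (Fin a) ℝ)
    (hM_meas : ∀ r s, Measurable
      (fun S : Fin a → Fin a → ℝ => M (QFMCT.centering a) (Matrix.of S) r s))
    (hM_psd : ∀ S : Matrix (Fin a) (Fin a) ℝ, S.PosSemidef → (M (QFMCT.centering a) S).PosSemidef)
    (S : ℕ → Fin d → Ω → Matrix (Fin a) (Fin a) ℝ)
    (hS_meas : ∀ N j r s, Measurable (fun ω => S N j ω r s))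
    (hS : ∀ j, QFMCT.TendstoInProb P (fun N => S N j) (QFMCT.limCovComp κ Sig j))
    (hMS : ∀ j, QFMCT.TendstoInProb P (fun N ω => M (QFMCT.centering a) (S N j ω))
      (M (QFMCT.centering a) (QFMCT.limCovComp κ Sig j)))
    (hM_emp : ∀ j, QFMCT.TendstoInProb P
      (fun N ω => M (QFMCT.centering a)
        (QFMCT.empCovComp (QFMCT.observed mean ε (n N) ω) j))
      (M (QFMCT.centering a) (QFMCT.limCovComp κ Sig j)))
    (hv : ∀ j, 0 < QFMCT.variance
      (M (QFMCT.centering a) (QFMCT.limCovComp κ Sig j)) (QFMCT.limCovComp κ Sig j))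
    -- the level, the numbers of replicates, and the Monte-Carlo draws, which given the data of
    -- total sample size `N` are independent with the centred normal distribution whose covariance
    -- matrix is the empirical one
    (α : ℝ) (hα : α ∈ Set.Ioo (0 : ℝ) 1)
    (B : ℕ → ℕ) (hB : Tendsto B atTop atTop)
    (Z : (N : ℕ) → Ω → Fin (B N) → EuclideanSpace ℝ (Fin d × Fin a))
    (hZ_meas : ∀ N, Measurable (Z N))
    (hZ : ∀ N, ∀ᵐ x ∂(P.map (QFMCT.observed mean ε (n N))),
      condDistrib (Z N) (QFMCT.observed mean ε (n N)) P x
        = Measure.pi (fun _ : Fin (B N) => multivariateGaussian 0 (QFMCT.empCovFull x))) :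
    ((∀ i i', mean i = mean i') →
      Tendsto (fun N => ∫ ω, (QFMCT.mcTest Finset.univ α M (fun j => S N j ω)
        (QFMCT.observed mean ε (n N) ω) (Z N ω) : ℝ) ∂P) atTop (𝓝 α)) ∧
    (∀ T : Finset (Fin d), (∀ j ∈ T, ∀ i i', mean i j = mean i' j) →
      ∃ L : ℝ, L ≤ α ∧
        Tendsto (fun N => ∫ ω, (QFMCT.mcTest T α M (fun j => S N j ω)
          (QFMCT.observed mean ε (n N) ω) (Z N ω) : ℝ) ∂P) atTop (𝓝 L)) :=  by
  have h : QFMCT.IsErrorModel P ε Sig :=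
    ⟨hε_meas, hε_indep, hε_ident, hε_sq, hε_mean, hε_cov⟩
  have key := QFMCT.tendsto_integral_mcTest hd h hn (fun i => (hκ i).1) hnκ hM_meas hM_psd hS_meas
    hS hMS hM_emp hv hα hB hZ_meas hZ
  refine ⟨fun hmean => ?_, fun T hT => ?_⟩
  · obtain ⟨L, -, hL, hlim⟩ := key Finset.univ fun j _ i i' => congrFun (hmean i i') j
    rwa [hL rfl] at hlim
  · obtain ⟨L, hL, -, hlim⟩ := key T hT
    exact ⟨L, hL, hlim⟩
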